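/- **Setting.** Let $K\ge 1$ agents minimize over $x\in\mathbb R^{d_1}$ and maximize over $y\in\mathbb R^{d_2}$ the function $J(x,y)=\frac1K\sum_{k=1}^K J_k(x,y)$, where either $J_k(x,y)=\mathbb E_{\zeta\sim\mathcal D_k}Q_k(x,y;\zeta)$ (online, $\mathbb I=1$) or $J_k(x,y)=\frac1{N_k}\sum_{s=1}^{N_k}Q_k(x,y;\zeta_k(s))$ (offline, $\mathbb I=0$; then $\mathcal D_k$ denotes the uniform law on the local data $\zeta_k(1),\dots,\zeta_k(N_k)$). The losses $Q_k(\cdot,\cdot;\zeta)$ and the risks $J_k$ are differentiable, the $Q_k(x,y;\zeta)$ are integrable and the partial gradients of $Q_k$ are measurable and square integrable in $\zeta\sim\mathcal D_k$. **Assumptions.** (1) For every $x$, $J(x,\cdot)$ attains its maximum $P(x)=\max_yJ(x,y)$ and $\|\nabla_yJ(x,y)\|^2\ge 2\nu(P(x)-J(x,y))$ for all $y$, with $\nu>0$; $P^\star=\inf_xP(x)>-\infty$. (2) For $w\in\{x,y\}$, all $k$ and all $x_1,x_2,y_1,y_2$: $\mathbb E_{\zeta\sim\mathcal D_k}\|\nabla_wQ_k(x_1,y_1;\zeta)-\nabla_wQ_k(x_2,y_2;\zeta)\|^2\le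 L_f^2(\|x_1-x_2\|^2+\|y_1-y_2\|^2)$; put $\kappa=L_f/\nu$ and assume $\kappa\ge1$ (automatic unless $J$ does not depend on $y$). (3) For $w\in\{x,y\}$ and all $k,x,y$: $\mathbb E_{\zeta\sim\mathcal D_k}\nabla_wQ_k(x,y;\zeta)=\nabla_wJ_k(x,y)$ and $\mathbb E_{\zeta\sim\mathcal D_k}\|\nabla_wQ_k(x,y;\zeta)-\nabla_wJ_k(x,y)\|^2\le\sigma^2$. (4) $W\in\mathbb R^{K\times K}$ is symmetric and doubly stochastic. For $w\in\{x,y\}$ there are matrices $A_w,B_w,C_w\in\mathbb R^{K\times K}$ such that $A_w,C_w,B_w^2$ are polynomials in $W$, $A_w\mathbf 1=C_w\mathbf 1=\mathbf 1$, $B_w$ is symmetric, commutes with $W$ and has null space $\mathrm{span}\{\mathbf 1\}$; the design matrices are $\mathcal A_w=A_w\otimes I$, $\mathcal B_w=B_w\otimes I$, $\mathcal C_w=C_w\otimes I$ (with $I=I_{d_1}$ for $w=x$ and $I=I_{d_2}$ for $w=y$). **Network constants.** For $w\in\{x,y\}$ let $\widehat U_w\in\mathbb R^{K\times(K-1)}$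 have as columns an orthonormal basis of $\mathbf 1^\perp$ of common eigenvectors of $A_w,B_w,C_w$, let $\widehat\Lambda_{a_w},\widehat\Lambda_{b_w},\widehat\Lambda_{c_w}$ be the corresponding diagonal eigenvalue matrices, each $\otimes I$, and let $$\begin{bmatrix}\widehat\Lambda_{a_w}\widehat\Lambda_{c_w}-\widehat\Lambda_{b_w}^2&-\widehat\Lambda_{b_w}\\ \widehat\Lambda_{b_w}&I\end{bmatrix}=\widehat{\mathcal Q}_w\mathcal T_w\widehat{\mathcal Q}_w^{-1}$$ be any real similarity transformation such that $\rho:=\max\{\|\mathcal T_x\|,\|\mathcal T_y\|\}<1$ (spectral norms). Put $\lambda_a=\max\{\|\widehat\Lambda_{a_x}\|,\|\widehat\Lambda_{a_y}\|\}$, $1/\underline{\lambda_b}=\max\{\|\widehat\Lambda_{b_x}^{-1}\|,\|\widehat\Lambda_{b_y}^{-1}\|\}$, $v_1=\max\{\|\widehat{\mathcal Q}_x\|,\|\widehat{\mathcal Q}_y\|\}$, $v_2=\max\{\|\widehat{\mathcal Q}_x^{-1}\|,\|\widehat{\mathcal Q}_y^{-1}\|\}$, $v=v_1v_2$. **Algorithm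 (DAMA with GRACE).** Starting from identical local models and identical local dual variables, for $i\ge0$ $$\mathcal X_{i+1}=\mathcal A_x(\mathcal C_x\mathcal X_i-\mu_x\mathcal M_{x,i})-\mathcal B_x\mathcal D_{x,i},\quad \mathcal D_{x,i+1}=\mathcal D_{x,i}+\mathcal B_x\mathcal X_{i+1},$$ $$\mathcal Y_{i+1}=\mathcal A_y(\mathcal C_y\mathcal Y_i+\mu_y\mathcal M_{y,i})-\mathcal B_y\mathcal D_{y,i},\quad \mathcal D_{y,i+1}=\mathcal D_{y,i}+\mathcal B_y\mathcal Y_{i+1}.$$ Here $\mathcal M_{w,i}=\mathrm{col}\{g^w_{k,i}\}_{k=1}^K$; $g^w_{k,0}$ averages $\nabla_wQ_k$ at the initial point over $b_0$ samples; for $i\ge1$ a Bernoulli($p$) flag $\pi_i$ common to all agents is drawn. If $\pi_i=1$, then $g^w_{k,i}$ is the average of $\nabla_wQ_k(x_{k,i},y_{k,i};\cdot)$ over $B$ samples (online), or over all local data (offline). If $\pi_i=0$, then $$g^w_{k,i}=(1-\beta)\Big(g^w_{k,i-1}-\tfrac1b\sum_{\xi}\nabla_wQ_k(x_{k,i-1},y_{k,i-1};\xi)\Big)+\tfrac1b\sum_{\xi}\nabla_wQ_k(x_{k,i},y_{k,i};\xi)$$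 with $b$ samples $\xi$, the same in both sums. The samples of agent $k$ have law $\mathcal D_k$; all samples and flags are independent. **Hyperparameters.** Let $\bar\beta=p+\beta-p\beta$, $\beta'=p+\beta^2$, $L=L_f+\kappa L_f/2$, $\mu_x,\mu_y>0$, $0\le\beta\le1$, $p\ge0$, $b,b_0,B\ge1$ integers, and assume $$\mu_x\le\min\Big\{\tfrac1{32L},\tfrac{\mu_y}{16\kappa^2},\tfrac{\sqrt{Kb\bar\beta}}{24\sqrt3\kappa L_f}\Big\},$$ $$\mu_y\le\min\Big\{\tfrac1\nu,\tfrac1{2L_f},\tfrac{\sqrt{Kb\bar\beta}}{12L_f},\tfrac{(1-\rho)\underline{\lambda_b}}{\sqrt{620}L_fv\lambda_a},\tfrac{(1-\rho)\underline{\lambda_b}}{12L_fv\lambda_a},\tfrac{(1-\rho)\underline{\lambda_b}}{24L_fv\lambda_a}\sqrt{\tfrac{b\bar\beta}{\beta'}},\tfrac{(1-\rho)^{2/3}\underline{\lambda_b}^{2/3}(bK\bar\beta)^{1/3}}{90L_f\kappa^{1/3}v^{2/3}\lambda_a^{2/3}}\Big\},$$ $$\bar\beta\le\tfrac{\nu\mu_y}2,\quad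 b\bar\beta\le\tfrac1K,\quad p+\beta\le1,\quad \beta+bp\le b,\quad \bar\beta\le1$$ (a bound on $\mu_y$ with $\lambda_a$ in its denominator is void if $\lambda_a=0$). **Claim.** There is an absolute constant $C$ such that, in this setting and for every $T\ge1$, with $x_{c,i}=\frac1K\sum_kx_{k,i}$, $y_{c,i}=\frac1K\sum_ky_{k,i}$, $G_{p,0}=P(x_{c,0})-P^\star$, $\Delta_{c,0}=P(x_{c,0})-J(x_{c,0},y_{c,0})$ and $\zeta_0^2=\sum_{w\in\{x,y\}}\frac1K\mathbb E\|(\mathcal A_w-\frac1K\mathbf 1\mathbf 1^\top\otimes I)\mathcal M_{w,0}\|^2$, the expectations on the left-hand side below are finite and $$\frac1T\sum_{i=0}^{T-1}\Big(\mathbb E\|\nabla_xJ(x_{c,i},y_{c,i})\|^2+\mathbb E\|\nabla_yJ(x_{c,i},y_{c,i})\|^2\Big)\le C\Big(\frac{\mathbb EG_{p,0}}{T\mu_x}+\frac{\kappa^2\mathbb E\Delta_{c,0}}{T\mu_y}+\frac{\kappa^2(v^2a'+v^4c'\mu_y^2+v^2f')\mu_y^2\zeta_0^2}{T}+\frac{\kappa^2v^2b'\mu_y^2\sigma^2}{T}+\kappa^2(v^2d'\mu_y^2+e')\sigma^2\Big),$$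 where $$a'=\frac{L_f^2}{bK\bar\beta(1-\rho)\underline{\lambda_b}^2},\quad b'=\frac{L_f^2\lambda_a^2\beta'}{bb_0K\bar\beta^2(1-\rho)^2\underline{\lambda_b}^2},\quad c'=\frac{L_f^4\lambda_a^2\beta'}{b^2K\bar\beta^2(1-\rho)^2\underline{\lambda_b}^4},$$ $$d'=\frac{L_f^2\lambda_a^2}{bK\bar\beta(1-\rho)^2\underline{\lambda_b}^2}\Big(\frac pB\mathbb I+\frac{\beta^2}b\Big),\quad e'=\frac1{b_0\bar\beta KT}+\frac{\beta^2}{Kb\bar\beta}+\frac p{KB\bar\beta}\mathbb I,\quad f'=\frac{L_f^2}{bK\bar\beta\underline{\lambda_b}^2}.$$ -/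

import Mathlib

open MeasureTheory ProbabilityTheory

noncomputable section

namespace DAMA

/-! ### Block vectors and matrices -/

/-- `ℝ^d` with the Euclidean norm. -/
abbrev Vec (d : ℕ) := EuclideanSpace ℝ (Fin d)

/-- Network block vectors `col{v_1, …, v_K} ∈ ℝ^{Kd}`. -/
abbrev Block (K d : ℕ) := Fin K → Vec d

/-- Squared Euclidean norm of a block vector. -/
def blockNormSq {K d : ℕ} (v : Block K d) : ℝ := ∑ k, ‖v k‖ ^ 2

/-- The network centroid `(1/K) ∑_k v_k`. -/
def centroid {K d : ℕ} (v : Block K d) : Vec d := (K : ℝ)⁻¹ • ∑ k, v k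

/-- The product `(M ⊗ I_d) v`. -/
def act {K d : ℕ} (M : Matrix (Fin K) (Fin K) ℝ) (v : Block K d) : Block K d :=
  fun k => ∑ l, M k l • v l

/-- The averaging matrix `(1/K) 𝟙 𝟙ᵀ`. -/
def avgMatrix (K : ℕ) : Matrix (Fin K) (Fin K) ℝ := Matrix.of fun _ _ => (K : ℝ)⁻¹

/-- The spectral norm of a square real matrix. -/
def specNorm {n : Type*} [Fintype n] [DecidableEq n] (M : Matrix n n ℝ) : ℝ :=
  ‖Matrix.toEuclideanCLM (n := n) (𝕜 := ℝ) M‖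

/-! ### The stochastic minimax problem -/

/-- The two learning scenarios: streaming data with law `D k` at agent `k`, or a finite local
data set `ζ k 0, …, ζ k (N k - 1)` at agent `k`. -/
inductive DataModel (K : ℕ) (Ξ : Type*) [MeasurableSpace Ξ] where
  | online (D : Fin K → ProbabilityMeasure Ξ)
  | offline (N : Fin K → ℕ) (hN : ∀ k, 0 < N k) (ζ : (k : Fin K) → Fin (N k) → Ξ)

/-- The law of one random sample of agent `k`: `D k`, or the uniform law on the local data. -/
def DataModel.law {K : ℕ} {Ξ : Type*} [MeasurableSpace Ξ] :
    DataModel K Ξ → Fin K → Measure Ξ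
  | .online D, k => (D k : Measure Ξ)
  | .offline N _ ζ, k => (N k : ENNReal)⁻¹ • ∑ s, Measure.dirac (ζ k s)

/-- The indicator of the online scenario. -/
def DataModel.onlineIndicator {K : ℕ} {Ξ : Type*} [MeasurableSpace Ξ] : DataModel K Ξ → ℝ
  | .online _ => 1
  | .offline _ _ _ => 0

/-- A distributed minimax problem with `K` agents: data and local losses `Q k x y ξ`. -/
structure Problem (K d₁ d₂ : ℕ) (Ξ : Type*) [MeasurableSpace Ξ] where
  data : DataModel K Ξ
  Q : Fin K → Vec d₁ → Vec d₂ → Ξ → ℝ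

section Problem

variable {K d₁ d₂ : ℕ} {Ξ : Type*} [MeasurableSpace Ξ]

/-- `∇ₓ Q_k(x, y; s)`. -/
def Problem.gradQx (prob : Problem K d₁ d₂ Ξ) (k : Fin K) (x : Vec d₁) (y : Vec d₂) (s : Ξ) :
    Vec d₁ :=
  gradient (fun x' => prob.Q k x' y s) x

/-- `∇_y Q_k(x, y; s)`. -/
def Problem.gradQy (prob : Problem K d₁ d₂ Ξ) (k : Fin K) (x : Vec d₁) (y : Vec d₂) (s : Ξ) :
    Vec d₂ :=
  gradient (fun y' => prob.Q k x y' s) y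

/-- The local risk `J_k`. -/
def Problem.localRisk (prob : Problem K d₁ d₂ Ξ) (k : Fin K) (x : Vec d₁) (y : Vec d₂) : ℝ :=
  match prob.data with
  | .online D => ∫ s, prob.Q k x y s ∂(D k : Measure Ξ)
  | .offline N _ ζ => (N k : ℝ)⁻¹ * ∑ s, prob.Q k x y (ζ k s)

/-- The global risk `J = (1/K) ∑_k J_k`. -/
def Problem.J (prob : Problem K d₁ d₂ Ξ) (x : Vec d₁) (y : Vec d₂) : ℝ :=
  (K : ℝ)⁻¹ * ∑ k, prob.localRisk k x y

/-- `∇ₓ J(x, y)`. -/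
def Problem.gradJx (prob : Problem K d₁ d₂ Ξ) (x : Vec d₁) (y : Vec d₂) : Vec d₁ :=
  gradient (fun x' => prob.J x' y) x

/-- `∇_y J(x, y)`. -/
def Problem.gradJy (prob : Problem K d₁ d₂ Ξ) (x : Vec d₁) (y : Vec d₂) : Vec d₂ :=
  gradient (fun y' => prob.J x y') y

/-- `P(x) = max_y J(x, y)`; the maximum is attained under `PLCondition`. -/
def Problem.P (prob : Problem K d₁ d₂ Ξ) (x : Vec d₁) : ℝ := ⨆ y, prob.J x y

/-- `P⋆ = inf_x P(x)`; `P` is bounded below under `PLCondition`. -/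
def Problem.Pstar (prob : Problem K d₁ d₂ Ξ) : ℝ := ⨅ x, prob.P x

/-- The risks and their gradients are well defined: losses and risks are differentiable, the
losses are integrable, the stochastic gradients are measurable and square integrable. -/
structure Problem.Regular (prob : Problem K d₁ d₂ Ξ) : Prop where
  diff_Q : ∀ k s, Differentiable ℝ fun z : Vec d₁ × Vec d₂ => prob.Q k z.1 z.2 s
  diff_J : ∀ k, Differentiable ℝ fun z : Vec d₁ × Vec d₂ => prob.localRisk k z.1 z.2
  integrable_Q : ∀ k x y, Integrable (prob.Q k x y) (prob.data.law k)
  measurable_x : ∀ k, Measurable fun z : (Vec d₁ × Vec d₂) × Ξ => prob.gradQx k z.1.1 z.1.2 z.2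
  measurable_y : ∀ k, Measurable fun z : (Vec d₁ × Vec d₂) × Ξ => prob.gradQy k z.1.1 z.1.2 z.2
  memLp_x : ∀ k x y, MemLp (prob.gradQx k x y) 2 (prob.data.law k)
  memLp_y : ∀ k x y, MemLp (prob.gradQy k x y) 2 (prob.data.law k)

/-- `J(x, ·)` attains its maximum and satisfies the Polyak–Łojasiewicz condition with constant
`ν`, for every `x`; the envelope `P` is bounded below. -/
structure Problem.PLCondition (prob : Problem K d₁ d₂ Ξ) (ν : ℝ) : Prop where
  pos : 0 < ν
  attained : ∀ x, ∃ y₀, ∀ y, prob.J x y ≤ prob.J x y₀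
  pl : ∀ x y, 2 * ν * (prob.P x - prob.J x y) ≤ ‖prob.gradJy x y‖ ^ 2
  bddBelow : BddBelow (Set.range prob.P)

/-- Expected smoothness: each partial stochastic gradient is Lipschitz in mean square. -/
structure Problem.ExpectedSmooth (prob : Problem K d₁ d₂ Ξ) (Lf : ℝ) : Prop where
  pos : 0 < Lf
  smooth_x : ∀ k x₁ y₁ x₂ y₂,
    ∫ s, ‖prob.gradQx k x₁ y₁ s - prob.gradQx k x₂ y₂ s‖ ^ 2 ∂(prob.data.law k)
      ≤ Lf ^ 2 * (‖x₁ - x₂‖ ^ 2 + ‖y₁ - y₂‖ ^ 2)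
  smooth_y : ∀ k x₁ y₁ x₂ y₂,
    ∫ s, ‖prob.gradQy k x₁ y₁ s - prob.gradQy k x₂ y₂ s‖ ^ 2 ∂(prob.data.law k)
      ≤ Lf ^ 2 * (‖x₁ - x₂‖ ^ 2 + ‖y₁ - y₂‖ ^ 2)

/-- Each partial stochastic gradient is unbiased with variance at most `σ²`. -/
structure Problem.BoundedVariance (prob : Problem K d₁ d₂ Ξ) (σ : ℝ) : Prop where
  unbiased_x : ∀ k x y,
    ∫ s, prob.gradQx k x y s ∂(prob.data.law k) = gradient (fun x' => prob.localRisk k x' y) x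
  unbiased_y : ∀ k x y,
    ∫ s, prob.gradQy k x y s ∂(prob.data.law k) = gradient (fun y' => prob.localRisk k x y') y
  variance_x : ∀ k x y,
    ∫ s, ‖prob.gradQx k x y s - gradient (fun x' => prob.localRisk k x' y) x‖ ^ 2 ∂(prob.data.law k)
      ≤ σ ^ 2
  variance_y : ∀ k x y,
    ∫ s, ‖prob.gradQy k x y s - gradient (fun y' => prob.localRisk k x y') y‖ ^ 2 ∂(prob.data.law k)
      ≤ σ ^ 2

end Problem

/-! ### Design matrices and network constants -/

/-- The `K × K` matrices `A, B, C` of one recursion; the design matrices acting on `ℝ^{Kd}` are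
`A ⊗ I_d`, `B ⊗ I_d`, `C ⊗ I_d`. -/
structure Design (K : ℕ) where
  A : Matrix (Fin K) (Fin K) ℝ
  B : Matrix (Fin K) (Fin K) ℝ
  C : Matrix (Fin K) (Fin K) ℝ

/-- Conditions on the design matrices relative to the combination matrix `W`. -/
structure Design.Admissible {K : ℕ} (D : Design K) (W : Matrix (Fin K) (Fin K) ℝ) : Prop where
  A_poly : ∃ q : Polynomial ℝ, D.A = Polynomial.aeval W q
  C_poly : ∃ q : Polynomial ℝ, D.C = Polynomial.aeval W q
  B_sq_poly : ∃ q : Polynomial ℝ, D.B * D.B = Polynomial.aeval W q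
  B_symm : D.B.IsSymm
  B_comm : Commute D.B W
  A_one : D.A.mulVec 1 = 1
  C_one : D.C.mulVec 1 = 1
  B_null : ∀ v : Fin K → ℝ, D.B.mulVec v = 0 ↔ ∃ t : ℝ, v = fun _ => t

/-- The eigen-structure of a design in block dimension `d`: the columns of `U` are an orthonormal
basis of `𝟙^⊥` consisting of common eigenvectors of `A, B, C`, with eigenvalues `a, b, c`, and
the transition matrix of the transformed recursion is written as `Q T Q⁻¹`. -/
structure Spectral {K : ℕ} (D : Design K) (d : ℕ) where
  U : Matrix (Fin K) (Fin (K - 1)) ℝ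
  a : Fin (K - 1) → ℝ
  b : Fin (K - 1) → ℝ
  c : Fin (K - 1) → ℝ
  Q : Matrix ((Fin (K - 1) ⊕ Fin (K - 1)) × Fin d) ((Fin (K - 1) ⊕ Fin (K - 1)) × Fin d) ℝ
  T : Matrix ((Fin (K - 1) ⊕ Fin (K - 1)) × Fin d) ((Fin (K - 1) ⊕ Fin (K - 1)) × Fin d) ℝ
  U_orth : U.transpose * U = 1
  U_proj : U * U.transpose = 1 - avgMatrix K
  A_eig : D.A * U = U * Matrix.diagonal a
  B_eig : D.B * U = U * Matrix.diagonal b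
  C_eig : D.C * U = U * Matrix.diagonal c
  Q_unit : IsUnit Q.det
  similarity :
    Matrix.kronecker
      (Matrix.fromBlocks (Matrix.diagonal fun i => a i * c i - b i ^ 2) (-Matrix.diagonal b)
        (Matrix.diagonal b) 1) (1 : Matrix (Fin d) (Fin d) ℝ) = Q * T * Q⁻¹

section Constants

variable {K d₁ d₂ : ℕ} {Dx Dy : Design K}

/-- The diagonal matrix `Λ̂_a ∈ ℝ^{(K-1)d × (K-1)d}`. -/
def Spectral.LamA {d : ℕ} {D : Design K} (S : Spectral D d) :
    Matrix (Fin (K - 1) × Fin d) (Fin (K - 1) × Fin d) ℝ :=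
  Matrix.diagonal fun i => S.a i.1

/-- The diagonal matrix `Λ̂_b ∈ ℝ^{(K-1)d × (K-1)d}`. -/
def Spectral.LamB {d : ℕ} {D : Design K} (S : Spectral D d) :
    Matrix (Fin (K - 1) × Fin d) (Fin (K - 1) × Fin d) ℝ :=
  Matrix.diagonal fun i => S.b i.1

/-- `ρ = max{‖T_x‖, ‖T_y‖}`. -/
def rho (Sx : Spectral Dx d₁) (Sy : Spectral Dy d₂) : ℝ := max (specNorm Sx.T) (specNorm Sy.T)

/-- `λ_a = max{‖Λ̂_{a_x}‖, ‖Λ̂_{a_y}‖}`. -/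
def lamA (Sx : Spectral Dx d₁) (Sy : Spectral Dy d₂) : ℝ :=
  max (specNorm Sx.LamA) (specNorm Sy.LamA)

/-- `1/λ_b = max{‖Λ̂_{b_x}⁻¹‖, ‖Λ̂_{b_y}⁻¹‖}`. -/
def lamBInv (Sx : Spectral Dx d₁) (Sy : Spectral Dy d₂) : ℝ :=
  max (specNorm Sx.LamB⁻¹) (specNorm Sy.LamB⁻¹)

/-- `v₁ = max{‖Q_x‖, ‖Q_y‖}`. -/
def v₁ (Sx : Spectral Dx d₁) (Sy : Spectral Dy d₂) : ℝ := max (specNorm Sx.Q) (specNorm Sy.Q)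

/-- `v₂ = max{‖Q_x⁻¹‖, ‖Q_y⁻¹‖}`. -/
def v₂ (Sx : Spectral Dx d₁) (Sy : Spectral Dy d₂) : ℝ :=
  max (specNorm Sx.Q⁻¹) (specNorm Sy.Q⁻¹)

end Constants

/-! ### The algorithm -/

/-- Hyperparameters: step sizes, smoothing factor (common to both variables), Bernoulli parameter,
initial batch size, large batch size, minibatch size. -/
structure Hyper where
  μx : ℝ
  μy : ℝ
  β : ℝ
  p : ℝ
  b₀ : ℕ
  B : ℕ
  b : ℕ

/-- `β̄ = p + β - pβ`. -/
def Hyper.βbar (h : Hyper) : ℝ := h.p + h.β - h.p * h.β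

/-- `β' = p + β²`. -/
def Hyper.β' (h : Hyper) : ℝ := h.p + h.β ^ 2

/-- Labels of the random samples: `init k j` is the `j`-th sample of the initial batch of agent
`k`, `large i k j` and `mini i k j` are those of the large batch and the minibatch of round `i`. -/
inductive SampleIdx (K : ℕ) (h : Hyper) where
  | init (k : Fin K) (j : Fin h.b₀)
  | large (i : ℕ) (k : Fin K) (j : Fin h.B)
  | mini (i : ℕ) (k : Fin K) (j : Fin h.b)

/-- The agent that draws a sample. -/
def SampleIdx.agent {K : ℕ} {h : Hyper} : SampleIdx K h → Fin K
  | .init k _ => k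
  | .large _ k _ => k
  | .mini _ k _ => k

/-- The variables held by the network at one round. -/
structure State (K d₁ d₂ : ℕ) where
  X : Block K d₁
  Y : Block K d₂
  Dx : Block K d₁
  Dy : Block K d₂
  Mx : Block K d₁
  My : Block K d₂

section Algorithm

variable {K d₁ d₂ : ℕ} {Ξ : Type*} [MeasurableSpace Ξ]

/-- Initial gradient estimate: the average of a stochastic gradient `g` over the initial batch. -/
def initEstimate {E : Type*} [AddCommGroup E] [Module ℝ E] (h : Hyper)
    (g : Fin K → Vec d₁ → Vec d₂ → Ξ → E) (s : SampleIdx K h → Ξ)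
    (X : Block K d₁) (Y : Block K d₂) : Fin K → E :=
  fun k => (h.b₀ : ℝ)⁻¹ • ∑ j, g k (X k) (Y k) (s (.init k j))

/-- Average of a stochastic gradient `g` over the minibatch of round `i`. -/
def miniEstimate {E : Type*} [AddCommGroup E] [Module ℝ E] (h : Hyper)
    (g : Fin K → Vec d₁ → Vec d₂ → Ξ → E) (s : SampleIdx K h → Ξ) (i : ℕ)
    (X : Block K d₁) (Y : Block K d₂) : Fin K → E :=
  fun k => (h.b : ℝ)⁻¹ • ∑ j, g k (X k) (Y k) (s (.mini i k j))

/-- Average of a stochastic gradient `g` over the large batch of round `i` (online), or over the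
whole local data set (offline). -/
def largeEstimate {E : Type*} [AddCommGroup E] [Module ℝ E] (h : Hyper) (data : DataModel K Ξ)
    (g : Fin K → Vec d₁ → Vec d₂ → Ξ → E) (s : SampleIdx K h → Ξ) (i : ℕ)
    (X : Block K d₁) (Y : Block K d₂) : Fin K → E :=
  match data with
  | .online _ => fun k => (h.B : ℝ)⁻¹ • ∑ j, g k (X k) (Y k) (s (.large i k j))
  | .offline N _ ζ => fun k => (N k : ℝ)⁻¹ • ∑ t, g k (X k) (Y k) (ζ k t)

/-- The GRACE estimator of round `i`, computed from the previous estimate `M'`, the previous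
models `X', Y'`, the current models `X, Y` and the Bernoulli flag shared by all agents. -/
def grace {E : Type*} [AddCommGroup E] [Module ℝ E] (h : Hyper) (data : DataModel K Ξ)
    (g : Fin K → Vec d₁ → Vec d₂ → Ξ → E) (s : SampleIdx K h → Ξ) (flag : Bool) (i : ℕ)
    (M' : Fin K → E) (X' : Block K d₁) (Y' : Block K d₂) (X : Block K d₁) (Y : Block K d₂) :
    Fin K → E :=
  if flag then largeEstimate h data g s i X Y
  else (1 - h.β) • (M' - miniEstimate h g s i X' Y') + miniEstimate h g s i X Y

/-- The state of DAMA with the GRACE estimator at each round, for one realization `s` of all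
samples and `flag` of all Bernoulli variables, started from identical local models `x₀, y₀` and
identical local dual variables `dx₀, dy₀`. -/
def iterate (prob : Problem K d₁ d₂ Ξ) (Dx Dy : Design K) (h : Hyper)
    (x₀ : Vec d₁) (y₀ : Vec d₂) (dx₀ : Vec d₁) (dy₀ : Vec d₂)
    (s : SampleIdx K h → Ξ) (flag : ℕ → Bool) : ℕ → State K d₁ d₂
  | 0 =>
    { X := fun _ => x₀
      Y := fun _ => y₀
      Dx := fun _ => dx₀
      Dy := fun _ => dy₀
      Mx := initEstimate h prob.gradQx s (fun _ => x₀) (fun _ => y₀)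
      My := initEstimate h prob.gradQy s (fun _ => x₀) (fun _ => y₀) }
  | i + 1 =>
    let S := iterate prob Dx Dy h x₀ y₀ dx₀ dy₀ s flag i
    let X' := act Dx.A (act Dx.C S.X - h.μx • S.Mx) - act Dx.B S.Dx
    let Y' := act Dy.A (act Dy.C S.Y + h.μy • S.My) - act Dy.B S.Dy
    { X := X'
      Y := Y'
      Dx := S.Dx + act Dx.B X'
      Dy := S.Dy + act Dy.B Y'
      Mx := grace h prob.data prob.gradQx s (flag (i + 1)) (i + 1) S.Mx S.X S.Y X' Y'
      My := grace h prob.data prob.gradQy s (flag (i + 1)) (i + 1) S.My S.X S.Y X' Y' }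

/-- All samples and all Bernoulli variables are mutually independent, a sample of agent `k` has
the law of agent `k`, and each flag is raised with probability `p`. -/
structure IsSampling {Ω : Type*} [MeasurableSpace Ω] (Pr : Measure Ω) (data : DataModel K Ξ)
    (h : Hyper) (ξ : SampleIdx K h → Ω → Ξ) (π : ℕ → Ω → Bool) : Prop where
  measurable_ξ : ∀ a, Measurable (ξ a)
  measurable_π : ∀ i, Measurable (π i)
  law_ξ : ∀ a, Pr.map (ξ a) = data.law a.agent
  law_π : ∀ i, Pr {ω | π i ω = true} = ENNReal.ofReal h.p
  indep_ξ : iIndepFun ξ Pr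
  indep_π : iIndepFun π Pr
  indep : IndepFun (fun ω a => ξ a ω) (fun ω i => π i ω) Pr

end Algorithm

/-! ### Hyperparameter conditions and the performance bound -/

/-- The conditions on the hyperparameters, with `κ = Lf/ν`, `L = Lf + κ Lf/2`, `lA = λ_a`,
`lBi = 1/λ_b`, `v = v₁ v₂`. An upper bound on `μ_y` with `λ_a` in a denominator is written with
`λ_a` on the left, so that it is void if `λ_a = 0`. -/
structure Hyper.Conditions (h : Hyper) (K : ℕ) (Lf ν ρ lA lBi v : ℝ) : Prop where
  μx_pos : 0 < h.μx
  μy_pos : 0 < h.μy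
  μx_1 : h.μx ≤ 1 / (32 * (Lf + Lf / ν * Lf / 2))
  μx_2 : h.μx ≤ h.μy / (16 * (Lf / ν) ^ 2)
  μx_3 : h.μx ≤ √(K * h.b * h.βbar) / (24 * √3 * (Lf / ν) * Lf)
  μy_1 : h.μy ≤ 1 / ν
  μy_2 : h.μy ≤ 1 / (2 * Lf)
  μy_3 : h.μy ≤ √(K * h.b * h.βbar) / (12 * Lf)
  μy_4 : √620 * Lf * v * lA * lBi * h.μy ≤ 1 - ρ
  μy_5 : 12 * Lf * v * lA * lBi * h.μy ≤ 1 - ρ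
  μy_6 : 24 * Lf * v * lA * lBi * h.μy ≤ (1 - ρ) * √(h.b * h.βbar / h.β')
  μy_7 : (90 * Lf * h.μy) ^ 3 * (Lf / ν) * v ^ 2 * lA ^ 2 * lBi ^ 2
    ≤ (1 - ρ) ^ 2 * (h.b * K * h.βbar)
  βbar_1 : h.βbar ≤ ν * h.μy / 2
  βbar_2 : h.b * h.βbar ≤ 1 / K
  βbar_3 : h.βbar ≤ 1
  p_nonneg : 0 ≤ h.p
  β_nonneg : 0 ≤ h.β
  β_le : h.β ≤ 1
  p_add_β : h.p + h.β ≤ 1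
  β_add_bp : h.β + h.b * h.p ≤ h.b
  one_le_b : 1 ≤ h.b
  one_le_b₀ : 1 ≤ h.b₀
  one_le_B : 1 ≤ h.B

/-- `a'`. -/
def aCoef (h : Hyper) (K : ℕ) (Lf ρ lBi : ℝ) : ℝ :=
  Lf ^ 2 * lBi ^ 2 / (h.b * K * h.βbar * (1 - ρ))

/-- `b'`. -/
def bCoef (h : Hyper) (K : ℕ) (Lf ρ lA lBi : ℝ) : ℝ :=
  Lf ^ 2 * lA ^ 2 * h.β' * lBi ^ 2 / (h.b * h.b₀ * K * h.βbar ^ 2 * (1 - ρ) ^ 2)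

/-- `c'`. -/
def cCoef (h : Hyper) (K : ℕ) (Lf ρ lA lBi : ℝ) : ℝ :=
  Lf ^ 4 * lA ^ 2 * h.β' * lBi ^ 4 / (h.b ^ 2 * K * h.βbar ^ 2 * (1 - ρ) ^ 2)

/-- `d'`; `I` is the online indicator. -/
def dCoef (h : Hyper) (K : ℕ) (Lf ρ lA lBi I : ℝ) : ℝ :=
  Lf ^ 2 * lA ^ 2 * lBi ^ 2 / (h.b * K * h.βbar * (1 - ρ) ^ 2)
    * (h.p / h.B * I + h.β ^ 2 / h.b)

/-- `e'`; `I` is the online indicator and `T` the number of rounds. -/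
def eCoef (h : Hyper) (K T : ℕ) (I : ℝ) : ℝ :=
  1 / (h.b₀ * h.βbar * K * T) + h.β ^ 2 / (K * h.b * h.βbar) + h.p / (K * h.B * h.βbar) * I

/-- `f'`. -/
def fCoef (h : Hyper) (K : ℕ) (Lf lBi : ℝ) : ℝ :=
  Lf ^ 2 * lBi ^ 2 / (h.b * K * h.βbar)

/-- The performance bound, up to an absolute factor: `EG = 𝔼 G_{p,0}`, `EΔ = 𝔼 Δ_{c,0}`,
`ζsq = ζ₀²`, `v = v₁ v₂`. -/
def performanceBound (h : Hyper) (K T : ℕ) (Lf ν σ ρ lA lBi v I EG EΔ ζsq : ℝ) : ℝ :=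
  EG / (T * h.μx) + (Lf / ν) ^ 2 * EΔ / (T * h.μy)
    + (Lf / ν) ^ 2
      * (v ^ 2 * aCoef h K Lf ρ lBi + v ^ 4 * cCoef h K Lf ρ lA lBi * h.μy ^ 2
        + v ^ 2 * fCoef h K Lf lBi) * h.μy ^ 2 * ζsq / T
    + (Lf / ν) ^ 2 * (v ^ 2 * bCoef h K Lf ρ lA lBi) * h.μy ^ 2 * σ ^ 2 / T
    + (Lf / ν) ^ 2 * (v ^ 2 * dCoef h K Lf ρ lA lBi I * h.μy ^ 2 + eCoef h K T I) * σ ^ 2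

/-- `ζ₀² = (1/K) 𝔼‖(A_x - (1/K)𝟙𝟙ᵀ ⊗ I) M_{x,0}‖² + (1/K) 𝔼‖(A_y - (1/K)𝟙𝟙ᵀ ⊗ I) M_{y,0}‖²` for
a random initial state `S₀`. -/
def zetaSq {K d₁ d₂ : ℕ} {Ω : Type*} [MeasurableSpace Ω] (Pr : Measure Ω) (Dx Dy : Design K)
    (S₀ : Ω → State K d₁ d₂) : ℝ :=
  (K : ℝ)⁻¹ * ∫ ω, blockNormSq (act (Dx.A - avgMatrix K) (S₀ ω).Mx) ∂Pr
    + (K : ℝ)⁻¹ * ∫ ω, blockNormSq (act (Dy.A - avgMatrix K) (S₀ ω).My) ∂Pr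

end DAMA

end

/-!
Why DAMA with GRACE converges at the stated rate.

**Optimization.** Along the centroids `x_c, y_c` of the network, one round is a step of inexact
gradient descent ascent on `J`, since the design matrices fix constant blocks or annihilate them
(`Design.Admissible.centroid_step`). Under the Polyak-Łojasiewicz condition the envelope `P` has a
quadratic upper model with curvature `L_f + κ L_f` (`SmoothRisk.envelope_le`), and the potential
`P(x_c) + 16 κ² (μ_x/μ_y) (P - J)(x_c, y_c)` decreases by a multiple of the squared gradient norms,
up to `κ²` times the squared error of the averaged gradient estimates
(`SmoothRisk.potential_step`). Since `P` is bounded below, it is enough to control that error,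
summed over the rounds.

**Consensus.** On the complement of the constant blocks, the model and a suitably shifted dual
variable form a linear system with transition matrix `Q T Q⁻¹` and `‖T‖ ≤ ρ < 1`. The shift absorbs
the gradient estimate itself, so that only its *increments* enter as forcing, together with the
initial disagreement `ζ₀²` (`Spectral.Bounds.sum_deviation_le`).

**Estimation.** A sample of a round is independent of everything determined by earlier rounds.
Independence is used in one form only: the joint law of all samples and flags is invariant under
redrawing any one of them (`IsSampling.isSampleLaw`). Hence fresh noise is orthogonal to the past
and to the noise of other samples, and the GRACE tracking error contracts by `1 - β̄` per round,
with a forcing by the squared displacement of the models and by the sample noise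
(`Oracle.integral_tracking_le`); averaging over the agents gains a factor `1/K`. The increments of
the estimates are bounded by the tracking errors, displacements and noise
(`Oracle.integral_increment_le`).

**Closing the loop.** Displacements are bounded by consensus errors and by the averaged estimates,
whose squared norms appear with a negative sign in the descent of the potential. The hyperparameter
conditions make the loop gains (increments to consensus errors, displacements to tracking errors)
small absolute constants, so that the summed recursions can be solved
(`ErrorRecursions.sum_le`, `ErrorRecursions.average_le`).
-/

noncomputable section

namespace DAMA

/-! ### Smoothness and the Polyak–Łojasiewicz envelope -/

local notation "⟪" x ", " y "⟫" => inner ℝ x y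

/-- First order expansion on `[0, 1]` for a function whose derivative grows at most linearly. -/
lemma abs_sub_sub_deriv_le {φ φ' : ℝ → ℝ} {c : ℝ} (hφ : ∀ t, HasDerivAt φ (φ' t) t)
    (hc : ∀ t ∈ Set.Icc (0 : ℝ) 1, |φ' t - φ' 0| ≤ c * t) :
    |φ 1 - φ 0 - φ' 0| ≤ c / 2 := by
  have key : ∀ {ψ ψ' : ℝ → ℝ}, (∀ t, HasDerivAt ψ (ψ' t) t) →
      (∀ t ∈ Set.Icc (0 : ℝ) 1, ψ' t - ψ' 0 ≤ c * t) → ψ 1 - ψ 0 - ψ' 0 ≤ c / 2 := by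
    intro ψ ψ' hψ hb
    have hd : ∀ t, HasDerivAt (fun t => ψ t - ψ' 0 * t - c / 2 * t ^ 2)
        (ψ' t - ψ' 0 * 1 - c / 2 * (2 * t)) t := by
      intro t
      have h2 : HasDerivAt (fun t : ℝ => t ^ 2) (2 * t) t := by
        simpa using hasDerivAt_pow 2 t
      exact ((hψ t).sub ((hasDerivAt_id t).const_mul _)).sub (h2.const_mul _)
    have hanti : AntitoneOn (fun t => ψ t - ψ' 0 * t - c / 2 * t ^ 2) (Set.Icc 0 1) := by
      refine antitoneOn_of_deriv_nonpos (convex_Icc 0 1)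
        (fun t _ => (hd t).continuousAt.continuousWithinAt)
        (fun t _ => (hd t).differentiableAt.differentiableWithinAt) fun t ht => ?_
      rw [(hd t).deriv]
      have := hb t (interior_subset ht)
      linarith
    have := hanti (Set.left_mem_Icc.2 zero_le_one) (Set.right_mem_Icc.2 zero_le_one) zero_le_one
    simp only at this
    linarith
  rw [abs_le]
  constructor
  · have h := key (ψ := fun t => -φ t) (ψ' := fun t => -φ' t) (fun t => (hφ t).neg)
      fun t ht => by linarith [neg_abs_le (φ' t - φ' 0), hc t ht]
    linarith
  · exact key hφ fun t ht => (le_abs_self _).trans (hc t ht)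

variable {d₁ d₂ : ℕ}

/-- Partial gradients pair with directions as the total derivative does. -/
lemma inner_gradient_add {f : Vec d₁ × Vec d₂ → ℝ} {z : Vec d₁ × Vec d₂}
    (hf : DifferentiableAt ℝ f z) (u : Vec d₁) (w : Vec d₂) :
    ⟪gradient (fun x => f (x, z.2)) z.1, u⟫ + ⟪gradient (fun y => f (z.1, y)) z.2, w⟫
      = fderiv ℝ f z (u, w) := by
  have h1 : HasFDerivAt (fun x => f (x, z.2))
      ((fderiv ℝ f z).comp (ContinuousLinearMap.inl ℝ (Vec d₁) (Vec d₂))) z.1 :=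
    HasFDerivAt.comp (f := fun x => (x, z.2)) (g := f) z.1 hf.hasFDerivAt
      (hasFDerivAt_prodMk_left z.1 z.2)
  have h2 : HasFDerivAt (fun y => f (z.1, y))
      ((fderiv ℝ f z).comp (ContinuousLinearMap.inr ℝ (Vec d₁) (Vec d₂))) z.2 :=
    HasFDerivAt.comp (f := fun y => (z.1, y)) (g := f) z.2 hf.hasFDerivAt
      (hasFDerivAt_prodMk_right z.1 z.2)
  rw [gradient, gradient, InnerProductSpace.toDual_symm_apply,
    InnerProductSpace.toDual_symm_apply, h1.fderiv, h2.fderiv]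
  simp [← map_add]

/-- The hypotheses on the risk `J` that the optimization part uses: differentiability and
Lipschitz continuity of both partial gradients. -/
structure SmoothRisk (f : Vec d₁ × Vec d₂ → ℝ) (Gx : Vec d₁ → Vec d₂ → Vec d₁)
    (Gy : Vec d₁ → Vec d₂ → Vec d₂) (Lf : ℝ) : Prop where
  diff : Differentiable ℝ f
  gradx : ∀ x y, Gx x y = gradient (fun x' => f (x', y)) x
  grady : ∀ x y, Gy x y = gradient (fun y' => f (x, y')) y
  lipx : ∀ x₁ y₁ x₂ y₂,
    ‖Gx x₁ y₁ - Gx x₂ y₂‖ ^ 2 ≤ Lf ^ 2 * (‖x₁ - x₂‖ ^ 2 + ‖y₁ - y₂‖ ^ 2)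
  lipy : ∀ x₁ y₁ x₂ y₂,
    ‖Gy x₁ y₁ - Gy x₂ y₂‖ ^ 2 ≤ Lf ^ 2 * (‖x₁ - x₂‖ ^ 2 + ‖y₁ - y₂‖ ^ 2)

variable {f : Vec d₁ × Vec d₂ → ℝ} {Gx : Vec d₁ → Vec d₂ → Vec d₁}
  {Gy : Vec d₁ → Vec d₂ → Vec d₂} {Lf : ℝ}

lemma SmoothRisk.hasDerivAt (hf : SmoothRisk f Gx Gy Lf) (x u : Vec d₁) (y w : Vec d₂) (t : ℝ) :
    HasDerivAt (fun t : ℝ => f (x + t • u, y + t • w))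
      (⟪Gx (x + t • u) (y + t • w), u⟫ + ⟪Gy (x + t • u) (y + t • w), w⟫) t := by
  rw [hf.gradx, hf.grady]
  rw [inner_gradient_add (f := f) (z := (x + t • u, y + t • w)) (hf.diff _) u w]
  have h1 : HasDerivAt (fun t : ℝ => (x + t • u, y + t • w)) (u, w) t := by
    have hx := ((hasDerivAt_id t).smul_const u).const_add x
    have hy := ((hasDerivAt_id t).smul_const w).const_add y
    simpa using hx.prodMk hy
  exact (hf.diff _).hasFDerivAt.comp_hasDerivAt t h1

lemma SmoothRisk.abs_sub_le_joint (hf : SmoothRisk f Gx Gy Lf) (hL : 0 ≤ Lf)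
    (x u : Vec d₁) (y w : Vec d₂) :
    |f (x + u, y + w) - f (x, y) - (⟪Gx x y, u⟫ + ⟪Gy x y, w⟫)|
      ≤ 3 / 4 * Lf * (‖u‖ ^ 2 + ‖w‖ ^ 2) := by
  have h := abs_sub_sub_deriv_le (c := 3 / 2 * Lf * (‖u‖ ^ 2 + ‖w‖ ^ 2))
    (hf.hasDerivAt x u y w) ?_
  · simp only [one_smul, zero_smul, add_zero] at h
    refine h.trans (le_of_eq (by ring))
  intro t ht
  simp only [zero_smul, add_zero]
  set R := √(‖u‖ ^ 2 + ‖w‖ ^ 2) with hR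
  have hR2 : R ^ 2 = ‖u‖ ^ 2 + ‖w‖ ^ 2 := Real.sq_sqrt (by positivity)
  have hR0 : 0 ≤ R := Real.sqrt_nonneg _
  have hsq : ‖x + t • u - x‖ ^ 2 + ‖y + t • w - y‖ ^ 2 = (t * R) ^ 2 := by
    rw [add_sub_cancel_left, add_sub_cancel_left, norm_smul, norm_smul, mul_pow, mul_pow, mul_pow,
      hR2, Real.norm_eq_abs, sq_abs]
    ring
  have hx : ‖Gx (x + t • u) (y + t • w) - Gx x y‖ ≤ Lf * (t * R) := by
    refine abs_le_of_sq_le_sq' ?_ (mul_nonneg hL (mul_nonneg ht.1 hR0)) |>.2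
    rw [mul_pow, ← hsq]
    exact hf.lipx _ _ _ _
  have hy : ‖Gy (x + t • u) (y + t • w) - Gy x y‖ ≤ Lf * (t * R) := by
    refine abs_le_of_sq_le_sq' ?_ (mul_nonneg hL (mul_nonneg ht.1 hR0)) |>.2
    rw [mul_pow, ← hsq]
    exact hf.lipy _ _ _ _
  have hsum : ‖u‖ + ‖w‖ ≤ 3 / 2 * R := by
    refine abs_le_of_sq_le_sq' ?_ (by positivity) |>.2
    nlinarith [sq_nonneg (‖u‖ - ‖w‖), sq_nonneg ‖u‖, sq_nonneg ‖w‖]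
  calc _ = |⟪Gx (x + t • u) (y + t • w) - Gx x y, u⟫
        + ⟪Gy (x + t • u) (y + t • w) - Gy x y, w⟫| := by
          rw [inner_sub_left, inner_sub_left]; congr 1; ring
    _ ≤ Lf * (t * R) * ‖u‖ + Lf * (t * R) * ‖w‖ := by
        refine (abs_add_le _ _).trans (add_le_add ?_ ?_)
        · exact (abs_real_inner_le_norm _ _).trans (by gcongr)
        · exact (abs_real_inner_le_norm _ _).trans (by gcongr)
    _ = Lf * (t * R) * (‖u‖ + ‖w‖) := by ring
    _ ≤ Lf * (t * R) * (3 / 2 * R) := by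
        have := ht.1
        gcongr
    _ = _ := by rw [← hR2]; ring

lemma SmoothRisk.abs_sub_le_left (hf : SmoothRisk f Gx Gy Lf) (hL : 0 ≤ Lf)
    (x u : Vec d₁) (y : Vec d₂) :
    |f (x + u, y) - f (x, y) - ⟪Gx x y, u⟫| ≤ Lf / 2 * ‖u‖ ^ 2 := by
  have h := abs_sub_sub_deriv_le (c := Lf * ‖u‖ ^ 2) (hf.hasDerivAt x u y 0) ?_
  · simp only [one_smul, zero_smul, add_zero, smul_zero, inner_zero_right] at h
    refine h.trans (le_of_eq (by ring))
  intro t ht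
  simp only [zero_smul, add_zero, smul_zero, inner_zero_right]
  have hx : ‖Gx (x + t • u) y - Gx x y‖ ≤ Lf * (t * ‖u‖) := by
    have ht0 := ht.1
    refine abs_le_of_sq_le_sq' ?_ (by positivity) |>.2
    refine (hf.lipx _ _ _ _).trans (le_of_eq ?_)
    simp [norm_smul, mul_pow]
  rw [← inner_sub_left]
  calc _ ≤ Lf * (t * ‖u‖) * ‖u‖ := (abs_real_inner_le_norm _ _).trans (by gcongr)
    _ = _ := by ring

/-- A risk whose maximum over `y` is attained with value `P x` and which satisfies the
Polyak–Łojasiewicz inequality in `y`. -/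
structure PLRisk (f : Vec d₁ × Vec d₂ → ℝ) (Gy : Vec d₁ → Vec d₂ → Vec d₂) (P : Vec d₁ → ℝ)
    (ν : ℝ) : Prop where
  pos : 0 < ν
  le_P : ∀ x y, f (x, y) ≤ P x
  attained : ∀ x, ∃ y, f (x, y) = P x
  pl : ∀ x y, 2 * ν * (P x - f (x, y)) ≤ ‖Gy x y‖ ^ 2

variable {P : Vec d₁ → ℝ} {ν : ℝ}

/-- The envelope `P` has a quadratic upper model at `x` whose slope is the partial gradient at a
maximizer. No differentiability of `P` is needed: the PL inequality at `(x + u, y₀)` bounds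
`P (x + u) - f (x + u, y₀)`, because the `y`-gradient vanishes at `(x, y₀)`. -/
lemma SmoothRisk.envelope_le (hf : SmoothRisk f Gx Gy Lf) (hP : PLRisk f Gy P ν) (hL : 0 ≤ Lf)
    {x : Vec d₁} {y₀ : Vec d₂} (hy₀ : f (x, y₀) = P x) (u : Vec d₁) :
    P (x + u) ≤ P x + ⟪Gx x y₀, u⟫ + (Lf + Lf / ν * Lf) / 2 * ‖u‖ ^ 2 := by
  have hmax : IsLocalMax (fun y => f (x, y)) y₀ :=
    Filter.Eventually.of_forall fun y => (hP.le_P x y).trans hy₀.ge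
  have hG0 : Gy x y₀ = 0 := by
    rw [hf.grady, gradient, hmax.fderiv_eq_zero, map_zero]
  have hlip := hf.lipy (x + u) y₀ x y₀
  rw [hG0, sub_zero, add_sub_cancel_left, sub_self, norm_zero] at hlip
  have hpl := hP.pl (x + u) y₀
  have hν := hP.pos
  have h1 : P (x + u) - f (x + u, y₀) ≤ Lf / ν * Lf / 2 * ‖u‖ ^ 2 := by
    have h3 : 2 * ν * (P (x + u) - f (x + u, y₀)) ≤ Lf ^ 2 * ‖u‖ ^ 2 := by
      refine hpl.trans (hlip.trans (le_of_eq (by ring)))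
    have h4 : Lf / ν * Lf / 2 * ‖u‖ ^ 2 = Lf ^ 2 * ‖u‖ ^ 2 / (2 * ν) := by
      field_simp
    rw [h4, le_div_iff₀ (by positivity)]
    linarith
  have h2 := (abs_le.1 (hf.abs_sub_le_left hL x u y₀)).2
  linarith

/-- The difference of the `x`-gradients at `y` and at a maximizer `y₀` is controlled by the gap
`P x - f (x, y)`, hence by the `y`-gradient. Indeed `x' ↦ P x' - f (x', y)` is nonnegative with a
quadratic upper model, so a gradient step on it cannot decrease it by more than its value. -/
lemma SmoothRisk.norm_sub_sq_le (hf : SmoothRisk f Gx Gy Lf) (hP : PLRisk f Gy P ν) (hL : 0 < Lf)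
    (hκ : ν ≤ Lf) {x : Vec d₁} {y₀ : Vec d₂} (hy₀ : f (x, y₀) = P x) (y : Vec d₂) :
    ‖Gx x y₀ - Gx x y‖ ^ 2 ≤ 3 * (Lf / ν) ^ 2 * ‖Gy x y‖ ^ 2 := by
  have hν := hP.pos
  set g := Gx x y₀ - Gx x y with hg
  set κ := Lf / ν with hκd
  have hκ1 : 1 ≤ κ := (one_le_div hν).2 hκ
  set A := (2 + κ) * Lf with hA
  have hApos : 0 < A := by positivity
  set u := -(A⁻¹ • g) with hu
  have h1 := hf.envelope_le hP hL.le hy₀ u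
  have h2 := (abs_le.1 (hf.abs_sub_le_left hL.le x u y)).1
  have h3 := hP.le_P (x + u) y
  have hgu : ⟪Gx x y₀, u⟫ - ⟪Gx x y, u⟫ = -(A⁻¹ * ‖g‖ ^ 2) := by
    rw [← inner_sub_left, ← hg, hu, inner_neg_right, real_inner_smul_right,
      real_inner_self_eq_norm_sq]
  have hun : ‖u‖ ^ 2 = (A⁻¹) ^ 2 * ‖g‖ ^ 2 := by
    rw [hu, norm_neg, norm_smul, mul_pow, Real.norm_eq_abs, sq_abs]
  have h4 : A⁻¹ * ‖g‖ ^ 2 / 2 ≤ P x - f (x, y) := by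
    have h5 : A / 2 * ‖u‖ ^ 2 = A⁻¹ * ‖g‖ ^ 2 / 2 := by
      rw [hun]; field_simp
    have h6 : (Lf + κ * Lf) / 2 * ‖u‖ ^ 2 + Lf / 2 * ‖u‖ ^ 2 = A / 2 * ‖u‖ ^ 2 := by
      rw [hA]; ring
    linarith
  have h7 : ‖g‖ ^ 2 ≤ 2 * A * (P x - f (x, y)) := by
    have : ‖g‖ ^ 2 = 2 * A * (A⁻¹ * ‖g‖ ^ 2 / 2) := by field_simp
    rw [this]; gcongr
  have hΔ : 0 ≤ P x - f (x, y) := sub_nonneg.2 (hP.le_P x y)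
  have h8 := hP.pl x y
  have h9 : Lf = κ * ν := by rw [hκd]; field_simp
  calc ‖g‖ ^ 2 ≤ 2 * A * (P x - f (x, y)) := h7
    _ ≤ 2 * (3 * κ * (κ * ν)) * (P x - f (x, y)) := by
        have : A ≤ 3 * κ * (κ * ν) := by
          rw [hA, ← h9]; nlinarith
        gcongr
    _ = 3 * κ ^ 2 * (2 * ν * (P x - f (x, y))) := by ring
    _ ≤ _ := by gcongr

/-- One round of inexact descent in `x` and ascent in `y` decreases the potential
`P + λ (P - f)` with `λ = 16 κ² μx / μy`. -/
lemma SmoothRisk.potential_step (hf : SmoothRisk f Gx Gy Lf) (hP : PLRisk f Gy P ν) (hL : 0 < Lf)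
    (hκ : ν ≤ Lf) {μx μy : ℝ} (hμx : 0 < μx) (hμy : 0 < μy)
    (h1 : μx ≤ 1 / (32 * (Lf + Lf / ν * Lf / 2))) (h2 : μx ≤ μy / (16 * (Lf / ν) ^ 2))
    (h3 : μy ≤ 1 / (2 * Lf)) (x mx : Vec d₁) (y my : Vec d₂) :
    P (x - μx • mx) + 16 * (Lf / ν) ^ 2 * μx / μy
        * (P (x - μx • mx) - f (x - μx • mx, y + μy • my))
      ≤ P x + 16 * (Lf / ν) ^ 2 * μx / μy * (P x - f (x, y))
        + μx * (8 * (Lf / ν) ^ 2 * (‖Gx x y - mx‖ ^ 2 + ‖Gy x y - my‖ ^ 2)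
          - 2 / 25 * (‖Gx x y‖ ^ 2 + ‖Gy x y‖ ^ 2)
          - 1 / 25 * ‖mx‖ ^ 2 - 2 * (Lf / ν) ^ 2 * ‖my‖ ^ 2) := by
  have hν := hP.pos
  set κ := Lf / ν with hκd
  have hκ1 : 1 ≤ κ := (one_le_div hν).2 hκ
  obtain ⟨y₀, hy₀⟩ := hP.attained x
  set l := 16 * κ ^ 2 * μx / μy with hl
  have hl0 : 0 ≤ l := by positivity
  have hl1 : l ≤ 1 := by
    rw [le_div_iff₀ (by positivity)] at h2
    rw [hl, div_le_one hμy]; linarith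
  have hlμ : l * μy = 16 * κ ^ 2 * μx := by rw [hl]; field_simp
  set g := Gx x y₀ - Gx x y with hg
  have hgb : ‖g‖ ^ 2 ≤ 3 * κ ^ 2 * ‖Gy x y‖ ^ 2 := hf.norm_sub_sq_le hP hL hκ hy₀ y
  have e1 := hf.envelope_le hP hL.le hy₀ (-(μx • mx))
  have e2 := (abs_le.1 (hf.abs_sub_le_joint hL.le x (-(μx • mx)) y (μy • my))).1
  rw [← sub_eq_add_neg] at e1 e2
  have n1 : ‖-(μx • mx)‖ ^ 2 = μx ^ 2 * ‖mx‖ ^ 2 := by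
    rw [norm_neg, norm_smul, mul_pow, Real.norm_eq_abs, sq_abs]
  have n2 : ‖μy • my‖ ^ 2 = μy ^ 2 * ‖my‖ ^ 2 := by
    rw [norm_smul, mul_pow, Real.norm_eq_abs, sq_abs]
  have i0 : ⟪Gx x y₀, -(μx • mx)⟫ = -(μx * (⟪g, mx⟫ + ⟪Gx x y, mx⟫)) := by
    rw [inner_neg_right, real_inner_smul_right, hg, inner_sub_left]; ring
  have i1 : ⟪Gx x y, -(μx • mx)⟫ = -(μx * ⟪Gx x y, mx⟫) := by
    rw [inner_neg_right, real_inner_smul_right]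
  have i2 : ⟪Gy x y, μy • my⟫ = μy * ⟪Gy x y, my⟫ := real_inner_smul_right _ _ _
  rw [n1, i0] at e1
  rw [n1, n2, i1, i2] at e2
  have p1 : ‖Gx x y - mx‖ ^ 2 = ‖Gx x y‖ ^ 2 - 2 * ⟪Gx x y, mx⟫ + ‖mx‖ ^ 2 :=
    norm_sub_sq_real _ _
  have p2 : ‖Gy x y - my‖ ^ 2 = ‖Gy x y‖ ^ 2 - 2 * ⟪Gy x y, my⟫ + ‖my‖ ^ 2 :=
    norm_sub_sq_real _ _
  -- the weight 66/25 leaves room for the gradient terms on both sides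
  have hgm : -(2 * ⟪g, mx⟫) ≤ 66 / 25 * ‖g‖ ^ 2 + 25 / 66 * ‖mx‖ ^ 2 := by
    have h := norm_add_sq_real ((66 / 25 : ℝ) • g) mx
    rw [norm_smul, real_inner_smul_left, mul_pow, Real.norm_eq_abs, sq_abs] at h
    linarith [sq_nonneg ‖(66 / 25 : ℝ) • g + mx‖]
  have hgm' : -((1 + l) * ⟪g, mx⟫) ≤ 66 / 25 * ‖g‖ ^ 2 + 25 / 66 * ‖mx‖ ^ 2 := by
    rcases le_total 0 ⟪g, mx⟫ with h | h
    · have h0 : 0 ≤ (1 + l) * ⟪g, mx⟫ := by positivity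
      have h' : 0 ≤ 66 / 25 * ‖g‖ ^ 2 + 25 / 66 * ‖mx‖ ^ 2 := by positivity
      linarith
    · have h0 : 0 ≤ (1 - l) * -⟪g, mx⟫ := mul_nonneg (sub_nonneg.2 hl1) (neg_nonneg.2 h)
      linarith
  have hLμ : (Lf + κ * Lf) / 2 * μx ≤ 1 / 32 := by
    rw [le_div_iff₀ (by positivity)] at h1
    have : 0 ≤ Lf * μx := by positivity
    linarith
  have hLμ' : 3 / 4 * Lf * μx ≤ 1 / 64 := by
    rw [le_div_iff₀ (by positivity)] at h1
    have : Lf * μx ≤ κ * (Lf * μx) := le_mul_of_one_le_left (by positivity) hκ1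
    linarith
  have hLy : 3 / 4 * Lf * μy ≤ 3 / 8 := by
    rw [le_div_iff₀ (by positivity)] at h3
    linarith
  set Mx := ‖mx‖ ^ 2
  set My := ‖my‖ ^ 2
  set A := ‖Gx x y‖ ^ 2
  set B := ‖Gy x y‖ ^ 2
  have hMx : 0 ≤ Mx := sq_nonneg _
  have hMy : 0 ≤ My := sq_nonneg _
  have hA : 0 ≤ A := sq_nonneg _
  have hB : 0 ≤ B := sq_nonneg _
  have q1 : (Lf + κ * Lf) / 2 * (μx ^ 2 * Mx) ≤ μx * (1 / 32 * Mx) := by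
    calc _ = μx * (((Lf + κ * Lf) / 2 * μx) * Mx) := by ring
      _ ≤ _ := by gcongr
  have q2 : 3 / 4 * Lf * (μx ^ 2 * Mx) ≤ μx * (1 / 64 * Mx) := by
    calc _ = μx * ((3 / 4 * Lf * μx) * Mx) := by ring
      _ ≤ _ := by gcongr
  have q3 : 3 / 4 * Lf * (μy ^ 2 * My) ≤ μy * (3 / 8 * My) := by
    calc _ = μy * ((3 / 4 * Lf * μy) * My) := by ring
      _ ≤ _ := by gcongr
  have e1' : (1 + l) * (P (x - μx • mx) - P x)
      ≤ (1 + l) * (-(μx * (⟪g, mx⟫ + ⟪Gx x y, mx⟫)) + μx * (1 / 32 * Mx)) := by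
    refine mul_le_mul_of_nonneg_left ?_ (by linarith)
    linarith
  have e2' : l * (f (x, y) - f (x - μx • mx, y + μy • my)) ≤
      l * (μx * ⟪Gx x y, mx⟫ - μy * ⟪Gy x y, my⟫ + μx * (1 / 64 * Mx) + μy * (3 / 8 * My)) := by
    refine mul_le_mul_of_nonneg_left ?_ hl0
    linarith
  have r1 : l * (μx * (1 / 64 * Mx)) ≤ μx * (1 / 64 * Mx) :=
    mul_le_of_le_one_left (by positivity) hl1
  have r2 : l * (μx * (1 / 32 * Mx)) ≤ μx * (1 / 32 * Mx) :=
    mul_le_of_le_one_left (by positivity) hl1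
  have hmain : (1 + l) * (P (x - μx • mx) - P x)
      + l * (f (x, y) - f (x - μx • mx, y + μy • my)) ≤
      μx * (-((1 + l) * ⟪g, mx⟫) - ⟪Gx x y, mx⟫ + 5 / 64 * Mx)
        + 16 * κ ^ 2 * μx * (3 / 8 * My - ⟪Gy x y, my⟫) := by
    have : l * (-(μy * ⟪Gy x y, my⟫) + μy * (3 / 8 * My))
        = 16 * κ ^ 2 * μx * (3 / 8 * My - ⟪Gy x y, my⟫) := by rw [← hlμ]; ring
    linarith
  have hfin : (-((1 + l) * ⟪g, mx⟫) - ⟪Gx x y, mx⟫ + 5 / 64 * Mx)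
        + 16 * κ ^ 2 * (3 / 8 * My - ⟪Gy x y, my⟫) ≤
      8 * κ ^ 2 * (‖Gx x y - mx‖ ^ 2 + ‖Gy x y - my‖ ^ 2)
          - 2 / 25 * (A + B) - 1 / 25 * Mx - 2 * κ ^ 2 * My := by
    have hκ2 : 1 ≤ κ ^ 2 := one_le_pow₀ hκ1
    have s1 : 1 / 2 * ‖Gx x y - mx‖ ^ 2 ≤ 8 * κ ^ 2 * ‖Gx x y - mx‖ ^ 2 := by
      gcongr; linarith
    have s2 : B ≤ κ ^ 2 * B := le_mul_of_one_le_left hB hκ2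
    have s3 : ⟪Gx x y, mx⟫ = (A + Mx - ‖Gx x y - mx‖ ^ 2) / 2 := by linarith
    have s4 : ⟪Gy x y, my⟫ = (B + My - ‖Gy x y - my‖ ^ 2) / 2 := by linarith
    rw [s3, s4]
    have : 16 * κ ^ 2 * (3 / 8 * My - (B + My - ‖Gy x y - my‖ ^ 2) / 2)
        = -2 * κ ^ 2 * My - 8 * (κ ^ 2 * B) + 8 * κ ^ 2 * ‖Gy x y - my‖ ^ 2 := by ring
    rw [this]
    linarith
  have hfin' := mul_le_mul_of_nonneg_left hfin hμx.le
  linarith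

/-! ### Consensus over the network -/

section Network

variable {K d : ℕ}

/-- Deviation of a block vector from consensus: `∑_k ‖v_k - centroid v‖²`. -/
def deviation (v : Block K d) : ℝ := ∑ k, ‖v k - centroid v‖ ^ 2

/-- The linear map of a square matrix on Euclidean space. -/
abbrev mulE {n : Type*} [Fintype n] [DecidableEq n] (M : Matrix n n ℝ) (x : EuclideanSpace ℝ n) :
    EuclideanSpace ℝ n :=
  Matrix.toEuclideanCLM (n := n) (𝕜 := ℝ) M x

lemma norm_mulE_le {n : Type*} [Fintype n] [DecidableEq n] (M : Matrix n n ℝ)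
    (x : EuclideanSpace ℝ n) : ‖mulE M x‖ ≤ specNorm M * ‖x‖ :=
  ContinuousLinearMap.le_opNorm _ _

lemma mulE_mul {n : Type*} [Fintype n] [DecidableEq n] (M N : Matrix n n ℝ)
    (x : EuclideanSpace ℝ n) : mulE (M * N) x = mulE M (mulE N x) := by
  simp [mulE]

lemma mulE_one {n : Type*} [Fintype n] [DecidableEq n] (x : EuclideanSpace ℝ n) :
    mulE 1 x = x := by
  simp [mulE]

lemma mulE_add {n : Type*} [Fintype n] [DecidableEq n] (M : Matrix n n ℝ)
    (x y : EuclideanSpace ℝ n) : mulE M (x + y) = mulE M x + mulE M y := map_add _ _ _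

lemma mulE_sub {n : Type*} [Fintype n] [DecidableEq n] (M : Matrix n n ℝ)
    (x y : EuclideanSpace ℝ n) : mulE M (x - y) = mulE M x - mulE M y := map_sub _ _ _

lemma mulE_smul {n : Type*} [Fintype n] [DecidableEq n] (M : Matrix n n ℝ) (t : ℝ)
    (x : EuclideanSpace ℝ n) : mulE M (t • x) = t • mulE M x := map_smul _ _ _

lemma specNorm_nonneg {n : Type*} [Fintype n] [DecidableEq n] (M : Matrix n n ℝ) :
    0 ≤ specNorm M := norm_nonneg _

lemma mulE_diagonal_apply {n : Type*} [Fintype n] [DecidableEq n] (m : n → ℝ)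
    (x : EuclideanSpace ℝ n) (i : n) : mulE (Matrix.diagonal m) x i = m i * x i := by
  simp [mulE, Matrix.ofLp_toEuclideanCLM, Matrix.mulVec_diagonal]

lemma isSymm_aeval {W : Matrix (Fin K) (Fin K) ℝ} (hW : W.IsSymm) (q : Polynomial ℝ) :
    (Polynomial.aeval W q).IsSymm := by
  rw [Polynomial.aeval_eq_sum_range, Matrix.IsSymm, Matrix.transpose_sum]
  refine Finset.sum_congr rfl fun i _ => ?_
  rw [Matrix.transpose_smul, Matrix.transpose_pow, hW.eq]

lemma Design.Admissible.A_symm {D : Design K} {W : Matrix (Fin K) (Fin K) ℝ}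
    (hD : D.Admissible W) (hW : W.IsSymm) : D.A.IsSymm := by
  obtain ⟨q, hq⟩ := hD.A_poly
  exact hq ▸ isSymm_aeval hW q

lemma Design.Admissible.C_symm {D : Design K} {W : Matrix (Fin K) (Fin K) ℝ}
    (hD : D.Admissible W) (hW : W.IsSymm) : D.C.IsSymm := by
  obtain ⟨q, hq⟩ := hD.C_poly
  exact hq ▸ isSymm_aeval hW q

lemma Design.Admissible.B_one {D : Design K} {W : Matrix (Fin K) (Fin K) ℝ}
    (hD : D.Admissible W) : D.B.mulVec 1 = 0 := (hD.B_null 1).2 ⟨1, rfl⟩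

lemma sum_act_of_mulVec_one {M : Matrix (Fin K) (Fin K) ℝ} {t : ℝ} (hM : M.IsSymm)
    (h1 : M.mulVec 1 = fun _ => t) (v : Block K d) : ∑ k, act M v k = t • ∑ k, v k := by
  simp only [act]
  rw [Finset.sum_comm, Finset.smul_sum]
  refine Finset.sum_congr rfl fun l _ => ?_
  rw [← Finset.sum_smul]
  congr 1
  have := congrFun h1 l
  simp only [Matrix.mulVec, dotProduct, Pi.one_apply, mul_one] at this
  rw [← this]
  exact Finset.sum_congr rfl fun k _ => hM.apply l k

lemma centroid_act_of_mulVec_one {M : Matrix (Fin K) (Fin K) ℝ} (hM : M.IsSymm)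
    (h1 : M.mulVec 1 = 1) (v : Block K d) : centroid (act M v) = centroid v := by
  rw [centroid, sum_act_of_mulVec_one hM (t := 1) h1, one_smul, centroid]

lemma centroid_act_of_mulVec_zero {M : Matrix (Fin K) (Fin K) ℝ} (hM : M.IsSymm)
    (h1 : M.mulVec 1 = 0) (v : Block K d) : centroid (act M v) = 0 := by
  rw [centroid, sum_act_of_mulVec_one hM (t := 0) h1, zero_smul, smul_zero]

lemma centroid_sub (v w : Block K d) : centroid (v - w) = centroid v - centroid w := by
  simp [centroid, Finset.sum_sub_distrib, smul_sub]

lemma centroid_smul (t : ℝ) (v : Block K d) : centroid (t • v) = t • centroid v := by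
  simp [centroid, ← Finset.smul_sum, smul_comm t]

lemma centroid_const (hK : 1 ≤ K) (x : Vec d) : centroid (fun _ : Fin K => x) = x := by
  have : (K : ℝ) ≠ 0 := by positivity
  simp [centroid, ← Nat.cast_smul_eq_nsmul ℝ, smul_smul, this]

/-- The centroid follows the recursion of a single agent with the averaged gradient estimate. -/
lemma Design.Admissible.centroid_step {D : Design K} {W : Matrix (Fin K) (Fin K) ℝ}
    (hD : D.Admissible W) (hW : W.IsSymm) (μ : ℝ) (X M Z : Block K d) :
    centroid (act D.A (act D.C X - μ • M) - act D.B Z) = centroid X - μ • centroid M := by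
  rw [centroid_sub, centroid_act_of_mulVec_one (hD.A_symm hW) hD.A_one,
    centroid_act_of_mulVec_zero hD.B_symm hD.B_one, centroid_sub, centroid_smul,
    centroid_act_of_mulVec_one (hD.C_symm hW) hD.C_one, sub_zero]

lemma sum_norm_sub_centroid_sq (hK : 1 ≤ K) (v : Block K d) (w : Vec d) :
    ∑ k, ‖v k - w‖ ^ 2 = deviation v + K * ‖centroid v - w‖ ^ 2 := by
  have hK0 : (K : ℝ) ≠ 0 := by positivity
  have h0 : ∑ k, (v k - centroid v) = 0 := by
    simp [centroid, Finset.sum_sub_distrib, ← Nat.cast_smul_eq_nsmul ℝ, smul_smul, hK0]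
  calc ∑ k, ‖v k - w‖ ^ 2
      = ∑ k, (‖v k - centroid v‖ ^ 2 + 2 * inner ℝ (v k - centroid v) (centroid v - w)
          + ‖centroid v - w‖ ^ 2) := by
        refine Finset.sum_congr rfl fun k _ => ?_
        rw [← norm_add_sq_real, sub_add_sub_cancel]
    _ = _ := by
        rw [Finset.sum_add_distrib, Finset.sum_add_distrib, ← Finset.mul_sum, ← sum_inner, h0,
          inner_zero_left]
        simp [deviation]

lemma deviation_nonneg (v : Block K d) : 0 ≤ deviation v :=
  Finset.sum_nonneg fun _ _ => sq_nonneg _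

lemma deviation_le_blockNormSq (hK : 1 ≤ K) (v : Block K d) : deviation v ≤ blockNormSq v := by
  have h := sum_norm_sub_centroid_sq hK v 0
  simp only [sub_zero] at h
  rw [blockNormSq, h]
  have : 0 ≤ (K : ℝ) * ‖centroid v‖ ^ 2 := by positivity
  linarith

/-- Displacement of the network: the motion of the centroid plus that of the deviations. -/
lemma blockNormSq_sub_le (hK : 1 ≤ K) (v w : Block K d) :
    blockNormSq (v - w)
      ≤ K * ‖centroid v - centroid w‖ ^ 2 + 2 * deviation v + 2 * deviation w := by
  have h := sum_norm_sub_centroid_sq hK (v - w) 0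
  simp only [sub_zero] at h
  rw [blockNormSq, h, centroid_sub]
  have : deviation (v - w) ≤ 2 * deviation v + 2 * deviation w := by
    simp only [deviation, centroid_sub, Finset.mul_sum, ← Finset.sum_add_distrib]
    refine Finset.sum_le_sum fun k _ => ?_
    have e : (v - w) k - (centroid v - centroid w) = (v k - centroid v) - (w k - centroid w) := by
      simp only [Pi.sub_apply]; abel
    rw [e]
    have p := parallelogram_law_with_norm ℝ (v k - centroid v) (w k - centroid w)
    nlinarith [sq_nonneg ‖v k - centroid v + (w k - centroid w)‖]
  linarith

variable {D : Design K} (S : Spectral D d)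

namespace Spectral

/-- Coordinates `(Uᵀ ⊗ I) v` of a block vector on `𝟙^⊥`. -/
def proj (v : Block K d) : EuclideanSpace ℝ (Fin (K - 1) × Fin d) :=
  WithLp.toLp 2 fun rc => ∑ k, S.U k rc.1 * v k rc.2

lemma proj_apply (v : Block K d) (rc : Fin (K - 1) × Fin d) :
    S.proj v rc = ∑ k, S.U k rc.1 * v k rc.2 := rfl

lemma proj_add (v w : Block K d) : S.proj (v + w) = S.proj v + S.proj w := by
  ext rc
  simp [proj_apply, mul_add, Finset.sum_add_distrib]

lemma proj_sub (v w : Block K d) : S.proj (v - w) = S.proj v - S.proj w := by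
  ext rc
  simp [proj_apply, mul_sub, Finset.sum_sub_distrib]

lemma proj_smul (t : ℝ) (v : Block K d) : S.proj (t • v) = t • S.proj v := by
  ext rc
  simp [proj_apply, Finset.mul_sum, mul_left_comm]

lemma U_transpose_mulVec_one (hK : 1 ≤ K) : S.U.transpose.mulVec 1 = 0 := by
  have hK0 : (K : ℝ) ≠ 0 := by positivity
  have h1 : (S.U * S.U.transpose).mulVec 1 = 0 := by
    rw [S.U_proj, Matrix.sub_mulVec, Matrix.one_mulVec]
    ext k
    simp [avgMatrix, Matrix.mulVec, dotProduct, hK0]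
  calc S.U.transpose.mulVec 1 = (S.U.transpose * S.U).mulVec (S.U.transpose.mulVec 1) := by
        rw [S.U_orth, Matrix.one_mulVec]
    _ = S.U.transpose.mulVec ((S.U * S.U.transpose).mulVec 1) := by
        simp only [Matrix.mulVec_mulVec, Matrix.mul_assoc]
    _ = 0 := by rw [h1, Matrix.mulVec_zero]

lemma proj_const (hK : 1 ≤ K) (x : Vec d) : S.proj (fun _ : Fin K => x) = 0 := by
  ext rc
  have := congrFun (S.U_transpose_mulVec_one hK) rc.1
  simp only [Matrix.mulVec, dotProduct, Matrix.transpose_apply, Pi.one_apply, mul_one,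
    Pi.zero_apply] at this
  simp [proj_apply, ← Finset.sum_mul, this]

/-- `proj` diagonalizes a symmetric matrix with eigenvector columns `U`. -/
lemma proj_act {M : Matrix (Fin K) (Fin K) ℝ} (hM : M.IsSymm) {m : Fin (K - 1) → ℝ}
    (h : M * S.U = S.U * Matrix.diagonal m) (v : Block K d) :
    S.proj (act M v) = mulE (Matrix.diagonal fun i : Fin (K - 1) × Fin d => m i.1) (S.proj v) := by
  ext rc
  rw [mulE_diagonal_apply, proj_apply, proj_apply]
  have hl : ∀ l, ∑ k, S.U k rc.1 * M k l = m rc.1 * S.U l rc.1 := by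
    intro l
    have := congrFun (congrFun h l) rc.1
    rw [Matrix.mul_diagonal, Matrix.mul_apply] at this
    rw [mul_comm, ← this]
    exact Finset.sum_congr rfl fun k _ => by rw [hM.apply l k, mul_comm]
  calc ∑ k, S.U k rc.1 * act M v k rc.2 = ∑ k, ∑ l, S.U k rc.1 * M k l * v l rc.2 := by
        simp [act, Finset.mul_sum, mul_assoc]
    _ = ∑ l, (∑ k, S.U k rc.1 * M k l) * v l rc.2 := by
        rw [Finset.sum_comm]; simp [Finset.sum_mul]
    _ = _ := by simp [hl, Finset.mul_sum, mul_assoc]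

lemma proj_act_avgMatrix (hK : 1 ≤ K) (v : Block K d) : S.proj (act (avgMatrix K) v) = 0 := by
  have : act (avgMatrix K) v = fun _ => centroid v := by
    ext k c
    simp [act, avgMatrix, centroid, Finset.smul_sum]
  rw [this, S.proj_const hK]

lemma norm_proj_sq (hK : 1 ≤ K) (v : Block K d) : ‖S.proj v‖ ^ 2 = deviation v := by
  have hK0 : (K : ℝ) ≠ 0 := by positivity
  have hv : S.proj v = S.proj (v - fun _ => centroid v) := by
    rw [proj_sub, S.proj_const hK, sub_zero]
  rw [hv, EuclideanSpace.real_norm_sq_eq, Fintype.sum_prod_type_right, deviation]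
  simp only [EuclideanSpace.real_norm_sq_eq]
  refine Eq.trans (Finset.sum_congr rfl fun c _ => ?_) Finset.sum_comm
  set w : Fin K → ℝ := fun k => (v k - centroid v) c with hw
  have hw0 : ∑ k, w k = 0 := by
    simp [hw, centroid, Finset.sum_sub_distrib, hK0]
  have h1 : (S.U * S.U.transpose).mulVec w = w := by
    rw [S.U_proj, Matrix.sub_mulVec, Matrix.one_mulVec]
    ext k
    simp [avgMatrix, Matrix.mulVec, dotProduct, ← Finset.mul_sum, hw0]
  have h2 : S.U.transpose.mulVec w ⬝ᵥ S.U.transpose.mulVec w = w ⬝ᵥ w := by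
    have h3 : w ⬝ᵥ (S.U * S.U.transpose).mulVec w = w ⬝ᵥ w := by rw [h1]
    rw [← h3, ← Matrix.mulVec_mulVec, Matrix.dotProduct_mulVec w, Matrix.mulVec_transpose]
  simpa [dotProduct, Matrix.mulVec, proj_apply, hw, sq] using h2

lemma b_ne_zero (hK : 1 ≤ K) {W : Matrix (Fin K) (Fin K) ℝ} (hD : D.Admissible W)
    (r : Fin (K - 1)) : S.b r ≠ 0 := by
  intro hb
  have h1 : D.B.mulVec (S.U.col r) = 0 := by
    ext k
    have := congrFun (congrFun S.B_eig k) r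
    rw [Matrix.mul_diagonal, hb, mul_zero] at this
    simpa [Matrix.mulVec, dotProduct, Matrix.mul_apply] using this
  obtain ⟨t, ht⟩ := (hD.B_null _).1 h1
  have h2 := congrFun (S.U_transpose_mulVec_one hK) r
  have h3 := congrFun (congrFun S.U_orth r) r
  have ht' : ∀ k, S.U k r = t := fun k => congrFun ht k
  have hK0 : (K : ℝ) ≠ 0 := by positivity
  simp only [Matrix.mulVec, dotProduct, Matrix.transpose_apply, ht', Pi.one_apply, mul_one,
    Finset.sum_const, Finset.card_univ, Fintype.card_fin, nsmul_eq_mul, Pi.zero_apply] at h2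
  have : t = 0 := by simpa [hK0] using h2
  simp [Matrix.mul_apply, ht', this] at h3

/-- Stacking of the two halves of the transformed recursion. -/
def pair (u s : EuclideanSpace ℝ (Fin (K - 1) × Fin d)) :
    EuclideanSpace ℝ ((Fin (K - 1) ⊕ Fin (K - 1)) × Fin d) :=
  WithLp.toLp 2 fun i => Sum.elim (fun r => u (r, i.2)) (fun r => s (r, i.2)) i.1

lemma norm_pair_sq (u s : EuclideanSpace ℝ (Fin (K - 1) × Fin d)) :
    ‖pair u s‖ ^ 2 = ‖u‖ ^ 2 + ‖s‖ ^ 2 := by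
  simp only [EuclideanSpace.real_norm_sq_eq, Fintype.sum_prod_type, Fintype.sum_sum_type, pair,
    Sum.elim_inl, Sum.elim_inr]

lemma pair_add (u s u' s' : EuclideanSpace ℝ (Fin (K - 1) × Fin d)) :
    pair (u + u') (s + s') = pair u s + pair u' s' := by
  ext ⟨r | r, c⟩ <;> simp [pair]

lemma mulE_transition (u s : EuclideanSpace ℝ (Fin (K - 1) × Fin d)) :
    mulE (Matrix.kronecker
      (Matrix.fromBlocks (Matrix.diagonal fun i => S.a i * S.c i - S.b i ^ 2)
        (-Matrix.diagonal S.b) (Matrix.diagonal S.b) 1) (1 : Matrix (Fin d) (Fin d) ℝ)) (pair u s)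
      = pair (mulE S.LamA (mulE (Matrix.diagonal fun i => S.c i.1) u)
            - mulE S.LamB (mulE S.LamB u) - mulE S.LamB s) (mulE S.LamB u + s) := by
  ext ⟨r | r, c⟩
  · simp only [mulE, Matrix.ofLp_toEuclideanCLM, Matrix.mulVec, dotProduct, Matrix.kronecker,
      Matrix.kroneckerMap_apply, Fintype.sum_prod_type, Fintype.sum_sum_type, pair, LamA, LamB]
    simp [Matrix.diagonal_apply, Matrix.one_apply, Matrix.mulVec_diagonal]
    ring
  · simp only [mulE, Matrix.ofLp_toEuclideanCLM, Matrix.mulVec, dotProduct, Matrix.kronecker,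
      Matrix.kroneckerMap_apply, Fintype.sum_prod_type, Fintype.sum_sum_type, pair, LamA, LamB]
    simp [Matrix.diagonal_apply, Matrix.one_apply, Matrix.mulVec_diagonal]

lemma LamB_mul_inv (hK : 1 ≤ K) {W : Matrix (Fin K) (Fin K) ℝ} (hD : D.Admissible W) :
    S.LamB * S.LamB⁻¹ = 1 := by
  refine Matrix.mul_nonsing_inv _ ?_
  rw [LamB, Matrix.det_diagonal, isUnit_iff_ne_zero]
  exact Finset.prod_ne_zero_iff.2 fun i _ => S.b_ne_zero hK hD i.1

/-- The dual half of the transformed recursion: the projected dual variable of the previous round,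
shifted by the fixed point that the current gradient estimate `M` would produce. -/
def dualError (μ : ℝ) (X Z M : Block K d) : EuclideanSpace ℝ (Fin (K - 1) × Fin d) :=
  S.proj Z - mulE S.LamB (S.proj X) + μ • mulE S.LamB⁻¹ (mulE S.LamA (S.proj M))

/-- The coupled consensus error in the coordinates in which the transition matrix is `T`. -/
def coupledError (μ : ℝ) (X Z M : Block K d) :
    EuclideanSpace ℝ ((Fin (K - 1) ⊕ Fin (K - 1)) × Fin d) :=
  mulE S.Q⁻¹ (pair (S.proj X) (S.dualError μ X Z M))

lemma coupledError_step (hK : 1 ≤ K) {W : Matrix (Fin K) (Fin K) ℝ} (hW : W.IsSymm)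
    (hD : D.Admissible W) (μ : ℝ) {X Z M X' Z' : Block K d} (M' : Block K d)
    (hX : X' = act D.A (act D.C X - μ • M) - act D.B Z) (hZ : Z' = Z + act D.B X') :
    S.coupledError μ X' Z' M' = mulE S.T (S.coupledError μ X Z M)
      + mulE S.Q⁻¹ (pair 0 (μ • mulE S.LamB⁻¹ (mulE S.LamA (S.proj (M' - M))))) := by
  have hQ : S.Q⁻¹ * S.Q = 1 := Matrix.nonsing_inv_mul _ S.Q_unit
  have pA := fun v => S.proj_act (hD.A_symm hW) S.A_eig v
  have pB := fun v => S.proj_act hD.B_symm S.B_eig v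
  have pC := fun v => S.proj_act (hD.C_symm hW) S.C_eig v
  have hu : S.proj X' = mulE S.LamA (mulE (Matrix.diagonal fun i => S.c i.1) (S.proj X))
      - mulE S.LamB (mulE S.LamB (S.proj X)) - mulE S.LamB (S.dualError μ X Z M) := by
    have hBB : ∀ x, mulE S.LamB (mulE S.LamB⁻¹ x) = x := fun x => by
      rw [← mulE_mul, S.LamB_mul_inv hK hD, mulE_one]
    rw [hX, proj_sub, pA, pB, proj_sub, proj_smul, pC, dualError]
    change mulE S.LamA _ - mulE S.LamB _ = _
    rw [mulE_sub, mulE_smul, mulE_add, mulE_sub, mulE_smul, hBB]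
    abel
  have hs : S.dualError μ X' Z' M' = (mulE S.LamB (S.proj X) + S.dualError μ X Z M)
      + μ • mulE S.LamB⁻¹ (mulE S.LamA (S.proj (M' - M))) := by
    have hb : S.proj (act D.B X') = mulE S.LamB (S.proj X') := pB X'
    rw [dualError, hZ, proj_add, hb, dualError, proj_sub]
    simp only [mulE, map_sub, smul_sub]
    abel
  have hp : pair (S.proj X') (S.dualError μ X' Z' M')
      = mulE (S.Q * S.T * S.Q⁻¹) (pair (S.proj X) (S.dualError μ X Z M))
        + pair 0 (μ • mulE S.LamB⁻¹ (mulE S.LamA (S.proj (M' - M)))) := by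
    rw [← S.similarity, S.mulE_transition, ← pair_add, add_zero, ← hu, ← hs]
  rw [coupledError, hp, mulE, map_add]
  congr 1
  change mulE _ (mulE _ _) = _
  rw [← mulE_mul, ← Matrix.mul_assoc, ← Matrix.mul_assoc, hQ, Matrix.one_mul, mulE_mul]
  rfl

lemma norm_pair_zero_left (s : EuclideanSpace ℝ (Fin (K - 1) × Fin d)) :
    ‖pair 0 s‖ = ‖s‖ := by
  rw [← sq_eq_sq₀ (norm_nonneg _) (norm_nonneg _), norm_pair_sq]
  simp

/-- Bounds on the spectral constants of one recursion. -/
structure Bounds (ρ lA lBi w₁ w₂ : ℝ) : Prop where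
  T_le : specNorm S.T ≤ ρ
  ρ_lt : ρ < 1
  A_le : specNorm S.LamA ≤ lA
  B_le : specNorm S.LamB⁻¹ ≤ lBi
  Q_le : specNorm S.Q ≤ w₁
  Qinv_le : specNorm S.Q⁻¹ ≤ w₂

variable {S} {ρ lA lBi w₁ w₂ : ℝ}

lemma Bounds.norm_perturbation_le (hS : S.Bounds ρ lA lBi w₁ w₂) (μ : ℝ)
    (x : EuclideanSpace ℝ (Fin (K - 1) × Fin d)) :
    ‖mulE S.Q⁻¹ (pair 0 (μ • mulE S.LamB⁻¹ x))‖ ≤ w₂ * lBi * |μ| * ‖x‖ := by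
  have h2 := (specNorm_nonneg _).trans hS.Qinv_le
  have h3 := (specNorm_nonneg _).trans hS.B_le
  calc _ ≤ specNorm S.Q⁻¹ * ‖pair 0 (μ • mulE S.LamB⁻¹ x)‖ := norm_mulE_le _ _
    _ = specNorm S.Q⁻¹ * (|μ| * ‖mulE S.LamB⁻¹ x‖) := by
        rw [norm_pair_zero_left, norm_smul, Real.norm_eq_abs]
    _ ≤ w₂ * (|μ| * (lBi * ‖x‖)) := by
        have := norm_mulE_le S.LamB⁻¹ x
        have hB := hS.B_le
        have hQ := hS.Qinv_le
        gcongr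
        exact this.trans (by gcongr)
    _ = _ := by ring

/-- The deviations from consensus along the whole trajectory are controlled by the initial
gradient disagreement and by the increments of the gradient estimates. -/
lemma Bounds.sum_deviation_le (hS : S.Bounds ρ lA lBi w₁ w₂) (hK : 1 ≤ K)
    {W : Matrix (Fin K) (Fin K) ℝ} (hW : W.IsSymm) (hD : D.Admissible W) (μ : ℝ)
    {X Z M : ℕ → Block K d}
    (hX : ∀ i, X (i + 1) = act D.A (act D.C (X i) - μ • M i) - act D.B (Z i))
    (hZ : ∀ i, Z (i + 1) = Z i + act D.B (X (i + 1)))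
    {x₀ z₀ : Vec d} (hX0 : X 0 = fun _ => x₀) (hZ0 : Z 0 = fun _ => z₀) (n : ℕ) :
    (1 - ρ) * ∑ i ∈ Finset.range (n + 1), deviation (X i)
      ≤ (w₁ * w₂ * lBi * μ) ^ 2 * blockNormSq (act (D.A - avgMatrix K) (M 0))
        + (w₁ * w₂ * lBi * lA * μ) ^ 2 / (1 - ρ)
          * ∑ i ∈ Finset.range n, blockNormSq (M (i + 1) - M i) := by
  have hρ : 0 < 1 - ρ := sub_pos.2 hS.ρ_lt
  have hρ0 : 0 ≤ ρ := (specNorm_nonneg _).trans hS.T_le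
  have hA0 := (specNorm_nonneg _).trans hS.A_le
  have hB0 := (specNorm_nonneg _).trans hS.B_le
  have h10 := (specNorm_nonneg _).trans hS.Q_le
  have h20 := (specNorm_nonneg _).trans hS.Qinv_le
  set e := fun i => S.coupledError μ (X i) (Z i) (M i) with he
  have hdev : ∀ i, deviation (X i) ≤ w₁ ^ 2 * ‖e i‖ ^ 2 := by
    intro i
    have hQ : S.Q * S.Q⁻¹ = 1 := Matrix.mul_nonsing_inv _ S.Q_unit
    have h1 : pair (S.proj (X i)) (S.dualError μ (X i) (Z i) (M i)) = mulE S.Q (e i) := by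
      rw [he]; simp only [coupledError]
      rw [← mulE_mul, hQ, mulE_one]
    have h2 := norm_pair_sq (S.proj (X i)) (S.dualError μ (X i) (Z i) (M i))
    rw [h1, S.norm_proj_sq hK] at h2
    calc deviation (X i) ≤ ‖mulE S.Q (e i)‖ ^ 2 := by
          rw [h2]; exact le_add_of_nonneg_right (sq_nonneg _)
      _ ≤ (w₁ * ‖e i‖) ^ 2 := by
          gcongr
          exact (norm_mulE_le _ _).trans (by gcongr; exact hS.Q_le)
      _ = _ := mul_pow _ _ _
  have h0 : ‖e 0‖ ^ 2 ≤ (w₂ * lBi * μ) ^ 2 * blockNormSq (act (D.A - avgMatrix K) (M 0)) := by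
    have hM : mulE S.LamA (S.proj (M 0)) = S.proj (act (D.A - avgMatrix K) (M 0)) := by
      have : act (D.A - avgMatrix K) (M 0) = act D.A (M 0) - act (avgMatrix K) (M 0) := by
        ext k c; simp [act, sub_smul]
      rw [this, proj_sub, S.proj_act_avgMatrix hK, sub_zero,
        S.proj_act (hD.A_symm hW) S.A_eig]
      rfl
    have h1 : e 0 = mulE S.Q⁻¹
        (pair 0 (μ • mulE S.LamB⁻¹ (S.proj (act (D.A - avgMatrix K) (M 0))))) := by
      rw [he]
      simp only [coupledError, dualError, hX0, hZ0, S.proj_const hK, hM, mulE, map_zero, sub_zero,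
        zero_add]
    have h2 := hS.norm_perturbation_le μ (S.proj (act (D.A - avgMatrix K) (M 0)))
    rw [← h1] at h2
    calc ‖e 0‖ ^ 2 ≤ (w₂ * lBi * |μ| * ‖S.proj (act (D.A - avgMatrix K) (M 0))‖) ^ 2 := by gcongr
      _ = (w₂ * lBi * μ) ^ 2 * ‖S.proj (act (D.A - avgMatrix K) (M 0))‖ ^ 2 := by
          rw [mul_pow, mul_pow _ |μ|, sq_abs, ← mul_pow]
      _ ≤ _ := by
          rw [S.norm_proj_sq hK]
          gcongr
          exact deviation_le_blockNormSq hK _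
  have hstep : ∀ i, ‖e (i + 1)‖ ^ 2 ≤ ρ * ‖e i‖ ^ 2
      + (w₂ * lBi * lA * μ) ^ 2 / (1 - ρ) * blockNormSq (M (i + 1) - M i) := by
    intro i
    have h1 : e (i + 1) = _ := S.coupledError_step hK hW hD μ (M (i + 1)) (hX i) (hZ i)
    set q := w₂ * lBi * |μ| * ‖mulE S.LamA (S.proj (M (i + 1) - M i))‖ with hq
    have h2 : ‖e (i + 1)‖ ≤ ρ * ‖e i‖ + q := by
      rw [h1]
      refine (norm_add_le _ _).trans (add_le_add ?_ (hS.norm_perturbation_le μ _))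
      exact (norm_mulE_le _ _).trans (by gcongr; exact hS.T_le)
    have hq2 : q ^ 2 ≤ (w₂ * lBi * lA * μ) ^ 2 * blockNormSq (M (i + 1) - M i) := by
      calc q ^ 2 ≤ (w₂ * lBi * |μ| * (lA * ‖S.proj (M (i + 1) - M i)‖)) ^ 2 := by
            rw [hq]
            gcongr
            exact (norm_mulE_le _ _).trans (by gcongr; exact hS.A_le)
        _ = (w₂ * lBi * lA * μ) ^ 2 * ‖S.proj (M (i + 1) - M i)‖ ^ 2 := by
            simp only [mul_pow, sq_abs]; ring
        _ ≤ _ := by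
            rw [S.norm_proj_sq hK]
            gcongr
            exact deviation_le_blockNormSq hK _
    -- convexity of the square with weights `ρ` and `1 - ρ`
    have h3 : (ρ * ‖e i‖ + q) ^ 2 ≤ ρ * ‖e i‖ ^ 2 + q ^ 2 / (1 - ρ) := by
      have : ρ * ‖e i‖ ^ 2 + q ^ 2 / (1 - ρ) - (ρ * ‖e i‖ + q) ^ 2
          = ρ / (1 - ρ) * ((1 - ρ) * ‖e i‖ - q) ^ 2 := by
        field_simp; ring
      have h4 : 0 ≤ ρ / (1 - ρ) * ((1 - ρ) * ‖e i‖ - q) ^ 2 := by positivity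
      linarith
    calc ‖e (i + 1)‖ ^ 2 ≤ (ρ * ‖e i‖ + q) ^ 2 := by gcongr
      _ ≤ _ := h3
      _ ≤ _ := by
          rw [div_mul_eq_mul_div]
          gcongr
  have hsum : (1 - ρ) * ∑ i ∈ Finset.range (n + 1), ‖e i‖ ^ 2 + ρ * ‖e n‖ ^ 2 ≤ ‖e 0‖ ^ 2
      + (w₂ * lBi * lA * μ) ^ 2 / (1 - ρ)
          * ∑ i ∈ Finset.range n, blockNormSq (M (i + 1) - M i) := by
    induction n with
    | zero => simp; linarith
    | succ n ih =>
      rw [Finset.sum_range_succ, Finset.sum_range_succ (fun i => blockNormSq _)]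
      have := hstep n
      linarith
  calc (1 - ρ) * ∑ i ∈ Finset.range (n + 1), deviation (X i)
      ≤ (1 - ρ) * ∑ i ∈ Finset.range (n + 1), w₁ ^ 2 * ‖e i‖ ^ 2 := by
        gcongr; exact hdev _
    _ = w₁ ^ 2 * ((1 - ρ) * ∑ i ∈ Finset.range (n + 1), ‖e i‖ ^ 2) := by
        rw [← Finset.mul_sum]; ring
    _ ≤ w₁ ^ 2 * (((w₂ * lBi * μ) ^ 2 * blockNormSq (act (D.A - avgMatrix K) (M 0)))
        + (w₂ * lBi * lA * μ) ^ 2 / (1 - ρ)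
          * ∑ i ∈ Finset.range n, blockNormSq (M (i + 1) - M i)) := by
        have : 0 ≤ ρ * ‖e n‖ ^ 2 := by positivity
        gcongr
        linarith
    _ = _ := by ring

end Spectral
end Network

/-! ### Resampling one coordinate of the randomness -/

/-- Replacing one coordinate of an infinite product measure by a fresh copy preserves it. -/
lemma measurePreserving_update_infinitePi {ι : Type*} [DecidableEq ι] {X : ι → Type*}
    [∀ i, MeasurableSpace (X i)] (μ : (i : ι) → Measure (X i)) [∀ i, IsProbabilityMeasure (μ i)]
    (a : ι) :
    MeasurePreserving (fun z : (∀ i, X i) × X a => Function.update z.1 a z.2)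
      ((Measure.infinitePi μ).prod (μ a)) (Measure.infinitePi μ) := by
  refine ⟨measurable_update', Measure.eq_infinitePi _ fun s t ht => ?_⟩
  rw [Measure.map_apply measurable_update'
    (MeasurableSet.pi s.countable_toSet fun i _ => ht i)]
  by_cases ha : a ∈ s
  · have : (fun z : (∀ i, X i) × X a => Function.update z.1 a z.2) ⁻¹' ((s : Set ι).pi t)
        = ((s.erase a : Finset ι) : Set ι).pi t ×ˢ t a := by
      ext z
      simp only [Set.mem_preimage, Set.mem_pi, Finset.mem_coe, Set.mem_prod, Finset.mem_erase]
      constructor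
      · intro h
        refine ⟨fun i hi => ?_, ?_⟩
        · simpa [hi.1] using h i hi.2
        · simpa using h a ha
      · rintro ⟨h1, h2⟩ i hi
        rcases eq_or_ne i a with rfl | hne
        · simpa using h2
        · simpa [hne] using h1 i ⟨hne, hi⟩
    rw [this, Measure.prod_prod, Measure.infinitePi_pi _ fun i _ => ht i,
      Finset.prod_erase_mul _ _ ha]
  · have : (fun z : (∀ i, X i) × X a => Function.update z.1 a z.2) ⁻¹' ((s : Set ι).pi t)
        = ((s : Set ι).pi t) ×ˢ Set.univ := by
      ext z
      simp only [Set.mem_preimage, Set.mem_pi, Finset.mem_coe, Set.mem_prod, Set.mem_univ, and_true]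
      refine forall₂_congr fun i hi => ?_
      have hne : i ≠ a := fun h => ha (h ▸ hi)
      simp [hne]
    rw [this, Measure.prod_prod, Measure.infinitePi_pi _ fun i _ => ht i, measure_univ, mul_one]

variable {K : ℕ} {h : Hyper} {Ξ : Type*} [MeasurableSpace Ξ]

instance : DecidableEq (SampleIdx K h) := Classical.decEq _

/-- All the randomness of one run: the samples and the flags. -/
abbrev Sample (K : ℕ) (h : Hyper) (Ξ : Type*) := (SampleIdx K h → Ξ) × (ℕ → Bool)

/-- Replace the sample with label `a`. -/
def resample (a : SampleIdx K h) (q : Sample K h Ξ) (s : Ξ) : Sample K h Ξ :=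
  (Function.update q.1 a s, q.2)

/-- Replace the flag of round `i`. -/
def reflag (i : ℕ) (q : Sample K h Ξ) (t : Bool) : Sample K h Ξ :=
  (q.1, Function.update q.2 i t)

/-- A quantity that does not depend on the sample with label `a`. -/
def FreeOf {α : Type*} (a : SampleIdx K h) (F : Sample K h Ξ → α) : Prop :=
  ∀ q s, F (resample a q s) = F q

/-- A quantity that does not depend on the flag of round `i`. -/
def FlagFree {α : Type*} (i : ℕ) (F : Sample K h Ξ → α) : Prop :=
  ∀ q t, F (reflag i q t) = F q

/-- The law of a flag that is raised with probability `p`. -/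
def flagLaw (p : ℝ) : Measure Bool :=
  ENNReal.ofReal p • Measure.dirac true + ENNReal.ofReal (1 - p) • Measure.dirac false

lemma isProbabilityMeasure_flagLaw {p : ℝ} (h0 : 0 ≤ p) (h1 : p ≤ 1) :
    IsProbabilityMeasure (flagLaw p) := by
  constructor
  simp only [flagLaw, Measure.coe_add, Measure.coe_smul, Pi.add_apply, Pi.smul_apply, measure_univ,
    smul_eq_mul, mul_one]
  rw [← ENNReal.ofReal_add h0 (sub_nonneg.2 h1)]
  simp

instance isProbabilityMeasure_law (data : DataModel K Ξ) (k : Fin K) :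
    IsProbabilityMeasure (data.law k) := by
  cases data with
  | online D => exact inferInstanceAs (IsProbabilityMeasure (D k : Measure Ξ))
  | offline N hN ζ =>
    constructor
    have h0 : (N k : ENNReal) ≠ 0 := by
      exact_mod_cast (hN k).ne'
    simp [DataModel.law, ENNReal.inv_mul_cancel h0 (ENNReal.natCast_ne_top _)]

/-- A law of the randomness that is invariant under independent redrawing of any one sample or
flag. -/
structure IsSampleLaw (P : Measure (Sample K h Ξ)) (data : DataModel K Ξ) : Prop where
  p_nonneg : 0 ≤ h.p
  p_le : h.p ≤ 1
  prob : IsProbabilityMeasure P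
  resample : ∀ a, MeasurePreserving (fun z : Sample K h Ξ × Ξ => resample a z.1 z.2)
    (P.prod (data.law a.agent)) P
  reflag : ∀ i, MeasurePreserving (fun z : Sample K h Ξ × Bool => reflag i z.1 z.2)
    (P.prod (flagLaw h.p)) P

lemma IsSampling.isSampleLaw {Ω : Type*} [MeasurableSpace Ω] {Pr : Measure Ω}
    [IsProbabilityMeasure Pr] {data : DataModel K Ξ} {ξ : SampleIdx K h → Ω → Ξ}
    {π : ℕ → Ω → Bool} (hs : IsSampling Pr data h ξ π) (h0 : 0 ≤ h.p) (h1 : h.p ≤ 1) :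
    IsSampleLaw (Pr.map fun ω => ((fun a => ξ a ω, fun i => π i ω) : Sample K h Ξ)) data := by
  have mξ : Measurable fun ω a => ξ a ω := measurable_pi_iff.2 hs.measurable_ξ
  have mπ : Measurable fun ω i => π i ω := measurable_pi_iff.2 hs.measurable_π
  have := isProbabilityMeasure_flagLaw h0 h1
  have hflag : ∀ i, Pr.map (π i) = flagLaw h.p := by
    intro i
    have hp := Measure.isProbabilityMeasure_map (μ := Pr) (hs.measurable_π i).aemeasurable
    have ht : Pr.map (π i) {true} = ENNReal.ofReal h.p := by
      rw [Measure.map_apply (hs.measurable_π i) (measurableSet_singleton _)]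
      exact hs.law_π i
    refine Measure.ext_of_singleton fun t => ?_
    cases t with
    | true => simp [ht, flagLaw]
    | false =>
      have : ({false} : Set Bool) = {true}ᶜ := by ext t; simp
      rw [this, prob_compl_eq_one_sub (measurableSet_singleton _), ht]
      simp [flagLaw, ENNReal.ofReal_sub _ h0]
  have hP : Pr.map (fun ω => ((fun a => ξ a ω, fun i => π i ω) : Sample K h Ξ))
      = (Measure.infinitePi fun a : SampleIdx K h => data.law a.agent).prod
        (Measure.infinitePi fun _ : ℕ => flagLaw h.p) := by
    have e1 := hs.indep_ξ.map_fun_eq_infinitePi_map hs.measurable_ξ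
    have e2 := hs.indep_π.map_fun_eq_infinitePi_map hs.measurable_π
    simp only [hs.law_ξ] at e1
    simp only [hflag] at e2
    rw [← e1, ← e2]
    exact (indepFun_iff_map_prod_eq_prod_map_map mξ.aemeasurable mπ.aemeasurable).1 hs.indep
  refine ⟨h0, h1, Measure.isProbabilityMeasure_map (mξ.prodMk mπ).aemeasurable, fun a => ?_,
    fun i => ?_⟩
  · rw [hP]
    have hu := (measurePreserving_update_infinitePi
      (fun a : SampleIdx K h => data.law a.agent) a).prod
      (MeasurePreserving.id (Measure.infinitePi fun _ : ℕ => flagLaw h.p))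
    have e1 := measurePreserving_prodAssoc
      (Measure.infinitePi fun a : SampleIdx K h => data.law a.agent)
      (Measure.infinitePi fun _ : ℕ => flagLaw h.p) (data.law a.agent)
    have e2 := (MeasurePreserving.id
      (Measure.infinitePi fun a : SampleIdx K h => data.law a.agent)).prod
      (Measure.measurePreserving_swap (μ := Measure.infinitePi fun _ : ℕ => flagLaw h.p)
        (ν := data.law a.agent))
    have e3 := (measurePreserving_prodAssoc
      (Measure.infinitePi fun a : SampleIdx K h => data.law a.agent)
      (data.law a.agent) (Measure.infinitePi fun _ : ℕ => flagLaw h.p)).symm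
    exact hu.comp (e3.comp (e2.comp e1))
  · rw [hP]
    have hu := (MeasurePreserving.id
      (Measure.infinitePi fun a : SampleIdx K h => data.law a.agent)).prod
      (measurePreserving_update_infinitePi (fun _ : ℕ => flagLaw h.p) i)
    have e1 := measurePreserving_prodAssoc
      (Measure.infinitePi fun a : SampleIdx K h => data.law a.agent)
      (Measure.infinitePi fun _ : ℕ => flagLaw h.p) (flagLaw h.p)
    exact hu.comp e1

variable {P : Measure (Sample K h Ξ)} {data : DataModel K Ξ}

namespace IsSampleLaw

lemma integrable_resample (hP : IsSampleLaw P data) (a : SampleIdx K h)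
    {E : Type*} [NormedAddCommGroup E] {f : Sample K h Ξ → E} (hf : Integrable f P) :
    Integrable (fun z : Sample K h Ξ × Ξ => f (DAMA.resample a z.1 z.2))
      (P.prod (data.law a.agent)) :=
  (hP.resample a).integrable_comp_of_integrable hf

/-- Averaging over one redrawn sample first does not change an expectation. -/
lemma integral_resample (hP : IsSampleLaw P data) (a : SampleIdx K h)
    {E : Type*} [NormedAddCommGroup E] [NormedSpace ℝ E] {f : Sample K h Ξ → E}
    (hf : Integrable f P) :
    ∫ q, f q ∂P = ∫ q, ∫ s, f (DAMA.resample a q s) ∂(data.law a.agent) ∂P := by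
  have := hP.prob
  rw [← integral_prod _ (hP.integrable_resample a hf)]
  conv_lhs => rw [← (hP.resample a).map_eq]
  exact integral_map (hP.resample a).aemeasurable
    ((hP.resample a).map_eq.symm ▸ hf.aestronglyMeasurable)

/-- Expectation of a quantity chosen by the flag of round `i`. -/
lemma integral_ite_flag (hP : IsSampleLaw P data) (i : ℕ) {f₁ f₂ : Sample K h Ξ → ℝ}
    (h₁ : Integrable f₁ P) (h₂ : Integrable f₂ P) (hf₁ : FlagFree i f₁) (hf₂ : FlagFree i f₂) :
    Integrable (fun q => if q.2 i then f₁ q else f₂ q) P ∧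
    ∫ q, (if q.2 i then f₁ q else f₂ q) ∂P = h.p * ∫ q, f₁ q ∂P + (1 - h.p) * ∫ q, f₂ q ∂P := by
  have := hP.prob
  have := isProbabilityMeasure_flagLaw hP.p_nonneg hP.p_le
  have hm : MeasurableSet {q : Sample K h Ξ | q.2 i = true} :=
    measurableSet_eq_fun ((measurable_pi_apply i).comp measurable_snd) measurable_const
  have hint : Integrable (fun q => if q.2 i then f₁ q else f₂ q) P := by
    have := (h₁.indicator hm).add (h₂.indicator hm.compl)
    refine this.congr (Filter.Eventually.of_forall fun q => ?_)
    by_cases hq : q.2 i = true <;> simp [Set.indicator, hq]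
  refine ⟨hint, ?_⟩
  have hint' := (hP.reflag i).integrable_comp_of_integrable hint
  calc ∫ q, (if q.2 i then f₁ q else f₂ q) ∂P
      = ∫ z : Sample K h Ξ × Bool, (if z.2 then f₁ z.1 else f₂ z.1) ∂(P.prod (flagLaw h.p)) := by
        conv_lhs => rw [← (hP.reflag i).map_eq]
        rw [integral_map (hP.reflag i).aemeasurable
          ((hP.reflag i).map_eq.symm ▸ hint.aestronglyMeasurable)]
        refine integral_congr_ae (Filter.Eventually.of_forall fun z => ?_)
        simp only [hf₁ z.1 z.2, hf₂ z.1 z.2]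
        simp [DAMA.reflag]
    _ = ∫ q, (h.p * f₁ q + (1 - h.p) * f₂ q) ∂P := by
        rw [integral_prod]
        · refine integral_congr_ae (Filter.Eventually.of_forall fun q => ?_)
          simp only [flagLaw]
          rw [integral_add_measure]
          · rw [integral_smul_measure, integral_smul_measure, integral_dirac, integral_dirac]
            simp [ENNReal.toReal_ofReal hP.p_nonneg,
              ENNReal.toReal_ofReal (sub_nonneg.2 hP.p_le)]
          · exact (integrable_dirac (by simp)).smul_measure (by simp)
          · exact (integrable_dirac (by simp)).smul_measure (by simp)
        · refine hint'.congr (Filter.Eventually.of_forall fun z => ?_)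
          simp only [Function.comp, hf₁ z.1 z.2, hf₂ z.1 z.2]
          simp [DAMA.reflag]
    _ = _ := by
        rw [integral_add (h₁.const_mul _) (h₂.const_mul _), integral_const_mul,
          integral_const_mul]

/-- Square integrability and a second moment bound from a conditional second moment bound. -/
lemma memLp_of_conditional (hP : IsSampleLaw P data) (a : SampleIdx K h)
    {E : Type*} [NormedAddCommGroup E] {φ : Sample K h Ξ → E}
    (hφ : AEStronglyMeasurable φ P) {ψ : Sample K h Ξ → ℝ} (hψ : Integrable ψ P)
    (h1 : ∀ q, Integrable (fun s => ‖φ (DAMA.resample a q s)‖ ^ 2) (data.law a.agent))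
    (h2 : ∀ q, ∫ s, ‖φ (DAMA.resample a q s)‖ ^ 2 ∂(data.law a.agent) ≤ ψ q) :
    MemLp φ 2 P ∧ ∫ q, ‖φ q‖ ^ 2 ∂P ≤ ∫ q, ψ q ∂P := by
  have := hP.prob
  have hm : AEStronglyMeasurable (fun z : Sample K h Ξ × Ξ => ‖φ (DAMA.resample a z.1 z.2)‖ ^ 2)
      (P.prod (data.law a.agent)) :=
    ((hφ.comp_measurePreserving (hP.resample a)).norm.pow 2)
  have hin : Integrable (fun q => ∫ s, ‖φ (DAMA.resample a q s)‖ ^ 2 ∂(data.law a.agent)) P := by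
    refine hψ.mono' hm.integral_prod_right' (Filter.Eventually.of_forall fun q => ?_)
    rw [Real.norm_eq_abs, abs_of_nonneg (integral_nonneg fun s => sq_nonneg _)]
    exact h2 q
  have hint : Integrable (fun z : Sample K h Ξ × Ξ => ‖φ (DAMA.resample a z.1 z.2)‖ ^ 2)
      (P.prod (data.law a.agent)) := by
    rw [integrable_prod_iff hm]
    refine ⟨Filter.Eventually.of_forall h1, ?_⟩
    simpa using hin
  have hint' : Integrable (fun q => ‖φ q‖ ^ 2) P := by
    have hφ2 : AEStronglyMeasurable (fun q => ‖φ q‖ ^ 2) P := hφ.norm.pow 2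
    exact ((hP.resample a).integrable_comp hφ2).1 hint
  refine ⟨(memLp_two_iff_integrable_sq_norm hφ).2 hint', ?_⟩
  rw [hP.integral_resample a hint']
  exact integral_mono hin hψ h2

variable {E : Type*} [NormedAddCommGroup E] [InnerProductSpace ℝ E]

lemma integrable_inner_of_memLp {u w : Sample K h Ξ → E} (hu : MemLp u 2 P) (hw : MemLp w 2 P) :
    Integrable (fun q => inner ℝ (u q) (w q)) P := by
  refine (hu.norm.integrable_mul hw.norm).mono (hu.1.inner hw.1)
    (Filter.Eventually.of_forall fun q => ?_)
  simpa using norm_inner_le_norm (𝕜 := ℝ) (u q) (w q)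

/-- Fresh noise with conditional mean zero is orthogonal to everything that does not depend on
it. -/
lemma integral_norm_add_sq [CompleteSpace E] (hP : IsSampleLaw P data) (a : SampleIdx K h)
    {u φ : Sample K h Ξ → E} (hu : MemLp u 2 P) (hφ : MemLp φ 2 P) (hfree : FreeOf a u)
    (hφi : ∀ q, Integrable (fun s => φ (DAMA.resample a q s)) (data.law a.agent))
    (hmean : ∀ q, ∫ s, φ (DAMA.resample a q s) ∂(data.law a.agent) = 0) :
    ∫ q, ‖u q + φ q‖ ^ 2 ∂P = ∫ q, ‖u q‖ ^ 2 ∂P + ∫ q, ‖φ q‖ ^ 2 ∂P := by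
  have hi := integrable_inner_of_memLp hu hφ
  have h0 : ∫ q, inner ℝ (u q) (φ q) ∂P = 0 := by
    rw [hP.integral_resample a hi]
    refine integral_eq_zero_of_ae (Filter.Eventually.of_forall fun q => ?_)
    simp only [hfree q]
    rw [integral_inner (hφi q), hmean q, inner_zero_right, Pi.zero_apply]
  have hu2 : Integrable (fun q => ‖u q‖ ^ 2) P := hu.integrable_norm_pow (by norm_num)
  have hφ2 : Integrable (fun q => ‖φ q‖ ^ 2) P := hφ.integrable_norm_pow (by norm_num)
  simp only [norm_add_sq_real]
  have e1 : ∫ q, (‖u q‖ ^ 2 + 2 * inner ℝ (u q) (φ q) + ‖φ q‖ ^ 2) ∂P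
      = ∫ q, (‖u q‖ ^ 2 + 2 * inner ℝ (u q) (φ q)) ∂P + ∫ q, ‖φ q‖ ^ 2 ∂P :=
    integral_add (hu2.add (hi.const_mul 2)) hφ2
  rw [e1, integral_add hu2 (hi.const_mul 2), integral_const_mul, h0]
  ring

/-- Second moment of a sum of independent fresh noises added to a quantity independent of all of
them. -/
lemma integral_norm_add_sum_sq [CompleteSpace E] (hP : IsSampleLaw P data) {ι : Type*}
    {a : ι → SampleIdx K h} (ha : Function.Injective a) (s : Finset ι)
    {u : Sample K h Ξ → E} {φ : ι → Sample K h Ξ → E} (hu : MemLp u 2 P)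
    (hφ : ∀ j, MemLp (φ j) 2 P) (hfree : ∀ j, FreeOf (a j) u)
    (hfreeφ : ∀ j l, a j ≠ a l → FreeOf (a j) (φ l))
    (hφi : ∀ j q, Integrable (fun s => φ j (DAMA.resample (a j) q s)) (data.law (a j).agent))
    (hmean : ∀ j q, ∫ s, φ j (DAMA.resample (a j) q s) ∂(data.law (a j).agent) = 0) :
    ∫ q, ‖u q + ∑ j ∈ s, φ j q‖ ^ 2 ∂P = ∫ q, ‖u q‖ ^ 2 ∂P + ∑ j ∈ s, ∫ q, ‖φ j q‖ ^ 2 ∂P := by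
  classical
  induction s using Finset.induction_on with
  | empty => simp
  | insert j s hj ih =>
    have hmem : MemLp (fun q => u q + ∑ l ∈ s, φ l q) 2 P :=
      hu.add (memLp_finsetSum s fun l _ => hφ l)
    have hfr : FreeOf (a j) fun q => u q + ∑ l ∈ s, φ l q := by
      intro q t
      simp only [hfree j q t]
      congr 1
      refine Finset.sum_congr rfl fun l hl => hfreeφ j l ?_ q t
      exact fun e => hj (ha e ▸ hl)
    have := hP.integral_norm_add_sq (a j) hmem (hφ j) hfr (hφi j) (hmean j)
    rw [Finset.sum_insert hj, ← add_assoc, add_right_comm, ← ih, ← this]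
    refine integral_congr_ae (Filter.Eventually.of_forall fun q => ?_)
    simp only [Finset.sum_insert hj]
    congr 2
    abel

end IsSampleLaw

/-! ### Stochastic gradient oracles -/

section Oracle

variable {K d₁ d₂ d : ℕ} {h : Hyper} {Ξ : Type*} [MeasurableSpace Ξ]

/-- A stochastic gradient `g` with conditional mean `G`: the common content of the assumptions on
the two partial gradients. -/
structure Oracle (data : DataModel K Ξ) (g : Fin K → Vec d₁ → Vec d₂ → Ξ → Vec d)
    (G : Fin K → Vec d₁ → Vec d₂ → Vec d) (Lf σ : ℝ) : Prop where
  meas : ∀ k, Measurable fun z : (Vec d₁ × Vec d₂) × Ξ => g k z.1.1 z.1.2 z.2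
  memLp : ∀ k x y, MemLp (g k x y) 2 (data.law k)
  mean : ∀ k x y, ∫ s, g k x y s ∂(data.law k) = G k x y
  var : ∀ k x y, ∫ s, ‖g k x y s - G k x y‖ ^ 2 ∂(data.law k) ≤ σ ^ 2
  smooth : ∀ k x₁ y₁ x₂ y₂, ∫ s, ‖g k x₁ y₁ s - g k x₂ y₂ s‖ ^ 2 ∂(data.law k)
      ≤ Lf ^ 2 * (‖x₁ - x₂‖ ^ 2 + ‖y₁ - y₂‖ ^ 2)

/-- Bias-variance decomposition. -/
lemma integral_norm_sub_integral_sq {α : Type*} [MeasurableSpace α] {μ : Measure α}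
    [IsProbabilityMeasure μ] {f : α → Vec d} (hf : MemLp f 2 μ) :
    ∫ s, ‖f s - ∫ t, f t ∂μ‖ ^ 2 ∂μ = ∫ s, ‖f s‖ ^ 2 ∂μ - ‖∫ t, f t ∂μ‖ ^ 2 := by
  set c := ∫ t, f t ∂μ with hc
  have hi : Integrable f μ := hf.integrable (by norm_num)
  have h1 : Integrable (fun s => ‖f s‖ ^ 2) μ := hf.integrable_norm_pow (by norm_num)
  have h2 : Integrable (fun s => 2 * inner ℝ (f s) c) μ := (hi.inner_const c).const_mul 2
  have h3 : ∫ s, inner ℝ (f s) c ∂μ = ‖c‖ ^ 2 := by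
    simp_rw [real_inner_comm c]
    rw [integral_inner hi, ← hc, real_inner_self_eq_norm_sq]
  simp only [norm_sub_sq_real]
  have e1 : ∫ s, (‖f s‖ ^ 2 - 2 * inner ℝ (f s) c + ‖c‖ ^ 2) ∂μ
      = ∫ s, (‖f s‖ ^ 2 - 2 * inner ℝ (f s) c) ∂μ + ∫ _, ‖c‖ ^ 2 ∂μ :=
    integral_add (h1.sub h2) (integrable_const _)
  rw [e1, integral_sub h1 h2, integral_const_mul, h3]
  simp
  ring

lemma norm_add_sq_le_five (u w : Vec d) : ‖u + w‖ ^ 2 ≤ 5 / 4 * ‖u‖ ^ 2 + 5 * ‖w‖ ^ 2 := by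
  have h1 := norm_add_le u w
  have h2 : ‖u + w‖ ^ 2 ≤ (‖u‖ + ‖w‖) ^ 2 := by gcongr
  nlinarith [sq_nonneg (‖u‖ / 2 - 2 * ‖w‖)]

lemma norm_add_sq_le_two (u w : Vec d) : ‖u + w‖ ^ 2 ≤ 2 * ‖u‖ ^ 2 + 2 * ‖w‖ ^ 2 := by
  have h1 := norm_add_le u w
  have h2 : ‖u + w‖ ^ 2 ≤ (‖u‖ + ‖w‖) ^ 2 := by gcongr
  nlinarith [sq_nonneg (‖u‖ - ‖w‖)]

namespace Oracle

variable {data : DataModel K Ξ} {g : Fin K → Vec d₁ → Vec d₂ → Ξ → Vec d}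
  {G : Fin K → Vec d₁ → Vec d₂ → Vec d} {Lf σ : ℝ}

lemma lip (hO : Oracle data g G Lf σ) (k : Fin K) (x₁ : Vec d₁) (y₁ : Vec d₂) (x₂ : Vec d₁)
    (y₂ : Vec d₂) :
    ‖G k x₁ y₁ - G k x₂ y₂‖ ^ 2 ≤ Lf ^ 2 * (‖x₁ - x₂‖ ^ 2 + ‖y₁ - y₂‖ ^ 2) := by
  refine le_trans ?_ (hO.smooth k x₁ y₁ x₂ y₂)
  have h1 := hO.memLp k x₁ y₁
  have h2 := hO.memLp k x₂ y₂
  have h3 := integral_norm_sub_integral_sq (h1.sub h2)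
  have h4 : ∫ s, (g k x₁ y₁ - g k x₂ y₂) s ∂(data.law k) = G k x₁ y₁ - G k x₂ y₂ := by
    rw [integral_sub' (h1.integrable (by norm_num)) (h2.integrable (by norm_num)), hO.mean, hO.mean]
  rw [h4] at h3
  have h5 : 0 ≤ ∫ s, ‖(g k x₁ y₁ - g k x₂ y₂) s - (G k x₁ y₁ - G k x₂ y₂)‖ ^ 2 ∂(data.law k) :=
    integral_nonneg fun s => sq_nonneg _
  rw [h3] at h5
  simpa using h5

lemma smooth_centered (hO : Oracle data g G Lf σ) (k : Fin K) (x₁ : Vec d₁) (y₁ : Vec d₂)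
    (x₂ : Vec d₁) (y₂ : Vec d₂) :
    ∫ s, ‖(g k x₁ y₁ s - G k x₁ y₁) - (g k x₂ y₂ s - G k x₂ y₂)‖ ^ 2 ∂(data.law k)
      ≤ Lf ^ 2 * (‖x₁ - x₂‖ ^ 2 + ‖y₁ - y₂‖ ^ 2) := by
  refine le_trans ?_ (hO.smooth k x₁ y₁ x₂ y₂)
  have h1 := hO.memLp k x₁ y₁
  have h2 := hO.memLp k x₂ y₂
  have h3 := integral_norm_sub_integral_sq (h1.sub h2)
  have h4 : ∫ s, (g k x₁ y₁ - g k x₂ y₂) s ∂(data.law k) = G k x₁ y₁ - G k x₂ y₂ := by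
    rw [integral_sub' (h1.integrable (by norm_num)) (h2.integrable (by norm_num)), hO.mean, hO.mean]
  rw [h4] at h3
  simp only [Pi.sub_apply] at h3
  have h5 : ∀ s, (g k x₁ y₁ s - G k x₁ y₁) - (g k x₂ y₂ s - G k x₂ y₂)
      = g k x₁ y₁ s - g k x₂ y₂ s - (G k x₁ y₁ - G k x₂ y₂) := fun s => by abel
  simp only [h5]
  rw [h3]
  have : 0 ≤ ‖G k x₁ y₁ - G k x₂ y₂‖ ^ 2 := sq_nonneg _
  linarith

lemma lip_norm (hO : Oracle data g G Lf σ) (hL : 0 ≤ Lf) (k : Fin K) (x₁ : Vec d₁) (y₁ : Vec d₂)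
    (x₂ : Vec d₁) (y₂ : Vec d₂) :
    ‖G k x₁ y₁ - G k x₂ y₂‖ ≤ Lf * (‖x₁ - x₂‖ + ‖y₁ - y₂‖) := by
  refine abs_le_of_sq_le_sq' ?_ (by positivity) |>.2
  refine (hO.lip k x₁ y₁ x₂ y₂).trans ?_
  rw [mul_pow]
  gcongr
  nlinarith [norm_nonneg (x₁ - x₂), norm_nonneg (y₁ - y₂)]

lemma continuous_mean (hO : Oracle data g G Lf σ) (hL : 0 ≤ Lf) (k : Fin K) :
    Continuous fun z : Vec d₁ × Vec d₂ => G k z.1 z.2 := by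
  refine LipschitzWith.continuous (K := (2 * Lf).toNNReal) (LipschitzWith.of_dist_le_mul ?_)
  intro z w
  rw [Real.coe_toNNReal _ (by positivity), dist_eq_norm, dist_eq_norm]
  refine (hO.lip_norm hL k _ _ _ _).trans ?_
  have h1 : ‖z.1 - w.1‖ ≤ ‖z - w‖ := norm_fst_le (z - w)
  have h2 : ‖z.2 - w.2‖ ≤ ‖z - w‖ := norm_snd_le (z - w)
  nlinarith

lemma measurable_mean (hO : Oracle data g G Lf σ) (hL : 0 ≤ Lf) (k : Fin K) :
    Measurable fun z : Vec d₁ × Vec d₂ => G k z.1 z.2 := (hO.continuous_mean hL k).measurable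

end Oracle

/-! ### Dependence on the rounds -/

/-- The round in which a sample is drawn. -/
def SampleIdx.round : SampleIdx K h → ℕ
  | .init _ _ => 0
  | .large i _ _ => i
  | .mini i _ _ => i

/-- A quantity determined by the samples and flags of the rounds before `r`. -/
def PriorTo {α : Type*} (r : ℕ) (F : Sample K h Ξ → α) : Prop :=
  ∀ q q', (∀ a, a.round < r → q.1 a = q'.1 a) → (∀ j < r, q.2 j = q'.2 j) → F q = F q'

lemma PriorTo.freeOf {Ξ α : Type*} {r : ℕ} {F : Sample K h Ξ → α} (hF : PriorTo r F)
    {a : SampleIdx K h} (ha : r ≤ a.round) : FreeOf a F := by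
  intro q s
  refine hF _ _ (fun b hb => ?_) fun j _ => rfl
  have : b ≠ a := by rintro rfl; omega
  exact Function.update_of_ne this _ _

lemma PriorTo.flagFree {Ξ α : Type*} {r : ℕ} {F : Sample K h Ξ → α} (hF : PriorTo r F)
    {i : ℕ} (hi : r ≤ i) : FlagFree i F := by
  intro q s
  refine hF _ _ (fun b _ => rfl) fun j hj => ?_
  exact Function.update_of_ne (by omega) _ _

variable {P : Measure (Sample K h Ξ)} {data : DataModel K Ξ}

/-- A square integrable random vector determined by the rounds before `r`. -/
structure Prior (P : Measure (Sample K h Ξ)) (r : ℕ) (F : Sample K h Ξ → Vec d) : Prop where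
  meas : Measurable F
  memLp : MemLp F 2 P
  prior : PriorTo r F

namespace Prior

variable {r : ℕ} {F F' : Sample K h Ξ → Vec d}

lemma mono {r' : ℕ} (hF : Prior P r F) (hr : r ≤ r') : Prior P r' F :=
  ⟨hF.meas, hF.memLp, fun q q' h1 h2 => hF.prior q q' (fun a ha => h1 a (ha.trans_le hr))
    fun j hj => h2 j (hj.trans_le hr)⟩

lemma add (hF : Prior P r F) (hF' : Prior P r F') : Prior P r fun q => F q + F' q :=
  ⟨hF.meas.add hF'.meas, hF.memLp.add hF'.memLp, fun q q' h1 h2 => by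
    simp only [hF.prior q q' h1 h2, hF'.prior q q' h1 h2]⟩

lemma sub (hF : Prior P r F) (hF' : Prior P r F') : Prior P r fun q => F q - F' q :=
  ⟨hF.meas.sub hF'.meas, hF.memLp.sub hF'.memLp, fun q q' h1 h2 => by
    simp only [hF.prior q q' h1 h2, hF'.prior q q' h1 h2]⟩

lemma smul (c : ℝ) (hF : Prior P r F) : Prior P r fun q => c • F q :=
  ⟨hF.meas.const_smul c, hF.memLp.const_smul c, fun q q' h1 h2 => by
    simp only [hF.prior q q' h1 h2]⟩

lemma sum {ι : Type*} (s : Finset ι) {F : ι → Sample K h Ξ → Vec d}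
    (hF : ∀ i, Prior P r (F i)) : Prior P r fun q => ∑ i ∈ s, F i q :=
  ⟨Finset.measurable_fun_sum _ fun i _ => (hF i).meas,
    memLp_finsetSum s fun i _ => (hF i).memLp, fun q q' h1 h2 =>
    Finset.sum_congr rfl fun i _ => (hF i).prior q q' h1 h2⟩

lemma const [IsFiniteMeasure P] (c : Vec d) : Prior P r fun _ : Sample K h Ξ => c :=
  ⟨measurable_const, memLp_const c, fun _ _ _ _ => rfl⟩

lemma integrable_norm_sq (hF : Prior P r F) : Integrable (fun q => ‖F q‖ ^ 2) P :=
  hF.memLp.integrable_norm_pow (by norm_num)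

end Prior

lemma Oracle.prior_mean {g : Fin K → Vec d₁ → Vec d₂ → Ξ → Vec d}
    {G : Fin K → Vec d₁ → Vec d₂ → Vec d} {Lf σ : ℝ} (hO : Oracle data g G Lf σ) (hL : 0 ≤ Lf)
    [IsFiniteMeasure P] {r : ℕ} {X : Sample K h Ξ → Vec d₁} {Y : Sample K h Ξ → Vec d₂}
    (hX : Prior P r X) (hY : Prior P r Y) (k : Fin K) : Prior P r fun q => G k (X q) (Y q) := by
  have hm : Measurable fun q => G k (X q) (Y q) :=
    (hO.measurable_mean hL k).comp (hX.meas.prodMk hY.meas)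
  refine ⟨hm, ?_, fun q q' h1 h2 => by simp only [hX.prior q q' h1 h2, hY.prior q q' h1 h2]⟩
  have h0 : MemLp (fun q => Lf * (‖X q‖ + ‖Y q‖)) 2 P :=
    (hX.memLp.norm.add hY.memLp.norm).const_mul Lf
  have h3 : MemLp (fun q => G k (X q) (Y q) - G k 0 0) 2 P := by
    refine h0.of_le (hm.sub_const _).aestronglyMeasurable (Filter.Eventually.of_forall fun q => ?_)
    have h1 := hO.lip_norm hL k (X q) (Y q) 0 0
    rw [sub_zero, sub_zero] at h1
    exact h1.trans (le_abs_self _)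
  have h4 : MemLp (fun _ : Sample K h Ξ => G k 0 0) 2 P := memLp_const _
  refine (h3.add h4).ae_eq (Filter.Eventually.of_forall fun q => ?_)
  simp

/-! ### Averages of fresh noise -/

/-- Centered noise of the agents: for every past `q`, a centered function `φ k q` of one sample of
agent `k` with second moment at most `ψ k q`; `a k j` labels the `j`-th sample of agent `k`. -/
structure FreshNoise (P : Measure (Sample K h Ξ)) (data : DataModel K Ξ) {n : ℕ}
    (a : Fin K → Fin n → SampleIdx K h) (φ : Fin K → Sample K h Ξ → Ξ → Vec d)
    (ψ : Fin K → Sample K h Ξ → ℝ) : Prop where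
  inj : Function.Injective fun i : Fin K × Fin n => a i.1 i.2
  agent : ∀ k j, (a k j).agent = k
  meas : ∀ k, Measurable fun z : Sample K h Ξ × Ξ => φ k z.1 z.2
  free : ∀ k j l, FreeOf (a k j) (φ l)
  memLp : ∀ k q, MemLp (φ k q) 2 (data.law k)
  mean : ∀ k q, ∫ s, φ k q s ∂(data.law k) = 0
  le : ∀ k q, ∫ s, ‖φ k q s‖ ^ 2 ∂(data.law k) ≤ ψ k q
  int : ∀ k, Integrable (ψ k) P

namespace FreshNoise

variable {n : ℕ} {a : Fin K → Fin n → SampleIdx K h} {φ : Fin K → Sample K h Ξ → Ξ → Vec d}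
    {ψ : Fin K → Sample K h Ξ → ℝ}

/-- The noise averaged over the batch. -/
def avg (a : Fin K → Fin n → SampleIdx K h) (φ : Fin K → Sample K h Ξ → Ξ → Vec d)
    (q : Sample K h Ξ) (k : Fin K) : Vec d := (n : ℝ)⁻¹ • ∑ j, φ k q (q.1 (a k j))

lemma measurable_single (hφ : FreshNoise P data a φ ψ) (k : Fin K) (j : Fin n) :
    Measurable fun q => φ k q (q.1 (a k j)) :=
  (hφ.meas k).comp (measurable_id.prodMk ((measurable_pi_apply _).comp measurable_fst))

lemma resample_single (hφ : FreshNoise P data a φ ψ) (k : Fin K) (j : Fin n)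
    (q : Sample K h Ξ) (s : Ξ) :
    φ k (resample (a k j) q s) ((resample (a k j) q s).1 (a k j)) = φ k q s := by
  rw [hφ.free k j k q s]
  simp [resample]

lemma memLp_single (hφ : FreshNoise P data a φ ψ) (hP : IsSampleLaw P data) (k : Fin K)
    (j : Fin n) : MemLp (fun q => φ k q (q.1 (a k j))) 2 P ∧
      ∫ q, ‖φ k q (q.1 (a k j))‖ ^ 2 ∂P ≤ ∫ q, ψ k q ∂P := by
  refine hP.memLp_of_conditional (a k j) (hφ.measurable_single k j).aestronglyMeasurable
    (hφ.int k) (fun q => ?_) fun q => ?_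
  · simp only [hφ.resample_single k j q, hφ.agent]
    exact (hφ.memLp k q).integrable_norm_pow (by norm_num)
  · simp only [hφ.resample_single k j q, hφ.agent]
    exact hφ.le k q

lemma measurable_avg (hφ : FreshNoise P data a φ ψ) (k : Fin K) :
    Measurable fun q => avg a φ q k :=
  (Finset.measurable_fun_sum _ fun j _ => hφ.measurable_single k j).const_smul ((n : ℝ)⁻¹)

lemma memLp_avg (hφ : FreshNoise P data a φ ψ) (hP : IsSampleLaw P data) (k : Fin K) :
    MemLp (fun q => avg a φ q k) 2 P :=
  (memLp_finsetSum _ fun j _ => (hφ.memLp_single hP k j).1).const_smul ((n : ℝ)⁻¹)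

/-- Averaging over a batch of `n` independent samples per agent divides the second moment by `n`,
and the noises of different agents are uncorrelated. -/
lemma integral_norm_sq_le (hφ : FreshNoise P data a φ ψ) (hP : IsSampleLaw P data) (hn : 1 ≤ n)
    {u : Sample K h Ξ → Vec d} (hu : MemLp u 2 P) (hfree : ∀ k j, FreeOf (a k j) u)
    (c : Fin K → ℝ) :
    ∫ q, ‖u q + ∑ k, c k • avg a φ q k‖ ^ 2 ∂P
      ≤ ∫ q, ‖u q‖ ^ 2 ∂P + ∑ k, c k ^ 2 * ((n : ℝ)⁻¹ * ∫ q, ψ k q ∂P) := by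
  have hn0 : (n : ℝ) ≠ 0 := by positivity
  have e : ∀ q, ∑ k, c k • avg a φ q k
      = ∑ i : Fin K × Fin n, (c i.1 * (n : ℝ)⁻¹) • φ i.1 q (q.1 (a i.1 i.2)) := by
    intro q
    rw [Fintype.sum_prod_type]
    simp only [avg, Finset.smul_sum, smul_smul]
  simp only [e]
  rw [hP.integral_norm_add_sum_sq (a := fun i : Fin K × Fin n => a i.1 i.2) hφ.inj Finset.univ
    (u := u) (φ := fun i q => (c i.1 * (n : ℝ)⁻¹) • φ i.1 q (q.1 (a i.1 i.2))) hu
    (fun i => (hφ.memLp_single hP i.1 i.2).1.const_smul (c i.1 * (n : ℝ)⁻¹))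
    (fun i => hfree i.1 i.2)]
  · gcongr
    rw [Fintype.sum_prod_type]
    refine Finset.sum_le_sum fun k _ => ?_
    calc ∑ j : Fin n, ∫ q, ‖(c k * (n : ℝ)⁻¹) • φ k q (q.1 (a k j))‖ ^ 2 ∂P
        ≤ ∑ _j : Fin n, (c k * (n : ℝ)⁻¹) ^ 2 * ∫ q, ψ k q ∂P := by
          refine Finset.sum_le_sum fun j _ => ?_
          simp only [norm_smul, mul_pow, Real.norm_eq_abs, sq_abs]
          rw [integral_const_mul]
          exact mul_le_mul_of_nonneg_left (hφ.memLp_single hP k j).2 (by positivity)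
      _ = _ := by
          rw [Finset.sum_const, Finset.card_univ, Fintype.card_fin, nsmul_eq_mul]
          field_simp
  · intro i l hil q s
    have h1 := hφ.free i.1 i.2 l.1 q s
    simp only [h1]
    congr 2
    exact Function.update_of_ne hil.symm _ _
  · intro i q
    simp only [hφ.resample_single i.1 i.2 q, hφ.agent]
    exact ((hφ.memLp i.1 q).integrable (by norm_num)).smul (c i.1 * (n : ℝ)⁻¹)
  · intro i q
    simp only [hφ.resample_single i.1 i.2 q, hφ.agent]
    rw [integral_smul, hφ.mean, smul_zero]

end FreshNoise

end Oracle

/-! ### The GRACE estimator -/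

section Grace

variable {K d₁ d₂ d : ℕ} {h : Hyper} {Ξ : Type*} [MeasurableSpace Ξ]
  {P : Measure (Sample K h Ξ)} {data : DataModel K Ξ}
  {g : Fin K → Vec d₁ → Vec d₂ → Ξ → Vec d} {G : Fin K → Vec d₁ → Vec d₂ → Vec d} {Lf σ : ℝ}

namespace Oracle

/-- Centered noise of the oracle at the models `X, Y`. -/
def pointNoise (g : Fin K → Vec d₁ → Vec d₂ → Ξ → Vec d) (G : Fin K → Vec d₁ → Vec d₂ → Vec d)
    (X : Sample K h Ξ → Block K d₁) (Y : Sample K h Ξ → Block K d₂)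
    (k : Fin K) (q : Sample K h Ξ) (s : Ξ) : Vec d :=
  g k (X q k) (Y q k) s - G k (X q k) (Y q k)

/-- Noise of one minibatch sample in the recursive branch of GRACE. -/
def miniNoise (g : Fin K → Vec d₁ → Vec d₂ → Ξ → Vec d) (G : Fin K → Vec d₁ → Vec d₂ → Vec d)
    (X' : Sample K h Ξ → Block K d₁) (Y' : Sample K h Ξ → Block K d₂)
    (X : Sample K h Ξ → Block K d₁) (Y : Sample K h Ξ → Block K d₂)
    (k : Fin K) (q : Sample K h Ξ) (s : Ξ) : Vec d :=
  (1 - h.β) • (pointNoise g G X Y k q s - pointNoise g G X' Y' k q s)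
    + h.β • pointNoise g G X Y k q s

/-- Squared displacement of agent `k`. -/
def moveSq (X' : Sample K h Ξ → Block K d₁) (Y' : Sample K h Ξ → Block K d₂)
    (X : Sample K h Ξ → Block K d₁) (Y : Sample K h Ξ → Block K d₂)
    (k : Fin K) (q : Sample K h Ξ) : ℝ :=
  ‖X q k - X' q k‖ ^ 2 + ‖Y q k - Y' q k‖ ^ 2

variable {r : ℕ} {X' X : Sample K h Ξ → Block K d₁} {Y' Y : Sample K h Ξ → Block K d₂}
  {M' : Sample K h Ξ → Block K d}

lemma integrable_moveSq (hX' : ∀ k, Prior P r fun q => X' q k)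
    (hY' : ∀ k, Prior P r fun q => Y' q k)
    (hX : ∀ k, Prior P r fun q => X q k) (hY : ∀ k, Prior P r fun q => Y q k) (k : Fin K) :
    Integrable (moveSq X' Y' X Y k) P :=
  ((hX k).sub (hX' k)).integrable_norm_sq.add ((hY k).sub (hY' k)).integrable_norm_sq

lemma block_resample {d : ℕ} {Z : Sample K h Ξ → Block K d} (hZ : ∀ k, Prior P r fun q => Z q k)
    {a : SampleIdx K h} (ha : r ≤ a.round) (q : Sample K h Ξ) (s : Ξ) :
    Z (resample a q s) = Z q := funext fun k => (hZ k).prior.freeOf ha q s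

lemma block_reflag {d : ℕ} {Z : Sample K h Ξ → Block K d} (hZ : ∀ k, Prior P r fun q => Z q k)
    (q : Sample K h Ξ) (t : Bool) :
    Z (reflag r q t) = Z q := funext fun k => (hZ k).prior.flagFree le_rfl q t

lemma block_congr {d : ℕ} {Z : Sample K h Ξ → Block K d} (hZ : ∀ k, Prior P r fun q => Z q k)
    {q q' : Sample K h Ξ} (h1 : ∀ a, a.round < r → q.1 a = q'.1 a)
    (h2 : ∀ j < r, q.2 j = q'.2 j) : Z q = Z q' := funext fun k => (hZ k).prior q q' h1 h2

lemma measurable_pointNoise (hO : Oracle data g G Lf σ) (hL : 0 ≤ Lf)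
    (hX : ∀ k, Prior P r fun q => X q k) (hY : ∀ k, Prior P r fun q => Y q k) (k : Fin K) :
    Measurable fun z : Sample K h Ξ × Ξ => pointNoise g G X Y k z.1 z.2 := by
  have h1 : Measurable fun z : Sample K h Ξ × Ξ => (X z.1 k, Y z.1 k) :=
    ((hX k).meas.comp measurable_fst).prodMk ((hY k).meas.comp measurable_fst)
  exact ((hO.meas k).comp (h1.prodMk measurable_snd)).sub ((hO.measurable_mean hL k).comp h1)

lemma memLp_pointNoise (hO : Oracle data g G Lf σ) (k : Fin K) (q : Sample K h Ξ) :
    MemLp (pointNoise g G X Y k q) 2 (data.law k) :=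
  (hO.memLp k _ _).sub (memLp_const _)

lemma integral_pointNoise (hO : Oracle data g G Lf σ) (k : Fin K) (q : Sample K h Ξ) :
    ∫ s, pointNoise g G X Y k q s ∂(data.law k) = 0 := by
  simp only [pointNoise]
  rw [integral_sub ((hO.memLp k _ _).integrable (by norm_num)) (integrable_const _), hO.mean]
  simp

lemma freeOf_pointNoise (hX : ∀ k, Prior P r fun q => X q k)
    (hY : ∀ k, Prior P r fun q => Y q k) {a : SampleIdx K h} (ha : r ≤ a.round) (k : Fin K) :
    FreeOf a (pointNoise g G X Y k) := by
  intro q s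
  funext t
  simp only [pointNoise]
  rw [block_resample hX ha, block_resample hY ha]

lemma freshNoise_point (hO : Oracle data g G Lf σ) (hL : 0 ≤ Lf) [IsFiniteMeasure P]
    (hX : ∀ k, Prior P r fun q => X q k) (hY : ∀ k, Prior P r fun q => Y q k)
    {n : ℕ} {a : Fin K → Fin n → SampleIdx K h}
    (inj : Function.Injective fun i : Fin K × Fin n => a i.1 i.2)
    (agent : ∀ k j, (a k j).agent = k) (round : ∀ k j, r ≤ (a k j).round) :
    FreshNoise P data a (pointNoise g G X Y) fun _ _ => σ ^ 2 where
  inj := inj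
  agent := agent
  meas := hO.measurable_pointNoise hL hX hY
  free k j l := freeOf_pointNoise hX hY (round k j) l
  memLp k q := hO.memLp_pointNoise k q
  mean k q := hO.integral_pointNoise k q
  le k _ := hO.var k _ _
  int _ := integrable_const _

lemma freshNoise_mini (hO : Oracle data g G Lf σ) (hL : 0 ≤ Lf) [IsFiniteMeasure P]
    (hβ0 : 0 ≤ h.β) (hβ1 : h.β ≤ 1)
    (hX' : ∀ k, Prior P r fun q => X' q k) (hY' : ∀ k, Prior P r fun q => Y' q k)
    (hX : ∀ k, Prior P r fun q => X q k) (hY : ∀ k, Prior P r fun q => Y q k) :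
    FreshNoise P data (fun k j => SampleIdx.mini r k j) (miniNoise g G X' Y' X Y)
      fun k q => 5 / 4 * Lf ^ 2 * moveSq X' Y' X Y k q + 5 * h.β ^ 2 * σ ^ 2 where
  inj := by
    rintro ⟨k, j⟩ ⟨k', j'⟩ e
    simpa using e
  agent _ _ := rfl
  meas k := (((hO.measurable_pointNoise hL hX hY k).sub
    (hO.measurable_pointNoise hL hX' hY' k)).const_smul (1 - h.β)).add
      ((hO.measurable_pointNoise hL hX hY k).const_smul h.β)
  free k j l q s := by
    funext t
    simp only [miniNoise]
    rw [freeOf_pointNoise hX hY (a := SampleIdx.mini r k j) le_rfl l q s,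
      freeOf_pointNoise hX' hY' (a := SampleIdx.mini r k j) le_rfl l q s]
  memLp k q := (((hO.memLp_pointNoise k q).sub (hO.memLp_pointNoise k q)).const_smul (1 - h.β)).add
    ((hO.memLp_pointNoise k q).const_smul h.β)
  mean k q := by
    have i1 : Integrable (pointNoise g G X Y k q) (data.law k) :=
      (hO.memLp_pointNoise k q).integrable (by norm_num)
    have i2 : Integrable (pointNoise g G X' Y' k q) (data.law k) :=
      (hO.memLp_pointNoise k q).integrable (by norm_num)
    simp only [miniNoise]
    have e := integral_add ((i1.sub i2).smul (1 - h.β)) (i1.smul h.β)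
    simp only [Pi.smul_apply, Pi.sub_apply] at e
    rw [e, integral_smul, integral_smul, integral_sub i1 i2, hO.integral_pointNoise,
      hO.integral_pointNoise]
    simp
  le k q := by
    have m1 : MemLp (pointNoise g G X Y k q) 2 (data.law k) := hO.memLp_pointNoise k q
    have m2 : MemLp (pointNoise g G X' Y' k q) 2 (data.law k) := hO.memLp_pointNoise k q
    have i1 : Integrable (fun s => ‖pointNoise g G X Y k q s - pointNoise g G X' Y' k q s‖ ^ 2)
        (data.law k) := (m1.sub m2).integrable_norm_pow (by norm_num)
    have i2 : Integrable (fun s => ‖pointNoise g G X Y k q s‖ ^ 2) (data.law k) :=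
      m1.integrable_norm_pow (by norm_num)
    have i3 : Integrable (fun s => ‖miniNoise g G X' Y' X Y k q s‖ ^ 2) (data.law k) :=
      (((m1.sub m2).const_smul (1 - h.β)).add (m1.const_smul h.β)).integrable_norm_pow (by norm_num)
    calc ∫ s, ‖miniNoise g G X' Y' X Y k q s‖ ^ 2 ∂(data.law k)
        ≤ ∫ s, (5 / 4 * ‖pointNoise g G X Y k q s - pointNoise g G X' Y' k q s‖ ^ 2
            + 5 * h.β ^ 2 * ‖pointNoise g G X Y k q s‖ ^ 2) ∂(data.law k) := by
          refine integral_mono i3 ((i1.const_mul _).add (i2.const_mul _)) fun s => ?_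
          refine (norm_add_sq_le_five _ _).trans ?_
          simp only [norm_smul, mul_pow, Real.norm_eq_abs, sq_abs]
          have : (1 - h.β) ^ 2 * ‖pointNoise g G X Y k q s - pointNoise g G X' Y' k q s‖ ^ 2
              ≤ ‖pointNoise g G X Y k q s - pointNoise g G X' Y' k q s‖ ^ 2 :=
            mul_le_of_le_one_left (sq_nonneg _) (pow_le_one₀ (by linarith) (by linarith))
          linarith
      _ = 5 / 4 * ∫ s, ‖pointNoise g G X Y k q s - pointNoise g G X' Y' k q s‖ ^ 2 ∂(data.law k)
            + 5 * h.β ^ 2 * ∫ s, ‖pointNoise g G X Y k q s‖ ^ 2 ∂(data.law k) := by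
          rw [integral_add (i1.const_mul _) (i2.const_mul _), integral_const_mul,
            integral_const_mul]
      _ ≤ 5 / 4 * (Lf ^ 2 * moveSq X' Y' X Y k q) + 5 * h.β ^ 2 * σ ^ 2 := by
          gcongr
          · exact hO.smooth_centered k _ _ _ _
          · exact hO.var k _ _
      _ = _ := by ring
  int k := ((integrable_moveSq hX' hY' hX hY k).const_mul _).add (integrable_const _)

/-- Error of the large-batch branch of GRACE. -/
def largeError (data : DataModel K Ξ) (g : Fin K → Vec d₁ → Vec d₂ → Ξ → Vec d)
    (G : Fin K → Vec d₁ → Vec d₂ → Vec d) (r : ℕ)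
    (X : Sample K h Ξ → Block K d₁) (Y : Sample K h Ξ → Block K d₂)
    (q : Sample K h Ξ) (k : Fin K) : Vec d :=
  largeEstimate h data g q.1 r (X q) (Y q) k - G k (X q k) (Y q k)

lemma average_sub {n : ℕ} (hn : 1 ≤ n) (f : Fin n → Vec d) (c : Vec d) :
    (n : ℝ)⁻¹ • ∑ j, f j - c = (n : ℝ)⁻¹ • ∑ j, (f j - c) := by
  have hn0 : (n : ℝ) ≠ 0 := by positivity
  simp [Finset.sum_sub_distrib, smul_sub, ← Nat.cast_smul_eq_nsmul ℝ, smul_smul, hn0]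

lemma largeError_online {D : Fin K → ProbabilityMeasure Ξ} (hB : 1 ≤ h.B) (q : Sample K h Ξ) :
    largeError (DataModel.online D) g G r X Y q
      = FreshNoise.avg (fun k j => SampleIdx.large r k j) (pointNoise g G X Y) q := by
  funext k
  exact average_sub hB _ _

/-- In the offline scenario the large-batch branch returns the exact local gradients. -/
lemma largeError_offline {N : Fin K → ℕ} {hN : ∀ k, 0 < N k} {ζ : (k : Fin K) → Fin (N k) → Ξ}
    (hO : Oracle (DataModel.offline N hN ζ) g G Lf σ) (q : Sample K h Ξ) (k : Fin K) :
    largeError (DataModel.offline N hN ζ) g G r X Y q k = 0 := by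
  have hm : Measurable (g k (X q k) (Y q k)) := 
    (hO.meas k).comp (measurable_prodMk_left (x := (X q k, Y q k)))
  have h1 := hO.mean k (X q k) (Y q k)
  simp only [DataModel.law] at h1
  rw [integral_smul_measure, integral_finsetSum_measure] at h1
  · simp only [integral_dirac' _ _ hm.stronglyMeasurable] at h1
    simp only [largeError, largeEstimate]
    rw [← h1]
    simp
  · intro t _
    exact integrable_dirac' hm.stronglyMeasurable (by simp)

/-- Second moment of the large-batch error: `σ² / B` per agent online, zero offline. -/
lemma largeError_bound (hO : Oracle data g G Lf σ) (hL : 0 ≤ Lf) (hP : IsSampleLaw P data)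
    (hB : 1 ≤ h.B) (hX : ∀ k, Prior P r fun q => X q k) (hY : ∀ k, Prior P r fun q => Y q k) :
    (∀ k, Measurable fun q => largeError data g G r X Y q k) ∧
    (∀ k, MemLp (fun q => largeError data g G r X Y q k) 2 P) ∧
    ∀ {u : Sample K h Ξ → Vec d}, Prior P r u → ∀ c : Fin K → ℝ,
      ∫ q, ‖u q + ∑ k, c k • largeError data g G r X Y q k‖ ^ 2 ∂P
        ≤ ∫ q, ‖u q‖ ^ 2 ∂P + ∑ k, c k ^ 2 * (data.onlineIndicator / h.B * σ ^ 2) := by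
  have := hP.prob
  cases data with
  | online D =>
    have hF : FreshNoise P (DataModel.online D) (fun k (j : Fin h.B) => SampleIdx.large r k j)
        (pointNoise g G X Y) fun _ _ => σ ^ 2 := by
      refine hO.freshNoise_point hL hX hY ?_ (fun _ _ => rfl) fun _ _ => le_rfl
      rintro ⟨k, j⟩ ⟨k', j'⟩ e
      simpa using e
    simp only [largeError_online hB]
    refine ⟨hF.measurable_avg, hF.memLp_avg hP, fun {u} hu c => ?_⟩
    refine (hF.integral_norm_sq_le hP hB hu.memLp
      (fun k j => hu.prior.freeOf (a := SampleIdx.large r k j) le_rfl) c).trans (le_of_eq ?_)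
    simp [DataModel.onlineIndicator]
  | offline N hN ζ =>
    simp only [hO.largeError_offline, smul_zero, Finset.sum_const_zero, add_zero]
    refine ⟨fun _ => measurable_const, fun _ => memLp_const _, fun {u} hu c => ?_⟩
    simp [DataModel.onlineIndicator]

lemma flagFree_avg {Ξ : Type*} {n : ℕ} {a : Fin K → Fin n → SampleIdx K h}
    {φ : Fin K → Sample K h Ξ → Ξ → Vec d} (hφ : ∀ k, FlagFree r (φ k)) (k : Fin K) :
    FlagFree r fun q => FreshNoise.avg a φ q k := by
  intro q t
  simp only [FreshNoise.avg]
  congr 1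
  refine Finset.sum_congr rfl fun j _ => ?_
  rw [hφ k q t]
  rfl

lemma flagFree_miniNoise (hX' : ∀ k, Prior P r fun q => X' q k)
    (hY' : ∀ k, Prior P r fun q => Y' q k) (hX : ∀ k, Prior P r fun q => X q k)
    (hY : ∀ k, Prior P r fun q => Y q k) (k : Fin K) :
    FlagFree r (miniNoise g G X' Y' X Y k) := by
  intro q t
  funext s
  simp only [miniNoise, pointNoise]
  rw [block_reflag hX, block_reflag hY, block_reflag hX', block_reflag hY']

lemma flagFree_largeError (hX : ∀ k, Prior P r fun q => X q k)
    (hY : ∀ k, Prior P r fun q => Y q k) (k : Fin K) :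
    FlagFree r fun q => largeError data g G r X Y q k := by
  intro q t
  simp only [largeError, block_reflag hX, block_reflag hY]
  rfl

/-- Mean parts and fresh noise of the GRACE estimator in its two branches. -/
lemma grace_eq (hb : 1 ≤ h.b) (q : Sample K h Ξ) (k : Fin K) :
    grace h data g q.1 (q.2 r) r (M' q) (X' q) (Y' q) (X q) (Y q) k =
      if q.2 r then G k (X q k) (Y q k) + largeError data g G r X Y q k
      else G k (X q k) (Y q k) + (1 - h.β) • (M' q k - G k (X' q k) (Y' q k))
        + FreshNoise.avg (fun k j => SampleIdx.mini r k j) (miniNoise g G X' Y' X Y) q k := by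
  have hb0 : (h.b : ℝ) ≠ 0 := by positivity
  rw [grace]
  split_ifs with hf
  · simp [largeError]
  · have e1 := average_sub hb (fun j => g k (X q k) (Y q k) (q.1 (.mini r k j)))
      (G k (X q k) (Y q k))
    have e2 := average_sub hb (fun j => g k (X' q k) (Y' q k) (q.1 (.mini r k j)))
      (G k (X' q k) (Y' q k))
    have e3 : FreshNoise.avg (fun k j => SampleIdx.mini r k j) (miniNoise g G X' Y' X Y) q k
        = (1 - h.β) • ((h.b : ℝ)⁻¹ • ∑ j, pointNoise g G X Y k q (q.1 (.mini r k j))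
            - (h.b : ℝ)⁻¹ • ∑ j, pointNoise g G X' Y' k q (q.1 (.mini r k j)))
          + h.β • ((h.b : ℝ)⁻¹ • ∑ j, pointNoise g G X Y k q (q.1 (.mini r k j))) := by
      simp only [FreshNoise.avg, miniNoise, Finset.sum_add_distrib, ← Finset.smul_sum,
        Finset.sum_sub_distrib, smul_add, smul_sub, smul_comm (h.b : ℝ)⁻¹]
    simp only [pointNoise] at e3
    rw [e3, ← e1, ← e2]
    simp only [Pi.add_apply, Pi.smul_apply, Pi.sub_apply, miniEstimate]
    module

section Round

variable (hO : Oracle data g G Lf σ) (hL : 0 ≤ Lf) (hP : IsSampleLaw P data)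
  (hβ0 : 0 ≤ h.β) (hβ1 : h.β ≤ 1) (hb : 1 ≤ h.b) (hB : 1 ≤ h.B)
  (hX' : ∀ k, Prior P r fun q => X' q k) (hY' : ∀ k, Prior P r fun q => Y' q k)
  (hX : ∀ k, Prior P r fun q => X q k) (hY : ∀ k, Prior P r fun q => Y q k)
  (hM : ∀ k, Prior P r fun q => M' q k)

include hO hL hP hβ0 hβ1 hb hB hX' hY' hX hY in
/-- Second moment after one GRACE round, for arbitrary mean parts of the two branches. -/
lemma integral_branch_le {u₁ u₂ : Sample K h Ξ → Vec d} (hu₁ : Prior P r u₁) (hu₂ : Prior P r u₂)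
    (c : Fin K → ℝ) {F : Sample K h Ξ → Vec d}
    (hF : ∀ q, F q = if q.2 r then u₁ q + ∑ k, c k • largeError data g G r X Y q k
      else u₂ q + ∑ k, c k • FreshNoise.avg (fun k j => SampleIdx.mini r k j)
        (miniNoise g G X' Y' X Y) q k) :
    ∫ q, ‖F q‖ ^ 2 ∂P ≤ h.p * ∫ q, ‖u₁ q‖ ^ 2 ∂P + (1 - h.p) * ∫ q, ‖u₂ q‖ ^ 2 ∂P
      + ∑ k, c k ^ 2 * (5 / 4 * Lf ^ 2 / h.b * ∫ q, moveSq X' Y' X Y k q ∂P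
        + (h.p / h.B * data.onlineIndicator + 5 * (h.β ^ 2 / h.b)) * σ ^ 2) := by
  have := hP.prob
  obtain ⟨-, l2, l3⟩ := hO.largeError_bound hL hP hB hX hY
  have hmini := hO.freshNoise_mini hL hβ0 hβ1 hX' hY' hX hY
  have m1 : MemLp (fun q => u₁ q + ∑ k, c k • largeError data g G r X Y q k) 2 P :=
    hu₁.memLp.add (memLp_finsetSum _ fun k _ => (l2 k).const_smul (c k))
  have m2 : MemLp (fun q => u₂ q + ∑ k, c k • FreshNoise.avg (fun k j => SampleIdx.mini r k j)
        (miniNoise g G X' Y' X Y) q k) 2 P :=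
    hu₂.memLp.add (memLp_finsetSum _ fun k _ => (hmini.memLp_avg hP k).const_smul (c k))
  have hsplit := (hP.integral_ite_flag r (m1.integrable_norm_pow (p := 2) (by norm_num))
    (m2.integrable_norm_pow (p := 2) (by norm_num)) ?_ ?_).2
  rotate_left
  · intro q t
    simp only [hu₁.prior.flagFree le_rfl q t,
      fun k => flagFree_largeError (data := data) (g := g) (G := G) hX hY k q t]
  · intro q t
    simp only [hu₂.prior.flagFree le_rfl q t,
      fun k => flagFree_avg (a := fun k (j : Fin h.b) => SampleIdx.mini r k j)
      (flagFree_miniNoise (g := g) (G := G) hX' hY' hX hY) k q t]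
  have hFe : ∀ q, ‖F q‖ ^ 2 = if q.2 r then ‖u₁ q + ∑ k, c k • largeError data g G r X Y q k‖ ^ 2
      else ‖u₂ q + ∑ k, c k • FreshNoise.avg (fun k j => SampleIdx.mini r k j)
        (miniNoise g G X' Y' X Y) q k‖ ^ 2 := by
    intro q
    rw [hF q]
    split_ifs <;> rfl
  simp only [hFe]
  refine hsplit.le.trans ?_
  have b1 := l3 hu₁ c
  have b2 := hmini.integral_norm_sq_le hP hb hu₂.memLp
    (fun k j => hu₂.prior.freeOf (a := SampleIdx.mini r k j) le_rfl) c
  have hp0 := hP.p_nonneg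
  have hp1 := hP.p_le
  have b1' := mul_le_mul_of_nonneg_left b1 hp0
  have b2' := mul_le_mul_of_nonneg_left b2 (sub_nonneg.2 hp1)
  have hψ : ∀ k, ∫ q, (5 / 4 * Lf ^ 2 * moveSq X' Y' X Y k q + 5 * h.β ^ 2 * σ ^ 2) ∂P
      = 5 / 4 * Lf ^ 2 * ∫ q, moveSq X' Y' X Y k q ∂P + 5 * h.β ^ 2 * σ ^ 2 := by
    intro k
    rw [integral_add ((integrable_moveSq hX' hY' hX hY k).const_mul _) (integrable_const _),
      integral_const_mul]
    simp
  simp only [hψ] at b2'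
  have hS : (1 - h.p) * ∑ k, c k ^ 2 * ((h.b : ℝ)⁻¹
      * (5 / 4 * Lf ^ 2 * ∫ q, moveSq X' Y' X Y k q ∂P + 5 * h.β ^ 2 * σ ^ 2))
      ≤ ∑ k, c k ^ 2 * ((h.b : ℝ)⁻¹
      * (5 / 4 * Lf ^ 2 * ∫ q, moveSq X' Y' X Y k q ∂P + 5 * h.β ^ 2 * σ ^ 2)) := by
    refine mul_le_of_le_one_left (Finset.sum_nonneg fun k _ => ?_) (by linarith)
    have : 0 ≤ ∫ q, moveSq X' Y' X Y k q ∂P :=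
      integral_nonneg fun q => add_nonneg (sq_nonneg _) (sq_nonneg _)
    positivity
  have hfin : ∑ k, c k ^ 2 * (5 / 4 * Lf ^ 2 / h.b * ∫ q, moveSq X' Y' X Y k q ∂P
        + (h.p / h.B * data.onlineIndicator + 5 * (h.β ^ 2 / h.b)) * σ ^ 2)
      = h.p * ∑ k, c k ^ 2 * (data.onlineIndicator / h.B * σ ^ 2)
        + ∑ k, c k ^ 2 * ((h.b : ℝ)⁻¹
      * (5 / 4 * Lf ^ 2 * ∫ q, moveSq X' Y' X Y k q ∂P + 5 * h.β ^ 2 * σ ^ 2)) := by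
    rw [Finset.mul_sum, ← Finset.sum_add_distrib]
    refine Finset.sum_congr rfl fun k _ => ?_
    ring
  rw [hfin]
  linarith

include hO hL hP hβ0 hβ1 hb hB hX' hY' hX hY hM in
/-- Contraction of the tracking error, for any linear combination of the agents' errors. -/
lemma integral_tracking_le (c : Fin K → ℝ) :
    ∫ q, ‖∑ k, c k • (grace h data g q.1 (q.2 r) r (M' q) (X' q) (Y' q) (X q) (Y q) k
        - G k (X q k) (Y q k))‖ ^ 2 ∂P
      ≤ (1 - h.βbar) * ∫ q, ‖∑ k, c k • (M' q k - G k (X' q k) (Y' q k))‖ ^ 2 ∂P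
      + ∑ k, c k ^ 2 * (5 / 4 * Lf ^ 2 / h.b * ∫ q, moveSq X' Y' X Y k q ∂P
        + (h.p / h.B * data.onlineIndicator + 5 * (h.β ^ 2 / h.b)) * σ ^ 2) := by
  have := hP.prob
  have hu : Prior P r fun q => ∑ k, c k • (M' q k - G k (X' q k) (Y' q k)) :=
    Prior.sum _ fun k => ((hM k).sub (hO.prior_mean hL (hX' k) (hY' k) k)).smul (c k)
  refine (hO.integral_branch_le hL hP hβ0 hβ1 hb hB hX' hY' hX hY (Prior.const 0)
    (hu.smul (1 - h.β)) c fun q => ?_).trans ?_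
  · simp only [grace_eq (G := G) hb]
    split_ifs with hf
    · simp
    · rw [Finset.smul_sum, ← Finset.sum_add_distrib]
      refine Finset.sum_congr rfl fun k _ => ?_
      module
  · gcongr
    simp only [norm_zero, norm_smul, mul_pow, Real.norm_eq_abs, sq_abs]
    rw [integral_const_mul]
    have hI : 0 ≤ ∫ q, ‖∑ k, c k • (M' q k - G k (X' q k) (Y' q k))‖ ^ 2 ∂P :=
      integral_nonneg fun q => sq_nonneg _
    have hp1 := hP.p_le
    have hc : (1 - h.p) * (1 - h.β) ^ 2 ≤ 1 - h.βbar := by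
      have : 1 - h.βbar = (1 - h.p) * (1 - h.β) := by rw [Hyper.βbar]; ring
      rw [this, sq, ← mul_assoc]
      exact mul_le_of_le_one_right (mul_nonneg (by linarith) (by linarith)) (by linarith)
    have := mul_le_mul_of_nonneg_right hc hI
    simp only [ne_eq, OfNat.ofNat_ne_zero, not_false_eq_true, zero_pow, integral_zero, mul_zero,
      zero_add]
    linarith

include hO hL hP hβ0 hβ1 hb hB hX' hY' hX hY hM in
/-- Increments of the estimator: tracking error, displacement and noise. -/
lemma integral_increment_le (k : Fin K) :
    ∫ q, ‖grace h data g q.1 (q.2 r) r (M' q) (X' q) (Y' q) (X q) (Y q) k - M' q k‖ ^ 2 ∂P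
      ≤ 2 * h.β' * ∫ q, ‖M' q k - G k (X' q k) (Y' q k)‖ ^ 2 ∂P
        + 13 / 4 * Lf ^ 2 * ∫ q, moveSq X' Y' X Y k q ∂P
        + 5 * (h.p / h.B * data.onlineIndicator + h.β ^ 2 / h.b) * σ ^ 2 := by
  have := hP.prob
  have hT : Prior P r fun q => M' q k - G k (X' q k) (Y' q k) :=
    (hM k).sub (hO.prior_mean hL (hX' k) (hY' k) k)
  have hD : Prior P r fun q => G k (X q k) (Y q k) - G k (X' q k) (Y' q k) :=
    (hO.prior_mean hL (hX k) (hY k) k).sub (hO.prior_mean hL (hX' k) (hY' k) k)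
  have hmv := integrable_moveSq hX' hY' hX hY k
  have hmv0 : 0 ≤ ∫ q, moveSq X' Y' X Y k q ∂P :=
    integral_nonneg fun q => add_nonneg (sq_nonneg _) (sq_nonneg _)
  have hN0 : 0 ≤ ∫ q, ‖M' q k - G k (X' q k) (Y' q k)‖ ^ 2 ∂P :=
    integral_nonneg fun q => sq_nonneg _
  have hu : ∀ t : ℝ, Prior P r fun q => (G k (X q k) (Y q k) - G k (X' q k) (Y' q k))
      + t • (M' q k - G k (X' q k) (Y' q k)) := fun t => hD.add (hT.smul t)
  have hub : ∀ t : ℝ, ∫ q, ‖(G k (X q k) (Y q k) - G k (X' q k) (Y' q k))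
      + t • (M' q k - G k (X' q k) (Y' q k))‖ ^ 2 ∂P
      ≤ 2 * Lf ^ 2 * ∫ q, moveSq X' Y' X Y k q ∂P
        + 2 * t ^ 2 * ∫ q, ‖M' q k - G k (X' q k) (Y' q k)‖ ^ 2 ∂P := by
    intro t
    rw [← integral_const_mul, ← integral_const_mul,
      ← integral_add (hmv.const_mul _) (hT.integrable_norm_sq.const_mul _)]
    refine integral_mono (hu t).integrable_norm_sq
      ((hmv.const_mul _).add (hT.integrable_norm_sq.const_mul _)) fun q => ?_
    refine (norm_add_sq_le_two _ _).trans ?_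
    rw [norm_smul, mul_pow, Real.norm_eq_abs, sq_abs]
    have := hO.lip k (X q k) (Y q k) (X' q k) (Y' q k)
    simp only [moveSq]
    linarith
  refine (hO.integral_branch_le hL hP hβ0 hβ1 hb hB hX' hY' hX hY (hu (-1)) (hu (-h.β))
    (Pi.single k 1) fun q => ?_).trans ?_
  · rw [grace_eq (G := G) hb]
    have e : ∀ v : Fin K → Vec d, ∑ l, (Pi.single k 1 : Fin K → ℝ) l • v l = v k := by
      intro v
      simp [Pi.single_apply, ite_smul]
    rw [e, e]
    split_ifs with hf
    · module
    · module
  · have e : ∀ w : Fin K → ℝ, ∑ l, (Pi.single k 1 : Fin K → ℝ) l ^ 2 * w l = w k := by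
      intro w
      simp [Pi.single_apply]
    rw [e]
    have hp0 := hP.p_nonneg
    have hp1 := hP.p_le
    have b1 := mul_le_mul_of_nonneg_left (hub (-1)) hp0
    have b2 := mul_le_mul_of_nonneg_left (hub (-h.β)) (sub_nonneg.2 hp1)
    have hb1 : 5 / 4 * Lf ^ 2 / h.b ≤ 5 / 4 * Lf ^ 2 := by
      have : (1 : ℝ) ≤ h.b := by exact_mod_cast hb
      exact div_le_self (by positivity) this
    have b3 := mul_le_mul_of_nonneg_right hb1 hmv0
    have hI : 0 ≤ data.onlineIndicator := by
      cases data <;> simp [DataModel.onlineIndicator]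
    have b4 : (h.p / h.B * data.onlineIndicator + 5 * (h.β ^ 2 / h.b)) * σ ^ 2
        ≤ 5 * (h.p / h.B * data.onlineIndicator + h.β ^ 2 / h.b) * σ ^ 2 := by
      have : 0 ≤ h.p / h.B * data.onlineIndicator := by positivity
      gcongr
      linarith
    have b5 : 0 ≤ h.p * (h.β ^ 2 * ∫ q, ‖M' q k - G k (X' q k) (Y' q k)‖ ^ 2 ∂P) := by positivity
    rw [Hyper.β']
    linarith

include hO hL hP hβ0 hβ1 hb hB hX' hY' hX hY hM in
lemma prior_grace (k : Fin K) : Prior P (r + 1) fun q =>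
    grace h data g q.1 (q.2 r) r (M' q) (X' q) (Y' q) (X q) (Y q) k := by
  have := hP.prob
  obtain ⟨l1, l2, -⟩ := hO.largeError_bound hL hP hB hX hY
  have hmini := hO.freshNoise_mini hL hβ0 hβ1 hX' hY' hX hY
  have hG := hO.prior_mean hL (hX k) (hY k) k
  have hT := hG.add (((hM k).sub (hO.prior_mean hL (hX' k) (hY' k) k)).smul (1 - h.β))
  have hm : MeasurableSet {q : Sample K h Ξ | q.2 r = true} :=
    measurableSet_eq_fun ((measurable_pi_apply r).comp measurable_snd) measurable_const
  refine ⟨?_, ?_, ?_⟩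
  · simp only [grace_eq (G := G) hb]
    exact Measurable.ite hm (hG.meas.add (l1 k)) (hT.meas.add (hmini.measurable_avg k))
  · simp only [grace_eq (G := G) hb]
    have e := ((hG.memLp.add (l2 k)).indicator hm).add
      ((hT.memLp.add (hmini.memLp_avg hP k)).indicator hm.compl)
    refine e.ae_eq (Filter.Eventually.of_forall fun q => ?_)
    by_cases hq : q.2 r = true <;> simp [Set.indicator, hq]
  · intro q q' h1 h2
    have p1 : ∀ a : SampleIdx K h, a.round < r → q.1 a = q'.1 a := fun a ha => h1 a (by omega)
    have p2 : ∀ j < r, q.2 j = q'.2 j := fun j hj => h2 j (by omega)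
    have es : ∀ Z Z', miniEstimate h g q.1 r Z Z' = miniEstimate h g q'.1 r Z Z' := by
      intro Z Z'
      funext k
      simp only [miniEstimate, fun k j => h1 (.mini r k j) (Nat.lt_succ_self r)]
    have el : ∀ k j, q.1 (.large r k j) = q'.1 (.large r k j) :=
      fun k j => h1 _ (Nat.lt_succ_self r)
    simp only [block_congr hX p1 p2, block_congr hY p1 p2, block_congr hX' p1 p2,
      block_congr hY' p1 p2, block_congr hM p1 p2, h2 r (Nat.lt_succ_self r)]
    cases data <;> simp only [grace, largeEstimate, es, el]

end Round

end Oracle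
end Grace

/-! ### Network averages of the GRACE recursions -/

section NetworkAverages

variable {K d₁ d₂ d : ℕ} {h : Hyper} {Ξ : Type*} [MeasurableSpace Ξ]
  {P : Measure (Sample K h Ξ)} {data : DataModel K Ξ}
  {g : Fin K → Vec d₁ → Vec d₂ → Ξ → Vec d} {G : Fin K → Vec d₁ → Vec d₂ → Vec d} {Lf σ : ℝ}

namespace Oracle

/-- Tracking errors `M_k - G_k(X_k, Y_k)` of all agents. -/
def trackErr (G : Fin K → Vec d₁ → Vec d₂ → Vec d) (M : Block K d) (X : Block K d₁)
    (Y : Block K d₂) : Block K d := fun k => M k - G k (X k) (Y k)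

/-- Total squared displacement of the network. -/
def totalMove (X' : Sample K h Ξ → Block K d₁) (Y' : Sample K h Ξ → Block K d₂)
    (X : Sample K h Ξ → Block K d₁) (Y : Sample K h Ξ → Block K d₂) (q : Sample K h Ξ) : ℝ :=
  blockNormSq (X q - X' q) + blockNormSq (Y q - Y' q)

/-- Noise level of one GRACE round: `p/B` for the large batches (online), `β²/b` for the
minibatches. -/
def noiseLevel (h : Hyper) (data : DataModel K Ξ) (σ : ℝ) : ℝ :=
  (h.p / h.B * data.onlineIndicator + h.β ^ 2 / h.b) * σ ^ 2

lemma onlineIndicator_nonneg (data : DataModel K Ξ) : 0 ≤ data.onlineIndicator := by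
  cases data <;> simp [DataModel.onlineIndicator]

lemma noise_le (hp : 0 ≤ h.p) :
    (h.p / h.B * data.onlineIndicator + 5 * (h.β ^ 2 / h.b)) * σ ^ 2
      ≤ 5 * noiseLevel h data σ := by
  have h1 := onlineIndicator_nonneg data
  have h2 : 0 ≤ h.p / h.B * data.onlineIndicator := by positivity
  unfold noiseLevel
  rw [← mul_assoc]
  gcongr
  linarith

variable {r : ℕ} {X' X : Sample K h Ξ → Block K d₁} {Y' Y : Sample K h Ξ → Block K d₂}
  {M' : Sample K h Ξ → Block K d}

lemma integral_totalMove (hX' : ∀ k, Prior P r fun q => X' q k)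
    (hY' : ∀ k, Prior P r fun q => Y' q k)
    (hX : ∀ k, Prior P r fun q => X q k) (hY : ∀ k, Prior P r fun q => Y q k) :
    ∫ q, totalMove X' Y' X Y q ∂P = ∑ k, ∫ q, moveSq X' Y' X Y k q ∂P := by
  rw [← integral_finsetSum _ fun k _ => integrable_moveSq hX' hY' hX hY k]
  simp [totalMove, moveSq, blockNormSq, Finset.sum_add_distrib]

lemma sum_single_smul (k : Fin K) (v : Fin K → Vec d) :
    ∑ l, (Pi.single k 1 : Fin K → ℝ) l • v l = v k := by
  simp [Pi.single_apply, ite_smul]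

lemma sum_single_sq_mul (k : Fin K) (w : Fin K → ℝ) :
    ∑ l, (Pi.single k 1 : Fin K → ℝ) l ^ 2 * w l = w k := by
  simp [Pi.single_apply]

lemma prior_trackErr (hO : Oracle data g G Lf σ) (hL : 0 ≤ Lf) [IsFiniteMeasure P]
    (hX : ∀ k, Prior P r fun q => X q k) (hY : ∀ k, Prior P r fun q => Y q k)
    (hM : ∀ k, Prior P r fun q => M' q k) (k : Fin K) :
    Prior P r fun q => trackErr G (M' q) (X q) (Y q) k :=
  (hM k).sub (hO.prior_mean hL (hX k) (hY k) k)

lemma _root_.DAMA.integral_blockNormSq {V : Sample K h Ξ → Block K d}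
    (hV : ∀ k, Prior P r fun q => V q k) :
    ∫ q, blockNormSq (V q) ∂P = ∑ k, ∫ q, ‖V q k‖ ^ 2 ∂P := by
  simp only [blockNormSq]
  exact integral_finsetSum _ fun k _ => (hV k).integrable_norm_sq

lemma _root_.DAMA.integrable_blockNormSq {V : Sample K h Ξ → Block K d}
    (hV : ∀ k, Prior P r fun q => V q k) : Integrable (fun q => blockNormSq (V q)) P := by
  simp only [blockNormSq]
  exact integrable_finsetSum _ fun k _ => (hV k).integrable_norm_sq

section Init

lemma trackErr_init {Ξ : Type*} {g : Fin K → Vec d₁ → Vec d₂ → Ξ → Vec d} (X₀ : Block K d₁)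
    (Y₀ : Block K d₂) (hb₀ : 1 ≤ h.b₀) (q : Sample K h Ξ) :
    trackErr G (initEstimate h g q.1 X₀ Y₀) X₀ Y₀
      = FreshNoise.avg (fun k (j : Fin h.b₀) => SampleIdx.init k j)
        (pointNoise g G (fun _ => X₀) fun _ => Y₀) q := by
  funext k
  exact average_sub hb₀ _ _

variable (hO : Oracle data g G Lf σ) (hL : 0 ≤ Lf) (hP : IsSampleLaw P data) (hb₀ : 1 ≤ h.b₀)
  (X₀ : Block K d₁) (Y₀ : Block K d₂)

include hO hL hP in
lemma freshNoise_init :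
    FreshNoise P data (fun k (j : Fin h.b₀) => SampleIdx.init k j)
      (pointNoise g G (fun _ => X₀) fun _ => Y₀) fun _ _ => σ ^ 2 := by
  have := hP.prob
  refine hO.freshNoise_point (P := P) hL (r := 0)
    (X := fun _ => X₀) (Y := fun _ => Y₀)
    (a := fun k (j : Fin h.b₀) => SampleIdx.init k j) (fun k => Prior.const (X₀ k))
    (fun k => Prior.const (Y₀ k)) ?_ (fun _ _ => rfl) fun _ _ => Nat.zero_le _
  rintro ⟨k, j⟩ ⟨k', j'⟩ e
  simpa using e

include hO hL hP hb₀ in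
lemma integral_init_le (c : Fin K → ℝ) :
    ∫ q, ‖∑ k, c k • trackErr G (initEstimate h g q.1 X₀ Y₀) X₀ Y₀ k‖ ^ 2 ∂P
      ≤ ∑ k, c k ^ 2 * (σ ^ 2 / h.b₀) := by
  have := hP.prob
  have := (hO.freshNoise_init hL hP X₀ Y₀).integral_norm_sq_le hP hb₀ (u := fun _ => 0)
    (memLp_const _) (fun _ _ _ _ => rfl) c
  simp only [trackErr_init (G := G) X₀ Y₀ hb₀]
  simpa [div_eq_inv_mul] using this

include hO hL hP hb₀ in
lemma prior_init (k : Fin K) : Prior P 1 fun q => initEstimate h g q.1 X₀ Y₀ k := by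
  have := hP.prob
  have hF := hO.freshNoise_init hL hP X₀ Y₀
  have e : ∀ q : Sample K h Ξ, initEstimate h g q.1 X₀ Y₀ k = G k (X₀ k) (Y₀ k)
      + FreshNoise.avg (fun k (j : Fin h.b₀) => SampleIdx.init k j)
        (pointNoise g G (fun _ => X₀) fun _ => Y₀) q k := by
    intro q
    rw [← trackErr_init (G := G) X₀ Y₀ hb₀]
    simp [trackErr]
  refine ⟨?_, ?_, fun q q' h1 _ => ?_⟩
  · simp only [e]
    exact (hF.measurable_avg k).const_add _
  · simp only [e]
    have hc : MemLp (fun _ : Sample K h Ξ => G k (X₀ k) (Y₀ k)) 2 P := memLp_const _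
    exact hc.add (hF.memLp_avg hP k)
  · simp only [initEstimate, fun j => h1 (.init k j) Nat.zero_lt_one]

include hO hL hP hb₀ in
lemma integral_trackErr_init_le :
    ∫ q, blockNormSq (trackErr G (initEstimate h g q.1 X₀ Y₀) X₀ Y₀) ∂P
      ≤ K * (σ ^ 2 / h.b₀) := by
  have := hP.prob
  have hV := hO.prior_trackErr (X := fun _ => X₀) (Y := fun _ => Y₀) hL
    (fun k => Prior.const _) (fun k => Prior.const _) (hO.prior_init hL hP hb₀ X₀ Y₀)
  rw [integral_blockNormSq hV]
  refine (Finset.sum_le_sum fun k _ => ?_).trans_eq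
    (b := ∑ _k : Fin K, σ ^ 2 / h.b₀) (by simp)
  have := hO.integral_init_le hL hP hb₀ X₀ Y₀ (Pi.single k 1)
  rw [sum_single_sq_mul] at this
  simpa only [sum_single_smul] using this

include hO hL hP hb₀ in
lemma integral_centroid_trackErr_init_le (hK : 1 ≤ K) :
    ∫ q, ‖centroid (trackErr G (initEstimate h g q.1 X₀ Y₀) X₀ Y₀)‖ ^ 2 ∂P
      ≤ σ ^ 2 / h.b₀ / K := by
  have hK0 : (K : ℝ) ≠ 0 := by positivity
  have := hO.integral_init_le hL hP hb₀ X₀ Y₀ fun _ => (K : ℝ)⁻¹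
  simp only [← Finset.smul_sum] at this
  refine this.trans_eq ?_
  rw [Finset.sum_const, Finset.card_univ, Fintype.card_fin, nsmul_eq_mul]
  field_simp

end Init

section Round

variable (hO : Oracle data g G Lf σ) (hL : 0 ≤ Lf) (hP : IsSampleLaw P data)
  (hβ0 : 0 ≤ h.β) (hβ1 : h.β ≤ 1) (hb : 1 ≤ h.b) (hB : 1 ≤ h.B)
  (hX' : ∀ k, Prior P r fun q => X' q k) (hY' : ∀ k, Prior P r fun q => Y' q k)
  (hX : ∀ k, Prior P r fun q => X q k) (hY : ∀ k, Prior P r fun q => Y q k)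
  (hM : ∀ k, Prior P r fun q => M' q k)

include hO hL hP hβ0 hβ1 hb hB hX' hY' hX hY hM

lemma integral_trackErr_le :
    ∫ q, blockNormSq (trackErr G (grace h data g q.1 (q.2 r) r (M' q) (X' q) (Y' q) (X q) (Y q))
        (X q) (Y q)) ∂P
      ≤ (1 - h.βbar) * ∫ q, blockNormSq (trackErr G (M' q) (X' q) (Y' q)) ∂P
      + 5 / 4 * Lf ^ 2 / h.b * ∫ q, totalMove X' Y' X Y q ∂P
        + K * (5 * noiseLevel h data σ) := by
  have := hP.prob
  have hg := hO.prior_grace hL hP hβ0 hβ1 hb hB hX' hY' hX hY hM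
  rw [integral_blockNormSq (hO.prior_trackErr hL (fun k => (hX k).mono (Nat.le_succ r))
    (fun k => (hY k).mono (Nat.le_succ r)) hg), integral_blockNormSq
    (hO.prior_trackErr hL hX' hY' hM), integral_totalMove hX' hY' hX hY]
  have hstep : ∀ k, _ := fun k =>
    hO.integral_tracking_le hL hP hβ0 hβ1 hb hB hX' hY' hX hY hM (Pi.single k 1)
  simp only [sum_single_sq_mul, sum_single_smul] at hstep
  refine (Finset.sum_le_sum fun k _ => hstep k).trans ?_
  rw [Finset.sum_add_distrib, Finset.sum_add_distrib, ← Finset.mul_sum, ← Finset.mul_sum]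
  have hn := noise_le (data := data) (σ := σ) hP.p_nonneg
  have : ∑ _k : Fin K, (h.p / h.B * data.onlineIndicator + 5 * (h.β ^ 2 / h.b)) * σ ^ 2
      ≤ K * (5 * noiseLevel h data σ) := by
    rw [Finset.sum_const, Finset.card_univ, Fintype.card_fin, nsmul_eq_mul]
    gcongr
  simp only [trackErr]
  linarith

lemma integral_centroid_trackErr_le (hK : 1 ≤ K) :
    ∫ q, ‖centroid (trackErr G (grace h data g q.1 (q.2 r) r (M' q) (X' q) (Y' q) (X q) (Y q))
        (X q) (Y q))‖ ^ 2 ∂P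
      ≤ (1 - h.βbar) * ∫ q, ‖centroid (trackErr G (M' q) (X' q) (Y' q))‖ ^ 2 ∂P
      + 5 / 4 * Lf ^ 2 / h.b / K * ((K : ℝ)⁻¹ * ∫ q, totalMove X' Y' X Y q ∂P)
        + 5 * noiseLevel h data σ / K := by
  have hK0 : (K : ℝ) ≠ 0 := by positivity
  have hstep := hO.integral_tracking_le hL hP hβ0 hβ1 hb hB hX' hY' hX hY hM fun _ => (K : ℝ)⁻¹
  simp only [← Finset.smul_sum] at hstep
  refine hstep.trans ?_
  rw [add_assoc]
  refine add_le_add le_rfl ?_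
  rw [integral_totalMove hX' hY' hX hY, ← Finset.mul_sum, Finset.sum_add_distrib,
    ← Finset.mul_sum, Finset.sum_const, Finset.card_univ, Fintype.card_fin, nsmul_eq_mul]
  have hn := noise_le (data := data) (σ := σ) hP.p_nonneg
  have : (K : ℝ)⁻¹ ^ 2 * (K * ((h.p / h.B * data.onlineIndicator + 5 * (h.β ^ 2 / h.b)) * σ ^ 2))
      ≤ 5 * noiseLevel h data σ / K := by
    have e : (K : ℝ)⁻¹ ^ 2
        * (K * ((h.p / h.B * data.onlineIndicator + 5 * (h.β ^ 2 / h.b)) * σ ^ 2))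
        = ((h.p / h.B * data.onlineIndicator + 5 * (h.β ^ 2 / h.b)) * σ ^ 2) / K := by
      field_simp
    rw [e]
    gcongr
  have e2 : (K : ℝ)⁻¹ ^ 2 * (5 / 4 * Lf ^ 2 / h.b * ∑ k, ∫ q, moveSq X' Y' X Y k q ∂P)
      = 5 / 4 * Lf ^ 2 / h.b / K * ((K : ℝ)⁻¹ * ∑ k, ∫ q, moveSq X' Y' X Y k q ∂P) := by
    ring
  rw [mul_add, e2]
  linarith

lemma integral_blockNormSq_increment_le :
    ∫ q, blockNormSq (grace h data g q.1 (q.2 r) r (M' q) (X' q) (Y' q) (X q) (Y q) - M' q) ∂P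
      ≤ 2 * h.β' * ∫ q, blockNormSq (trackErr G (M' q) (X' q) (Y' q)) ∂P
        + 13 / 4 * Lf ^ 2 * ∫ q, totalMove X' Y' X Y q ∂P
        + K * (5 * noiseLevel h data σ) := by
  have := hP.prob
  have hg := hO.prior_grace hL hP hβ0 hβ1 hb hB hX' hY' hX hY hM
  rw [integral_blockNormSq (V := fun q =>
    grace h data g q.1 (q.2 r) r (M' q) (X' q) (Y' q) (X q) (Y q) - M' q)
    fun k => (hg k).sub ((hM k).mono (Nat.le_succ r)), integral_blockNormSq
    (hO.prior_trackErr hL hX' hY' hM), integral_totalMove hX' hY' hX hY]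
  refine (Finset.sum_le_sum fun k _ =>
    hO.integral_increment_le hL hP hβ0 hβ1 hb hB hX' hY' hX hY hM k).trans (le_of_eq ?_)
  rw [Finset.sum_add_distrib, Finset.sum_add_distrib, ← Finset.mul_sum, ← Finset.mul_sum,
    Finset.sum_const, Finset.card_univ, Fintype.card_fin, nsmul_eq_mul, noiseLevel]
  simp only [trackErr]
  ring

end Round

/-- The centroid of the estimates versus the gradient of the global risk at the centroids:
averaged tracking error plus consensus error. -/
lemma norm_mean_sub_centroid_sq_le (hO : Oracle data g G Lf σ) (hK : 1 ≤ K) (M : Block K d)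
    (X : Block K d₁) (Y : Block K d₂) :
    ‖(K : ℝ)⁻¹ • ∑ k, G k (centroid X) (centroid Y) - centroid M‖ ^ 2
      ≤ 5 / 4 * ‖centroid (trackErr G M X Y)‖ ^ 2
        + 5 * Lf ^ 2 * ((K : ℝ)⁻¹ * (deviation X + deviation Y)) := by
  have hK0 : (0 : ℝ) < K := by positivity
  set V : Block K d := fun k => G k (centroid X) (centroid Y) - G k (X k) (Y k) with hV
  have e : (K : ℝ)⁻¹ • ∑ k, G k (centroid X) (centroid Y) - centroid M
      = -centroid (trackErr G M X Y) + centroid V := by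
    simp only [centroid, hV, trackErr, Finset.sum_sub_distrib, smul_sub]
    abel
  have hVn : ‖centroid V‖ ^ 2 ≤ (K : ℝ)⁻¹ * blockNormSq V := by
    have h1 := sum_norm_sub_centroid_sq hK V 0
    simp only [sub_zero] at h1
    rw [blockNormSq, h1]
    have := deviation_nonneg V
    rw [mul_add, inv_mul_cancel_left₀ hK0.ne']
    have h2 : 0 ≤ (K : ℝ)⁻¹ * deviation V := by positivity
    linarith
  have hVb : blockNormSq V ≤ Lf ^ 2 * (deviation X + deviation Y) := by
    rw [blockNormSq, deviation, deviation, ← Finset.sum_add_distrib, Finset.mul_sum]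
    refine Finset.sum_le_sum fun k _ => ?_
    have := hO.lip k (centroid X) (centroid Y) (X k) (Y k)
    rwa [norm_sub_rev (centroid X), norm_sub_rev (centroid Y)] at this
  rw [e]
  refine (norm_add_sq_le_five _ _).trans ?_
  rw [norm_neg]
  have h3 : (K : ℝ)⁻¹ * blockNormSq V ≤ (K : ℝ)⁻¹ * (Lf ^ 2 * (deviation X + deviation Y)) := by
    gcongr
  have h4 : (K : ℝ)⁻¹ * (Lf ^ 2 * (deviation X + deviation Y))
      = Lf ^ 2 * ((K : ℝ)⁻¹ * (deviation X + deviation Y)) := by ring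
  linarith

end Oracle
end NetworkAverages

/-! ### The risks of a distributed minimax problem -/

section Risks

variable {K d₁ d₂ : ℕ} {Ξ : Type*} [MeasurableSpace Ξ]

namespace Problem

/-- `∇ₓ J_k(x, y)`. -/
def localGradx (prob : Problem K d₁ d₂ Ξ) (k : Fin K) (x : Vec d₁) (y : Vec d₂) : Vec d₁ :=
  gradient (fun x' => prob.localRisk k x' y) x

/-- `∇_y J_k(x, y)`. -/
def localGrady (prob : Problem K d₁ d₂ Ξ) (k : Fin K) (x : Vec d₁) (y : Vec d₂) : Vec d₂ :=
  gradient (fun y' => prob.localRisk k x y') y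

variable {prob : Problem K d₁ d₂ Ξ} {ν Lf σ : ℝ}

lemma oracle_x (hreg : prob.Regular) (hsm : prob.ExpectedSmooth Lf)
    (hvar : prob.BoundedVariance σ) : Oracle prob.data prob.gradQx prob.localGradx Lf σ :=
  ⟨hreg.measurable_x, hreg.memLp_x, hvar.unbiased_x, hvar.variance_x, hsm.smooth_x⟩

lemma oracle_y (hreg : prob.Regular) (hsm : prob.ExpectedSmooth Lf)
    (hvar : prob.BoundedVariance σ) : Oracle prob.data prob.gradQy prob.localGrady Lf σ :=
  ⟨hreg.measurable_y, hreg.memLp_y, hvar.unbiased_y, hvar.variance_y, hsm.smooth_y⟩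

lemma gradient_average {d : ℕ} {f : Fin K → Vec d → ℝ} {x : Vec d}
    (hf : ∀ k, DifferentiableAt ℝ (f k) x) :
    gradient (fun x' => (K : ℝ)⁻¹ * ∑ k, f k x') x = (K : ℝ)⁻¹ • ∑ k, gradient (f k) x := by
  have h1 : HasFDerivAt (fun x' => (K : ℝ)⁻¹ * ∑ k, f k x')
      ((K : ℝ)⁻¹ • ∑ k, fderiv ℝ (f k) x) x :=
    (HasFDerivAt.fun_sum fun k _ => (hf k).hasFDerivAt).const_mul _
  rw [gradient, h1.fderiv, map_smul, map_sum]
  rfl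

lemma gradJx_eq (hreg : prob.Regular) (x : Vec d₁) (y : Vec d₂) :
    prob.gradJx x y = (K : ℝ)⁻¹ • ∑ k, prob.localGradx k x y := by
  refine gradient_average (f := fun k x' => prob.localRisk k x' y) fun k => ?_
  exact DifferentiableAt.comp (f := fun x' => (x', y)) x ((hreg.diff_J k) (x, y))
    (differentiableAt_id.prodMk (differentiableAt_const _))

lemma gradJy_eq (hreg : prob.Regular) (x : Vec d₁) (y : Vec d₂) :
    prob.gradJy x y = (K : ℝ)⁻¹ • ∑ k, prob.localGrady k x y := by
  refine gradient_average (f := fun k y' => prob.localRisk k x y') fun k => ?_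
  exact DifferentiableAt.comp (f := fun y' => (x, y')) y ((hreg.diff_J k) (x, y))
    ((differentiableAt_const _).prodMk differentiableAt_id)

lemma norm_average_sub_sq_le {d : ℕ} {data : DataModel K Ξ}
    {g : Fin K → Vec d₁ → Vec d₂ → Ξ → Vec d} {G : Fin K → Vec d₁ → Vec d₂ → Vec d}
    (hO : Oracle data g G Lf σ) (hK : 1 ≤ K) (x₁ : Vec d₁) (y₁ : Vec d₂) (x₂ : Vec d₁)
    (y₂ : Vec d₂) :
    ‖(K : ℝ)⁻¹ • ∑ k, G k x₁ y₁ - (K : ℝ)⁻¹ • ∑ k, G k x₂ y₂‖ ^ 2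
      ≤ Lf ^ 2 * (‖x₁ - x₂‖ ^ 2 + ‖y₁ - y₂‖ ^ 2) := by
  have hK0 : (0 : ℝ) < K := by positivity
  set V : Block K d := fun k => G k x₁ y₁ - G k x₂ y₂ with hV
  have e : (K : ℝ)⁻¹ • ∑ k, G k x₁ y₁ - (K : ℝ)⁻¹ • ∑ k, G k x₂ y₂ = centroid V := by
    simp [centroid, hV, Finset.sum_sub_distrib, smul_sub]
  rw [e]
  have h1 := sum_norm_sub_centroid_sq hK V 0
  simp only [sub_zero] at h1
  have h2 : ∑ k, ‖V k‖ ^ 2 ≤ ∑ _k : Fin K, Lf ^ 2 * (‖x₁ - x₂‖ ^ 2 + ‖y₁ - y₂‖ ^ 2) :=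
    Finset.sum_le_sum fun k _ => hO.lip k x₁ y₁ x₂ y₂
  rw [h1, Finset.sum_const, Finset.card_univ, Fintype.card_fin, nsmul_eq_mul] at h2
  have h3 := deviation_nonneg V
  exact le_of_mul_le_mul_left (by linarith) hK0

lemma smoothRisk (hreg : prob.Regular) (hsm : prob.ExpectedSmooth Lf)
    (hvar : prob.BoundedVariance σ) (hK : 1 ≤ K) :
    SmoothRisk (fun z : Vec d₁ × Vec d₂ => prob.J z.1 z.2) prob.gradJx prob.gradJy Lf where
  diff := by
    have h1 : Differentiable ℝ fun z : Vec d₁ × Vec d₂ =>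
        (K : ℝ)⁻¹ * ∑ k, prob.localRisk k z.1 z.2 :=
      (Differentiable.fun_sum fun k _ => hreg.diff_J k).const_mul _
    exact h1
  gradx _ _ := rfl
  grady _ _ := rfl
  lipx x₁ y₁ x₂ y₂ := by
    rw [gradJx_eq hreg, gradJx_eq hreg]
    exact norm_average_sub_sq_le (oracle_x hreg hsm hvar) hK _ _ _ _
  lipy x₁ y₁ x₂ y₂ := by
    rw [gradJy_eq hreg, gradJy_eq hreg]
    exact norm_average_sub_sq_le (oracle_y hreg hsm hvar) hK _ _ _ _

lemma plRisk (hPL : prob.PLCondition ν) :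
    PLRisk (fun z : Vec d₁ × Vec d₂ => prob.J z.1 z.2) prob.gradJy prob.P ν where
  pos := hPL.pos
  le_P x y := by
    obtain ⟨y₀, hy₀⟩ := hPL.attained x
    exact le_ciSup (f := fun y => prob.J x y) ⟨prob.J x y₀, by rintro _ ⟨y, rfl⟩; exact hy₀ y⟩ y
  attained x := by
    obtain ⟨y₀, hy₀⟩ := hPL.attained x
    refine ⟨y₀, le_antisymm ?_ (ciSup_le hy₀)⟩
    exact le_ciSup (f := fun y => prob.J x y) ⟨prob.J x y₀, by rintro _ ⟨y, rfl⟩; exact hy₀ y⟩ y₀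
  pl := hPL.pl

lemma Pstar_le (hPL : prob.PLCondition ν) (x : Vec d₁) : prob.Pstar ≤ prob.P x :=
  ciInf_le hPL.bddBelow x

end Problem
end Risks

/-! ### Combining the recursions -/

lemma mul_sum_range_le_of_contraction {a w : ℕ → ℝ} {t : ℝ} (ha : ∀ i, 0 ≤ a i)
    (hstep : ∀ i, a (i + 1) ≤ (1 - t) * a i + w i) (n : ℕ) :
    t * ∑ i ∈ Finset.range n, a i ≤ a 0 + ∑ i ∈ Finset.range n, w i := by
  have : t * ∑ i ∈ Finset.range n, a i + a n ≤ a 0 + ∑ i ∈ Finset.range n, w i := by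
    induction n with
    | zero => simp
    | succ n ih =>
      rw [Finset.sum_range_succ, Finset.sum_range_succ]
      linarith [hstep n]
  linarith [ha n]

/-- Consequences of the hyperparameter conditions in the form in which they are used: the gains of
the loops from estimator increments to consensus errors and back, and from displacements to the
averaged tracking error, are small. -/
lemma Hyper.Conditions.gains {h : Hyper} {K : ℕ} {Lf ν ρ lA lBi v : ℝ}
    (hh : h.Conditions K Lf ν ρ lA lBi v) (hK : 1 ≤ K) (hL : 0 < Lf) (hν : 0 < ν) (hρ : ρ < 1)
    (hv : 0 ≤ v) (hA : 0 ≤ lA) (hB : 0 ≤ lBi) :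
    0 < h.βbar ∧ h.β' ≤ h.βbar ∧
    (v * lBi * lA * h.μy) ^ 2 / (1 - ρ) ^ 2 * Lf ^ 2 ≤ 1 / 620 ∧
    (v * lBi * lA * h.μy) ^ 2 / (1 - ρ) ^ 2 * (h.β' / h.βbar) * (Lf ^ 2 / h.b) ≤ 1 / 576 ∧
    Lf ^ 2 ≤ Lf ^ 2 / (h.b * K * h.βbar) ∧
    (Lf / ν) ^ 2 * (Lf ^ 2 / (h.b * K * h.βbar) * h.μx ^ 2) ≤ 1 / 1728 ∧
    Lf ^ 2 / (h.b * K * h.βbar) * h.μy ^ 2 ≤ 1 / 144 := by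
  have hK0 : (0 : ℝ) < K := by exact_mod_cast hK
  have hb0 : (0 : ℝ) < h.b := by exact_mod_cast hh.one_le_b
  have hμx := hh.μx_pos
  have hμy := hh.μy_pos
  have hρ' : 0 < 1 - ρ := sub_pos.2 hρ
  -- a vanishing `β̄` would force `μ_y ≤ 0`
  have hs : 0 < √(K * h.b * h.βbar) := by
    by_contra hcon
    have h0 : √(K * h.b * h.βbar) = 0 := le_antisymm (not_lt.1 hcon) (Real.sqrt_nonneg _)
    have := hh.μy_3
    rw [h0, zero_div] at this
    linarith
  have hpos := Real.sqrt_pos.1 hs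
  have hβ : 0 < h.βbar := by
    by_contra hcon
    have : K * h.b * h.βbar ≤ 0 := mul_nonpos_of_nonneg_of_nonpos (by positivity) (not_lt.1 hcon)
    linarith
  have hβ'p : 0 < h.β' := by
    have h1 := hh.p_nonneg
    have h2 := hh.β_nonneg
    rcases h1.lt_or_eq with h3 | h3
    · unfold Hyper.β'; positivity
    · rcases h2.lt_or_eq with h4 | h4
      · unfold Hyper.β'; positivity
      · rw [Hyper.βbar, ← h3, ← h4] at hβ
        simp at hβ
  refine ⟨hβ, ?_, ?_, ?_, ?_, ?_, ?_⟩
  · have h1 : 0 ≤ h.β * (1 - h.p - h.β) :=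
      mul_nonneg hh.β_nonneg (by linarith [hh.p_add_β])
    unfold Hyper.β' Hyper.βbar
    linarith
  · have h1 := pow_le_pow_left₀ (by have := hμy; positivity) hh.μy_4 2
    have h2 : (√620 * Lf * v * lA * lBi * h.μy) ^ 2
        = 620 * (Lf ^ 2 * (v * lBi * lA * h.μy) ^ 2) := by
      have : (√620 : ℝ) ^ 2 = 620 := Real.sq_sqrt (by norm_num)
      calc _ = √620 ^ 2 * (Lf ^ 2 * (v * lBi * lA * h.μy) ^ 2) := by ring
        _ = _ := by rw [this]
    rw [h2] at h1
    rw [div_mul_eq_mul_div, div_le_iff₀ (by positivity)]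
    linarith
  · have h1 := pow_le_pow_left₀ (by have := hμy; positivity) hh.μy_6 2
    rw [mul_pow (1 - ρ), Real.sq_sqrt (by positivity)] at h1
    have h2 : (24 * Lf * v * lA * lBi * h.μy) ^ 2
        = 576 * (Lf ^ 2 * (v * lBi * lA * h.μy) ^ 2) := by ring
    rw [h2, mul_div_assoc', le_div_iff₀ hβ'p] at h1
    have e : (v * lBi * lA * h.μy) ^ 2 / (1 - ρ) ^ 2 * (h.β' / h.βbar) * (Lf ^ 2 / h.b)
        = (Lf ^ 2 * (v * lBi * lA * h.μy) ^ 2 * h.β') / ((1 - ρ) ^ 2 * (h.b * h.βbar)) := by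
      field_simp
    rw [e, div_le_iff₀ (by positivity)]
    linarith
  · rw [le_div_iff₀ (by positivity)]
    have h1 := hh.βbar_2
    rw [le_div_iff₀ hK0] at h1
    have h2 : h.b * K * h.βbar ≤ 1 := by linarith
    exact mul_le_of_le_one_right (by positivity) h2
  · have h1 := hh.μx_3
    have hd : 0 < 24 * √3 * (Lf / ν) * Lf := by positivity
    rw [le_div_iff₀ hd] at h1
    have h2 := pow_le_pow_left₀ (by positivity) h1 2
    rw [Real.sq_sqrt hpos.le] at h2
    have h3 : (h.μx * (24 * √3 * (Lf / ν) * Lf)) ^ 2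
        = 1728 * ((Lf / ν) ^ 2 * (Lf ^ 2 * h.μx ^ 2)) := by
      have : (√3 : ℝ) ^ 2 = 3 := Real.sq_sqrt (by norm_num)
      calc _ = √3 ^ 2 * (576 * ((Lf / ν) ^ 2 * (Lf ^ 2 * h.μx ^ 2))) := by ring
        _ = _ := by rw [this]; ring
    rw [h3] at h2
    rw [div_mul_eq_mul_div, mul_div_assoc', div_le_iff₀ (by positivity)]
    linarith
  · have h1 := hh.μy_3
    have hd : 0 < 12 * Lf := by positivity
    rw [le_div_iff₀ hd] at h1
    have h2 := pow_le_pow_left₀ (by positivity) h1 2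
    rw [Real.sq_sqrt hpos.le] at h2
    rw [div_mul_eq_mul_div, div_le_iff₀ (by positivity)]
    linarith

/-- The recursions satisfied by the expected errors of a run: consensus errors `D`, tracking errors
`N` (of the agents) and `F` (of the average), increments `R`, displacements `Z`, squared norms
`mx, my` of the averaged estimates, gradient errors `ε` and squared gradient norms `G`. -/
structure ErrorRecursions (h : Hyper) (K T : ℕ) (Lf ν ρ lA lBi v s₀ τ EG EΔ ζ : ℝ)
    (D N F R Z mx my ε G : ℕ → ℝ) : Prop where
  D_nonneg : ∀ i, 0 ≤ D i
  N_nonneg : ∀ i, 0 ≤ N i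
  F_nonneg : ∀ i, 0 ≤ F i
  mx_nonneg : ∀ i, 0 ≤ mx i
  my_nonneg : ∀ i, 0 ≤ my i
  move : ∀ i, Z i ≤ h.μx ^ 2 * mx i + h.μy ^ 2 * my i + 2 * D (i + 1) + 2 * D i
  consensus : (1 - ρ) * ∑ i ∈ Finset.range (T + 1), D i ≤ (v * lBi * h.μy) ^ 2 * ζ
    + (v * lBi * lA * h.μy) ^ 2 / (1 - ρ) * ∑ i ∈ Finset.range T, R i
  N_zero : N 0 ≤ 2 * s₀
  N_succ : ∀ i, N (i + 1) ≤ (1 - h.βbar) * N i + (5 / 2 * Lf ^ 2 / h.b * Z i + 10 * τ)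
  F_zero : F 0 ≤ 2 * s₀ / K
  F_succ : ∀ i, F (i + 1) ≤ (1 - h.βbar) * F i + (5 / 2 * Lf ^ 2 / h.b / K * Z i + 10 * τ / K)
  increment : ∀ i, R i ≤ 2 * h.β' * N i + 13 / 2 * Lf ^ 2 * Z i + 10 * τ
  error : ∀ i, ε i ≤ 5 / 4 * F i + 10 * Lf ^ 2 * D i
  potential : ∑ i ∈ Finset.range T, (2 / 25 * G i + 1 / 25 * mx i + 2 * (Lf / ν) ^ 2 * my i)
    ≤ EG / h.μx + 16 * (Lf / ν) ^ 2 * EΔ / h.μy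
      + 8 * (Lf / ν) ^ 2 * ∑ i ∈ Finset.range T, ε i

/-- Solution of the recursions. The consensus error `d` reappears on the right of its own bound,
through the estimator increments, and the displacements reappear in the gradient errors; both loops
are closed by the gains. -/
lemma ErrorRecursions.sum_le {h : Hyper} {K T : ℕ} {Lf ν ρ lA lBi v s₀ τ EG EΔ ζ : ℝ}
    {D N F R Z mx my ε G : ℕ → ℝ}
    (H : ErrorRecursions h K T Lf ν ρ lA lBi v s₀ τ EG EΔ ζ D N F R Z mx my ε G)
    (hh : h.Conditions K Lf ν ρ lA lBi v) (hK : 1 ≤ K) (hL : 0 < Lf) (hν : 0 < ν) (hρ : ρ < 1)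
    (hv : 0 ≤ v) (hA : 0 ≤ lA) (hB : 0 ≤ lBi) (hs₀ : 0 ≤ s₀) (hτ : 0 ≤ τ) (hζ : 0 ≤ ζ) :
    ∑ i ∈ Finset.range T, G i ≤ 25 / 2 * (EG / h.μx + 16 * (Lf / ν) ^ 2 * EΔ / h.μy)
      + 2500 * (Lf / ν) ^ 2 * (Lf ^ 2 / (h.b * K * h.βbar)
        * ((v * lBi * h.μy) ^ 2 * ζ / (1 - ρ)
          + (v * lBi * lA * h.μy) ^ 2 / (1 - ρ) ^ 2
            * (4 * (h.β' / h.βbar) * s₀ + 30 * (T * τ))))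
      + 125 * (Lf / ν) ^ 2 * ((2 * s₀ + 10 * (T * τ)) / (K * h.βbar)) := by
  obtain ⟨hβ, hβ', g1, g2, g3, g4, g5⟩ := hh.gains hK hL hν hρ hv hA hB
  have hK0 : (0 : ℝ) < K := by exact_mod_cast hK
  have hb0 : (0 : ℝ) < h.b := by exact_mod_cast hh.one_le_b
  have hρ' : 0 < 1 - ρ := sub_pos.2 hρ
  set κ := Lf / ν with hκd
  set q := Lf ^ 2 / (h.b * K * h.βbar) with hq
  set Γ := (v * lBi * lA * h.μy) ^ 2 / (1 - ρ) ^ 2 with hΓ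
  have hΓ0 : 0 ≤ Γ := by positivity
  have hq0 : 0 ≤ q := by positivity
  have hT0 : (0 : ℝ) ≤ T := by positivity
  set d := ∑ i ∈ Finset.range (T + 1), D i with hd
  set n := ∑ i ∈ Finset.range T, N i with hn
  set f := ∑ i ∈ Finset.range T, F i with hf
  set r := ∑ i ∈ Finset.range T, R i with hr
  set z := ∑ i ∈ Finset.range T, Z i with hz
  set a := ∑ i ∈ Finset.range T, mx i with ha
  set c := ∑ i ∈ Finset.range T, my i with hc
  set e := ∑ i ∈ Finset.range T, ε i with he
  have ha0 : 0 ≤ a := Finset.sum_nonneg fun i _ => H.mx_nonneg i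
  have hc0 : 0 ≤ c := Finset.sum_nonneg fun i _ => H.my_nonneg i
  have hd0 : 0 ≤ d := Finset.sum_nonneg fun i _ => H.D_nonneg i
  have hdT : ∑ i ∈ Finset.range T, D i ≤ d := by
    rw [hd, Finset.sum_range_succ]
    linarith [H.D_nonneg T]
  have hdT' : ∑ i ∈ Finset.range T, D (i + 1) ≤ d := by
    rw [hd, Finset.sum_range_succ']
    linarith [H.D_nonneg 0]
  have z1 : z ≤ h.μx ^ 2 * a + h.μy ^ 2 * c + 4 * d := by
    have := Finset.sum_le_sum fun i (_ : i ∈ Finset.range T) => H.move i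
    simp only [Finset.sum_add_distrib, ← Finset.mul_sum] at this
    linarith
  set s := h.μx ^ 2 * a + h.μy ^ 2 * c with hs
  have hs0 : 0 ≤ s := by positivity
  set d₀ := (v * lBi * h.μy) ^ 2 * ζ / (1 - ρ) with hd₀
  have d1 : d ≤ d₀ + Γ * r := by
    have e1 : (v * lBi * lA * h.μy) ^ 2 / (1 - ρ) = Γ * (1 - ρ) := by
      rw [hΓ]; field_simp
    have e2 : (v * lBi * h.μy) ^ 2 * ζ = d₀ * (1 - ρ) := by
      rw [hd₀]; field_simp
    have := H.consensus
    rw [e1, e2] at this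
    have h3 : (1 - ρ) * d ≤ (1 - ρ) * (d₀ + Γ * r) := by linarith
    exact le_of_mul_le_mul_left h3 hρ'
  have n1 : n ≤ (2 * s₀ + 5 / 2 * Lf ^ 2 / h.b * z + 10 * (T * τ)) / h.βbar := by
    have := mul_sum_range_le_of_contraction H.N_nonneg H.N_succ T
    simp only [Finset.sum_add_distrib, ← Finset.mul_sum, Finset.sum_const, Finset.card_range,
      nsmul_eq_mul] at this
    rw [le_div_iff₀ hβ]
    linarith [H.N_zero]
  have f1 : f ≤ 5 / 2 * q * z + (2 * s₀ + 10 * (T * τ)) / (K * h.βbar) := by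
    have := mul_sum_range_le_of_contraction H.F_nonneg H.F_succ T
    simp only [Finset.sum_add_distrib, ← Finset.mul_sum, Finset.sum_const, Finset.card_range,
      nsmul_eq_mul] at this
    have e1 : h.βbar * (5 / 2 * q * z + (2 * s₀ + 10 * (T * τ)) / (K * h.βbar))
        = 2 * s₀ / K + (5 / 2 * Lf ^ 2 / h.b / K * z + T * (10 * τ / K)) := by
      rw [hq]; field_simp; ring
    have h3 : h.βbar * f ≤ h.βbar * (5 / 2 * q * z + (2 * s₀ + 10 * (T * τ)) / (K * h.βbar)) := by
      rw [e1]; linarith [H.F_zero]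
    exact le_of_mul_le_mul_left h3 hβ
  have r1 : r ≤ 2 * h.β' * n + 13 / 2 * Lf ^ 2 * z + 10 * (T * τ) := by
    have := Finset.sum_le_sum fun i (_ : i ∈ Finset.range T) => H.increment i
    simp only [Finset.sum_add_distrib, ← Finset.mul_sum, Finset.sum_const, Finset.card_range,
      nsmul_eq_mul] at this
    linarith
  have hβ'0 : 0 ≤ h.β' := by
    have := hh.p_nonneg
    unfold Hyper.β'; positivity
  set A := Γ * (4 * (h.β' / h.βbar) * s₀ + 30 * (T * τ)) with hAd
  -- the increments feed back into the consensus error with gain `1/50`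
  have r2 : Γ * r ≤ 1 / 50 * (s + 4 * d) + A := by
    have h1 : 2 * h.β' * n ≤ 2 * h.β'
        * ((2 * s₀ + 5 / 2 * Lf ^ 2 / h.b * z + 10 * (T * τ)) / h.βbar) := by gcongr
    have h2 : Γ * r ≤ Γ * (2 * h.β'
        * ((2 * s₀ + 5 / 2 * Lf ^ 2 / h.b * z + 10 * (T * τ)) / h.βbar)
          + 13 / 2 * Lf ^ 2 * z + 10 * (T * τ)) := by
      refine mul_le_mul_of_nonneg_left ?_ hΓ0
      linarith
    have h3 : Γ * (2 * h.β'
        * ((2 * s₀ + 5 / 2 * Lf ^ 2 / h.b * z + 10 * (T * τ)) / h.βbar)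
          + 13 / 2 * Lf ^ 2 * z + 10 * (T * τ))
        = (5 * (Γ * (h.β' / h.βbar) * (Lf ^ 2 / h.b)) + 13 / 2 * (Γ * Lf ^ 2)) * z
          + Γ * (4 * (h.β' / h.βbar) * s₀)
          + 20 * (h.β' / h.βbar) * (Γ * (T * τ)) + 10 * (Γ * (T * τ)) := by
      field_simp; ring
    have h4 : h.β' / h.βbar ≤ 1 := (div_le_one hβ).2 hβ'
    have h5 : 0 ≤ Γ * (T * τ) := by positivity
    have h6 := mul_le_of_le_one_left h5 h4
    have h7 : (5 * (Γ * (h.β' / h.βbar) * (Lf ^ 2 / h.b)) + 13 / 2 * (Γ * Lf ^ 2)) * z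
        ≤ 1 / 50 * (s + 4 * d) := by
      have hco : 0 ≤ 5 * (Γ * (h.β' / h.βbar) * (Lf ^ 2 / h.b)) + 13 / 2 * (Γ * Lf ^ 2) := by
        positivity
      refine (mul_le_mul_of_nonneg_left z1 hco).trans ?_
      refine mul_le_mul_of_nonneg_right ?_ (by linarith)
      linarith
    rw [h3] at h2
    have h8 : A = Γ * (4 * (h.β' / h.βbar) * s₀) + 30 * (Γ * (T * τ)) := by rw [hAd]; ring
    linarith
  have hd₀0 : 0 ≤ d₀ := by positivity
  have hA0 : 0 ≤ A := by positivity
  have d2 : d ≤ 11 / 10 * (d₀ + A) + 11 / 500 * s := by linarith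
  have e1 : e ≤ 5 / 4 * f + 10 * Lf ^ 2 * d := by
    have := Finset.sum_le_sum fun i (_ : i ∈ Finset.range T) => H.error i
    simp only [Finset.sum_add_distrib, ← Finset.mul_sum] at this
    have h2 : 10 * Lf ^ 2 * ∑ i ∈ Finset.range T, D i ≤ 10 * Lf ^ 2 * d := by gcongr
    linarith
  set Bf := (2 * s₀ + 10 * (T * τ)) / (K * h.βbar) with hBf
  have e2 : e ≤ 181 / 50 * (q * s) + 99 / 4 * (q * (d₀ + A)) + 5 / 4 * Bf := by
    have h1 : 5 / 2 * q * z ≤ 5 / 2 * q * (s + 4 * d) := by gcongr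
    have h2 : 10 * Lf ^ 2 * d ≤ 10 * q * d := by gcongr
    have h3 : q * d ≤ q * (11 / 10 * (d₀ + A) + 11 / 500 * s) := by gcongr
    linarith
  have s1 : 8 * κ ^ 2 * (181 / 50 * (q * s)) ≤ 1 / 25 * a + 2 * κ ^ 2 * c := by
    have h1 := mul_le_mul_of_nonneg_right g4 ha0
    have h2 : κ ^ 2 * (q * h.μy ^ 2 * c) ≤ κ ^ 2 * (1 / 144 * c) := by gcongr
    have h3 : 8 * κ ^ 2 * (181 / 50 * (q * s))
        = 724 / 25 * (κ ^ 2 * (q * h.μx ^ 2) * a) + 724 / 25 * (κ ^ 2 * (q * h.μy ^ 2 * c)) := by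
      rw [hs]; ring
    have h4 : 0 ≤ κ ^ 2 * c := by positivity
    linarith
  have p1 := H.potential
  simp only [Finset.sum_add_distrib, ← Finset.mul_sum] at p1
  have e3 : 8 * κ ^ 2 * e
      ≤ 8 * κ ^ 2 * (181 / 50 * (q * s) + 99 / 4 * (q * (d₀ + A)) + 5 / 4 * Bf) := by gcongr
  have hqd : 0 ≤ κ ^ 2 * (q * (d₀ + A)) := by positivity
  linarith

/-- The summed bound is an absolute multiple of the performance bound. -/
lemma ErrorRecursions.average_le {h : Hyper} {K T : ℕ} {Lf ν σ ρ lA lBi v I EG EΔ ζ : ℝ}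
    {D N F R Z mx my ε G : ℕ → ℝ}
    (H : ErrorRecursions h K T Lf ν ρ lA lBi v (σ ^ 2 / h.b₀)
      ((h.p / h.B * I + h.β ^ 2 / h.b) * σ ^ 2) EG EΔ ζ D N F R Z mx my ε G)
    (hh : h.Conditions K Lf ν ρ lA lBi v) (hK : 1 ≤ K) (hT : 1 ≤ T) (hL : 0 < Lf) (hν : 0 < ν)
    (hρ : ρ < 1) (hv : 0 ≤ v) (hA : 0 ≤ lA) (hB : 0 ≤ lBi) (hI : 0 ≤ I) (hζ : 0 ≤ ζ)
    (hEG : 0 ≤ EG) (hEΔ : 0 ≤ EΔ) :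
    (T : ℝ)⁻¹ * ∑ i ∈ Finset.range T, G i
      ≤ 75000 * performanceBound h K T Lf ν σ ρ lA lBi v I EG EΔ ζ := by
  have hp := hh.p_nonneg
  have hsum := H.sum_le hh hK hL hν hρ hv hA hB (by positivity) (by positivity) hζ
  obtain ⟨hβ, -⟩ := hh.gains hK hL hν hρ hv hA hB
  have hK0 : (0 : ℝ) < K := by exact_mod_cast hK
  have hT0 : (0 : ℝ) < T := by exact_mod_cast hT
  have hb0 : (0 : ℝ) < h.b := by exact_mod_cast hh.one_le_b
  have hb₀0 : (0 : ℝ) < h.b₀ := by exact_mod_cast hh.one_le_b₀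
  have hρ' : 0 < 1 - ρ := sub_pos.2 hρ
  have hμx := hh.μx_pos
  have hμy := hh.μy_pos
  have hβ'0 : 0 ≤ h.β' := by
    unfold Hyper.β'; positivity
  set κ := Lf / ν with hκ
  set ϖ := h.p / h.B * I + h.β ^ 2 / h.b with hϖ
  have hϖ0 : 0 ≤ ϖ := by positivity
  set t1 := EG / (T * h.μx) with ht1
  set t2 := κ ^ 2 * EΔ / (T * h.μy) with ht2
  set t3 := κ ^ 2 * (v ^ 2 * aCoef h K Lf ρ lBi) * h.μy ^ 2 * ζ / T with ht3
  set t4 := κ ^ 2 * (v ^ 2 * bCoef h K Lf ρ lA lBi) * h.μy ^ 2 * σ ^ 2 / T with ht4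
  set t5 := κ ^ 2 * (v ^ 2 * dCoef h K Lf ρ lA lBi I * h.μy ^ 2) * σ ^ 2 with ht5
  set t6 := κ ^ 2 * eCoef h K T I * σ ^ 2 with ht6
  have hperf : t1 + t2 + t3 + t4 + t5 + t6
      ≤ performanceBound h K T Lf ν σ ρ lA lBi v I EG EΔ ζ := by
    have e : performanceBound h K T Lf ν σ ρ lA lBi v I EG EΔ ζ = t1 + t2 + t3 + t4 + t5 + t6
        + κ ^ 2 * (v ^ 4 * cCoef h K Lf ρ lA lBi * h.μy ^ 2 + v ^ 2 * fCoef h K Lf lBi)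
          * h.μy ^ 2 * ζ / T := by
      rw [performanceBound]; ring
    have hc : 0 ≤ cCoef h K Lf ρ lA lBi := by unfold cCoef; positivity
    have hf : 0 ≤ fCoef h K Lf lBi := by unfold fCoef; positivity
    have : 0 ≤ κ ^ 2 * (v ^ 4 * cCoef h K Lf ρ lA lBi * h.μy ^ 2 + v ^ 2 * fCoef h K Lf lBi)
          * h.μy ^ 2 * ζ / T := by positivity
    linarith
  have p1 : 0 ≤ t1 := by positivity
  have p2 : 0 ≤ t2 := by positivity
  have p3 : 0 ≤ t3 := by
    have : 0 ≤ aCoef h K Lf ρ lBi := by unfold aCoef; positivity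
    positivity
  have p4 : 0 ≤ t4 := by
    have : 0 ≤ bCoef h K Lf ρ lA lBi := by unfold bCoef; positivity
    positivity
  have p5 : 0 ≤ t5 := by
    have : 0 ≤ dCoef h K Lf ρ lA lBi I := by unfold dCoef; positivity
    positivity
  have hE : eCoef h K T I = 1 / (h.b₀ * h.βbar * K * T) + ϖ / (K * h.βbar) := by
    rw [eCoef, hϖ]; field_simp; ring
  have p6 : 0 ≤ t6 := by
    have : 0 ≤ eCoef h K T I := by rw [hE]; positivity
    positivity
  have hrhs : (T : ℝ)⁻¹ * (25 / 2 * (EG / h.μx + 16 * κ ^ 2 * EΔ / h.μy)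
      + 2500 * κ ^ 2 * (Lf ^ 2 / (h.b * K * h.βbar)
        * ((v * lBi * h.μy) ^ 2 * ζ / (1 - ρ)
          + (v * lBi * lA * h.μy) ^ 2 / (1 - ρ) ^ 2
            * (4 * (h.β' / h.βbar) * (σ ^ 2 / h.b₀) + 30 * (T * (ϖ * σ ^ 2)))))
      + 125 * κ ^ 2 * ((2 * (σ ^ 2 / h.b₀) + 10 * (T * (ϖ * σ ^ 2))) / (K * h.βbar)))
      = 25 / 2 * t1 + 200 * t2 + 2500 * t3 + 10000 * t4 + 75000 * t5
        + 125 * κ ^ 2 * (2 * (1 / (h.b₀ * h.βbar * K * T)) + 10 * (ϖ / (K * h.βbar))) * σ ^ 2 := by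
    have hd : dCoef h K Lf ρ lA lBi I
        = Lf ^ 2 * lA ^ 2 * lBi ^ 2 / (h.b * K * h.βbar * (1 - ρ) ^ 2) * ϖ := rfl
    rw [ht1, ht2, ht3, ht4, ht5, aCoef, bCoef, hd]
    clear_value κ ϖ
    field_simp
    ring
  have h6 : 125 * κ ^ 2 * (2 * (1 / (h.b₀ * h.βbar * K * T)) + 10 * (ϖ / (K * h.βbar))) * σ ^ 2
      ≤ 1250 * t6 := by
    rw [ht6, hE]
    have : 0 ≤ κ ^ 2 * (1 / (h.b₀ * h.βbar * K * T)) * σ ^ 2 := by positivity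
    linarith
  calc (T : ℝ)⁻¹ * ∑ i ∈ Finset.range T, G i ≤ _ := mul_le_mul_of_nonneg_left hsum (by positivity)
    _ = _ := hrhs
    _ ≤ 75000 * (t1 + t2 + t3 + t4 + t5 + t6) := by linarith
    _ ≤ _ := by gcongr

/-! ### Expected errors along a run -/

section Runs

variable {K d₁ d₂ : ℕ} {h : Hyper} {Ξ : Type*} [MeasurableSpace Ξ]

/-- `S` is a run of DAMA with GRACE: the defining equations of `iterate`, as a family of states
indexed by rounds and realizations of the randomness. The ascent step in `y` is written as a
descent step of size `-μ_y`, so that the results on one recursion apply to both variables. -/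
structure IsRun (prob : Problem K d₁ d₂ Ξ) (Dx Dy : Design K) (x₀ dx₀ : Vec d₁) (y₀ dy₀ : Vec d₂)
    (S : ℕ → Sample K h Ξ → State K d₁ d₂) : Prop where
  X_zero : ∀ q, (S 0 q).X = fun _ => x₀
  Y_zero : ∀ q, (S 0 q).Y = fun _ => y₀
  Dx_zero : ∀ q, (S 0 q).Dx = fun _ => dx₀
  Dy_zero : ∀ q, (S 0 q).Dy = fun _ => dy₀
  Mx_zero : ∀ q, (S 0 q).Mx = initEstimate h prob.gradQx q.1 (fun _ => x₀) fun _ => y₀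
  My_zero : ∀ q, (S 0 q).My = initEstimate h prob.gradQy q.1 (fun _ => x₀) fun _ => y₀
  X_succ : ∀ i q, (S (i + 1) q).X
    = act Dx.A (act Dx.C (S i q).X - h.μx • (S i q).Mx) - act Dx.B (S i q).Dx
  Y_succ : ∀ i q, (S (i + 1) q).Y
    = act Dy.A (act Dy.C (S i q).Y - (-h.μy) • (S i q).My) - act Dy.B (S i q).Dy
  Dx_succ : ∀ i q, (S (i + 1) q).Dx = (S i q).Dx + act Dx.B (S (i + 1) q).X
  Dy_succ : ∀ i q, (S (i + 1) q).Dy = (S i q).Dy + act Dy.B (S (i + 1) q).Y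
  Mx_succ : ∀ i q, (S (i + 1) q).Mx = grace h prob.data prob.gradQx q.1 (q.2 (i + 1)) (i + 1)
    (S i q).Mx (S i q).X (S i q).Y (S (i + 1) q).X (S (i + 1) q).Y
  My_succ : ∀ i q, (S (i + 1) q).My = grace h prob.data prob.gradQy q.1 (q.2 (i + 1)) (i + 1)
    (S i q).My (S i q).X (S i q).Y (S (i + 1) q).X (S (i + 1) q).Y

lemma isRun_iterate (prob : Problem K d₁ d₂ Ξ) (Dx Dy : Design K) (x₀ dx₀ : Vec d₁)
    (y₀ dy₀ : Vec d₂) : IsRun (h := h) prob Dx Dy x₀ dx₀ y₀ dy₀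
      fun i q => iterate prob Dx Dy h x₀ y₀ dx₀ dy₀ q.1 q.2 i where
  X_zero _ := rfl
  Y_zero _ := rfl
  Dx_zero _ := rfl
  Dy_zero _ := rfl
  Mx_zero _ := rfl
  My_zero _ := rfl
  X_succ _ _ := rfl
  Y_succ _ _ := by rw [neg_smul, sub_neg_eq_add]; rfl
  Dx_succ _ _ := rfl
  Dy_succ _ _ := rfl
  Mx_succ _ _ := rfl
  My_succ _ _ := rfl

variable {P : Measure (Sample K h Ξ)}

lemma blockNormSq_nonneg {d : ℕ} (v : Block K d) : 0 ≤ blockNormSq v :=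
  Finset.sum_nonneg fun _ _ => sq_nonneg _

lemma prior_act {d r : ℕ} (M : Matrix (Fin K) (Fin K) ℝ) {V : Sample K h Ξ → Block K d}
    (hV : ∀ k, Prior P r fun q => V q k) (k : Fin K) : Prior P r fun q => act M (V q) k :=
  Prior.sum _ fun l => (hV l).smul (M k l)

lemma prior_centroid {d r : ℕ} {V : Sample K h Ξ → Block K d}
    (hV : ∀ k, Prior P r fun q => V q k) : Prior P r fun q => centroid (V q) :=
  (Prior.sum _ fun l => hV l).smul _

lemma integrable_deviation {d r : ℕ} {V : Sample K h Ξ → Block K d}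
    (hV : ∀ k, Prior P r fun q => V q k) : Integrable (fun q => deviation (V q)) P :=
  integrable_finsetSum _ fun k _ => ((hV k).sub (prior_centroid hV)).integrable_norm_sq

/-- The models and dual variables of round `r` are determined by the randomness of earlier rounds,
and the gradient estimates by that up to round `r`; all are square integrable. -/
structure PriorState (P : Measure (Sample K h Ξ)) (r : ℕ)
    (S : Sample K h Ξ → State K d₁ d₂) : Prop where
  X : ∀ k, Prior P r fun q => (S q).X k
  Y : ∀ k, Prior P r fun q => (S q).Y k
  Dx : ∀ k, Prior P r fun q => (S q).Dx k
  Dy : ∀ k, Prior P r fun q => (S q).Dy k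
  Mx : ∀ k, Prior P (r + 1) fun q => (S q).Mx k
  My : ∀ k, Prior P (r + 1) fun q => (S q).My k

/-- What is assumed of the problem, the network and the randomness. -/
structure Setting (P : Measure (Sample K h Ξ)) (prob : Problem K d₁ d₂ Ξ) (ν Lf σ : ℝ)
    (W : Matrix (Fin K) (Fin K) ℝ) (Dx Dy : Design K) : Prop where
  law : IsSampleLaw P prob.data
  one_le_K : 1 ≤ K
  regular : prob.Regular
  pl : prob.PLCondition ν
  smooth : prob.ExpectedSmooth Lf
  variance : prob.BoundedVariance σ
  le_Lf : ν ≤ Lf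
  W_symm : W.IsSymm
  admissible_x : Dx.Admissible W
  admissible_y : Dy.Admissible W

variable {prob : Problem K d₁ d₂ Ξ} {ν Lf σ ρ lA lBi w₁ w₂ : ℝ} {W : Matrix (Fin K) (Fin K) ℝ}
  {Dx Dy : Design K} {Sx : Spectral Dx d₁} {Sy : Spectral Dy d₂}
  {x₀ dx₀ : Vec d₁} {y₀ dy₀ : Vec d₂} {S : ℕ → Sample K h Ξ → State K d₁ d₂}

lemma Setting.oracle_x (hA : Setting P prob ν Lf σ W Dx Dy) :
    Oracle prob.data prob.gradQx prob.localGradx Lf σ :=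
  Problem.oracle_x hA.regular hA.smooth hA.variance

lemma Setting.oracle_y (hA : Setting P prob ν Lf σ W Dx Dy) :
    Oracle prob.data prob.gradQy prob.localGrady Lf σ :=
  Problem.oracle_y hA.regular hA.smooth hA.variance

lemma IsRun.prior (hR : IsRun prob Dx Dy x₀ dx₀ y₀ dy₀ S) (hA : Setting P prob ν Lf σ W Dx Dy)
    (hh : h.Conditions K Lf ν ρ lA lBi (w₁ * w₂)) (i : ℕ) : PriorState P i (S i) := by
  have := hA.law.prob
  have hL := hA.smooth.pos.le
  induction i with
  | zero =>
    refine ⟨fun k => ?_, fun k => ?_, fun k => ?_, fun k => ?_, fun k => ?_, fun k => ?_⟩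
    · simpa only [hR.X_zero] using Prior.const _
    · simpa only [hR.Y_zero] using Prior.const _
    · simpa only [hR.Dx_zero] using Prior.const _
    · simpa only [hR.Dy_zero] using Prior.const _
    · simpa only [hR.Mx_zero] using hA.oracle_x.prior_init hL hA.law hh.one_le_b₀ _ _ k
    · simpa only [hR.My_zero] using hA.oracle_y.prior_init hL hA.law hh.one_le_b₀ _ _ k
  | succ i ih =>
    have hup : i ≤ i + 1 := Nat.le_succ i
    have hX : ∀ k, Prior P (i + 1) fun q => (S (i + 1) q).X k := by
      intro k
      simp only [hR.X_succ]
      exact (prior_act _ (fun l => (prior_act _ (fun m => (ih.X m).mono hup) l).sub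
        ((ih.Mx l).smul h.μx)) k).sub (prior_act _ (fun l => (ih.Dx l).mono hup) k)
    have hY : ∀ k, Prior P (i + 1) fun q => (S (i + 1) q).Y k := by
      intro k
      simp only [hR.Y_succ]
      exact (prior_act _ (fun l => (prior_act _ (fun m => (ih.Y m).mono hup) l).sub
        ((ih.My l).smul (-h.μy))) k).sub (prior_act _ (fun l => (ih.Dy l).mono hup) k)
    refine ⟨hX, hY, fun k => ?_, fun k => ?_, fun k => ?_, fun k => ?_⟩
    · simp only [hR.Dx_succ]
      exact ((ih.Dx k).mono hup).add (prior_act _ hX k)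
    · simp only [hR.Dy_succ]
      exact ((ih.Dy k).mono hup).add (prior_act _ hY k)
    · simp only [hR.Mx_succ]
      exact hA.oracle_x.prior_grace hL hA.law hh.β_nonneg hh.β_le hh.one_le_b hh.one_le_B
        (fun l => (ih.X l).mono hup) (fun l => (ih.Y l).mono hup) hX hY ih.Mx k
    · simp only [hR.My_succ]
      exact hA.oracle_y.prior_grace hL hA.law hh.β_nonneg hh.β_le hh.one_le_b hh.one_le_B
        (fun l => (ih.X l).mono hup) (fun l => (ih.Y l).mono hup) hX hY ih.My k

lemma PriorState.prior_gradJx {r : ℕ} {S : Sample K h Ξ → State K d₁ d₂} (hS : PriorState P r S)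
    (hA : Setting P prob ν Lf σ W Dx Dy) :
    Prior P r fun q => prob.gradJx (centroid (S q).X) (centroid (S q).Y) := by
  have := hA.law.prob
  simp only [Problem.gradJx_eq hA.regular]
  exact (Prior.sum _ fun k => hA.oracle_x.prior_mean hA.smooth.pos.le (prior_centroid hS.X)
    (prior_centroid hS.Y) k).smul _

lemma PriorState.prior_gradJy {r : ℕ} {S : Sample K h Ξ → State K d₁ d₂} (hS : PriorState P r S)
    (hA : Setting P prob ν Lf σ W Dx Dy) :
    Prior P r fun q => prob.gradJy (centroid (S q).X) (centroid (S q).Y) := by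
  have := hA.law.prob
  simp only [Problem.gradJy_eq hA.regular]
  exact (Prior.sum _ fun k => hA.oracle_y.prior_mean hA.smooth.pos.le (prior_centroid hS.X)
    (prior_centroid hS.Y) k).smul _

variable (P prob S)

/-- Expected consensus error per agent. -/
def consensusError (i : ℕ) : ℝ :=
  (K : ℝ)⁻¹ * (∫ q, deviation (S i q).X ∂P + ∫ q, deviation (S i q).Y ∂P)

/-- Expected squared tracking error per agent. -/
def trackingError (i : ℕ) : ℝ :=
  (K : ℝ)⁻¹ *
    (∫ q, blockNormSq (Oracle.trackErr prob.localGradx (S i q).Mx (S i q).X (S i q).Y) ∂P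
      + ∫ q, blockNormSq (Oracle.trackErr prob.localGrady (S i q).My (S i q).X (S i q).Y) ∂P)

/-- Expected squared tracking error of the averaged estimates. -/
def meanTrackingError (i : ℕ) : ℝ :=
  ∫ q, ‖centroid (Oracle.trackErr prob.localGradx (S i q).Mx (S i q).X (S i q).Y)‖ ^ 2 ∂P
    + ∫ q, ‖centroid (Oracle.trackErr prob.localGrady (S i q).My (S i q).X (S i q).Y)‖ ^ 2 ∂P

/-- Expected squared increment of the estimates, per agent. -/
def estimateIncrement (i : ℕ) : ℝ :=
  (K : ℝ)⁻¹ * (∫ q, blockNormSq ((S (i + 1) q).Mx - (S i q).Mx) ∂P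
    + ∫ q, blockNormSq ((S (i + 1) q).My - (S i q).My) ∂P)

/-- Expected squared displacement of the models, per agent. -/
def displacement (i : ℕ) : ℝ :=
  (K : ℝ)⁻¹ * ∫ q, Oracle.totalMove (fun q => (S i q).X) (fun q => (S i q).Y)
    (fun q => (S (i + 1) q).X) (fun q => (S (i + 1) q).Y) q ∂P

/-- Expected squared difference between the gradients of the global risk at the centroids and the
averaged estimates. -/
def gradientError (i : ℕ) : ℝ :=
  ∫ q, ‖prob.gradJx (centroid (S i q).X) (centroid (S i q).Y) - centroid (S i q).Mx‖ ^ 2 ∂P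
    + ∫ q, ‖prob.gradJy (centroid (S i q).X) (centroid (S i q).Y) - centroid (S i q).My‖ ^ 2 ∂P

/-- Expected squared norm of the gradient of the global risk at the centroids. -/
def gradientSq (i : ℕ) : ℝ :=
  ∫ q, ‖prob.gradJx (centroid (S i q).X) (centroid (S i q).Y)‖ ^ 2 ∂P
    + ∫ q, ‖prob.gradJy (centroid (S i q).X) (centroid (S i q).Y)‖ ^ 2 ∂P

variable {P prob S}

namespace IsRun

variable (hR : IsRun prob Dx Dy x₀ dx₀ y₀ dy₀ S) (hA : Setting P prob ν Lf σ W Dx Dy)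
  (hh : h.Conditions K Lf ν ρ lA lBi (w₁ * w₂))

include hR hA

lemma centroid_x (i : ℕ) (q : Sample K h Ξ) :
    centroid (S (i + 1) q).X = centroid (S i q).X - h.μx • centroid (S i q).Mx := by
  rw [hR.X_succ, hA.admissible_x.centroid_step hA.W_symm]

lemma centroid_y (i : ℕ) (q : Sample K h Ξ) :
    centroid (S (i + 1) q).Y = centroid (S i q).Y + h.μy • centroid (S i q).My := by
  rw [hR.Y_succ, hA.admissible_y.centroid_step hA.W_symm, neg_smul, sub_neg_eq_add]

include hh

lemma displacement_le (i : ℕ) :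
    displacement P S i ≤ h.μx ^ 2 * ∫ q, ‖centroid (S i q).Mx‖ ^ 2 ∂P
      + h.μy ^ 2 * ∫ q, ‖centroid (S i q).My‖ ^ 2 ∂P
      + 2 * consensusError P S (i + 1) + 2 * consensusError P S i := by
  have hK0 : (0 : ℝ) < K := by exact_mod_cast hA.one_le_K
  have h0 := hR.prior hA hh i
  have h1 := hR.prior hA hh (i + 1)
  have ix := (prior_centroid h0.Mx).integrable_norm_sq.const_mul (K * h.μx ^ 2)
  have iy := (prior_centroid h0.My).integrable_norm_sq.const_mul (K * h.μy ^ 2)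
  have i1 := ((integrable_deviation h1.X).fun_add (integrable_deviation h1.Y)).const_mul 2
  have i0 := ((integrable_deviation h0.X).fun_add (integrable_deviation h0.Y)).const_mul 2
  have hi := ((ix.fun_add iy).fun_add i1).fun_add i0
  have hle : ∫ q, Oracle.totalMove (fun q => (S i q).X) (fun q => (S i q).Y)
      (fun q => (S (i + 1) q).X) (fun q => (S (i + 1) q).Y) q ∂P
      ≤ K * h.μx ^ 2 * ∫ q, ‖centroid (S i q).Mx‖ ^ 2 ∂P
      + K * h.μy ^ 2 * ∫ q, ‖centroid (S i q).My‖ ^ 2 ∂P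
      + 2 * (∫ q, deviation (S (i + 1) q).X ∂P + ∫ q, deviation (S (i + 1) q).Y ∂P)
      + 2 * (∫ q, deviation (S i q).X ∂P + ∫ q, deviation (S i q).Y ∂P) := by
    rw [← integral_add (integrable_deviation h1.X) (integrable_deviation h1.Y),
      ← integral_add (integrable_deviation h0.X) (integrable_deviation h0.Y),
      ← integral_const_mul, ← integral_const_mul, ← integral_const_mul, ← integral_const_mul,
      ← integral_add ix iy, ← integral_add (ix.fun_add iy) i1,
      ← integral_add ((ix.fun_add iy).fun_add i1) i0]
    refine integral_mono_of_nonneg (Filter.Eventually.of_forall fun q => ?_) hi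
      (Filter.Eventually.of_forall fun q => ?_)
    · exact add_nonneg (blockNormSq_nonneg _) (blockNormSq_nonneg _)
    · have e1 := blockNormSq_sub_le hA.one_le_K (S (i + 1) q).X (S i q).X
      have e2 := blockNormSq_sub_le hA.one_le_K (S (i + 1) q).Y (S i q).Y
      rw [hR.centroid_x hA, sub_sub_cancel_left, norm_neg, norm_smul, mul_pow, Real.norm_eq_abs,
        sq_abs] at e1
      rw [hR.centroid_y hA, add_sub_cancel_left, norm_smul, mul_pow, Real.norm_eq_abs,
        sq_abs] at e2
      simp only [Oracle.totalMove]
      linarith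
  have := mul_le_mul_of_nonneg_left hle (inv_nonneg.2 hK0.le)
  rw [displacement, consensusError, consensusError]
  refine this.trans_eq ?_
  field_simp

lemma sum_consensusError_le (hSx : Sx.Bounds ρ lA lBi w₁ w₂) (hSy : Sy.Bounds ρ lA lBi w₁ w₂)
    (T : ℕ) :
    (1 - ρ) * ∑ i ∈ Finset.range (T + 1), consensusError P S i
      ≤ (w₁ * w₂ * lBi * h.μy) ^ 2 * zetaSq P Dx Dy (S 0)
        + (w₁ * w₂ * lBi * lA * h.μy) ^ 2 / (1 - ρ)
          * ∑ i ∈ Finset.range T, estimateIncrement P S i := by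
  have hK0 : (0 : ℝ) < K := by exact_mod_cast hA.one_le_K
  have hρ : 0 < 1 - ρ := sub_pos.2 hSx.ρ_lt
  have hpr := hR.prior hA hh
  have hμ : h.μx ^ 2 ≤ h.μy ^ 2 := by
    refine pow_le_pow_left₀ hh.μx_pos.le (hh.μx_2.trans (div_le_self hh.μy_pos.le ?_)) 2
    have : 1 ≤ (Lf / ν) := (one_le_div hA.pl.pos).2 hA.le_Lf
    nlinarith
  -- one recursion with step size `μ`, integrated; it is used with `μ = μ_x` and `μ = -μ_y`
  have key : ∀ {d : ℕ} {D : Design K} (Sd : Spectral D d) (X Z M : ℕ → Sample K h Ξ → Block K d)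
      (_ : Sd.Bounds ρ lA lBi w₁ w₂) (_ : D.Admissible W) (μ : ℝ) (_ : μ ^ 2 ≤ h.μy ^ 2)
      (x z : Vec d) (_ : ∀ q, X 0 q = fun _ => x) (_ : ∀ q, Z 0 q = fun _ => z)
      (_ : ∀ i q, X (i + 1) q = act D.A (act D.C (X i q) - μ • M i q) - act D.B (Z i q))
      (_ : ∀ i q, Z (i + 1) q = Z i q + act D.B (X (i + 1) q))
      (_ : ∀ i k, Prior P i fun q => X i q k) (_ : ∀ i k, Prior P (i + 1) fun q => M i q k),
      (1 - ρ) * ∑ i ∈ Finset.range (T + 1), ∫ q, deviation (X i q) ∂P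
        ≤ (w₁ * w₂ * lBi * h.μy) ^ 2 * ∫ q, blockNormSq (act (D.A - avgMatrix K) (M 0 q)) ∂P
          + (w₁ * w₂ * lBi * lA * h.μy) ^ 2 / (1 - ρ)
            * ∑ i ∈ Finset.range T, ∫ q, blockNormSq (M (i + 1) q - M i q) ∂P := by
    intro d D Sd X Z M hSd hD μ hle x z hX0 hZ0 hX hZ pX pM
    have j0 : Integrable (fun q => blockNormSq (act (D.A - avgMatrix K) (M 0 q))) P :=
      integrable_blockNormSq (prior_act _ (pM 0))
    have j1 : ∀ i, Integrable (fun q => blockNormSq (M (i + 1) q - M i q)) P := fun i =>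
      integrable_blockNormSq (V := fun q => M (i + 1) q - M i q)
        fun k => (pM (i + 1) k).sub ((pM i k).mono (Nat.le_succ _))
    have jD : ∀ i, Integrable (fun q => deviation (X i q)) P := fun i =>
      integrable_deviation (pX i)
    have r0 := j0.const_mul ((w₁ * w₂ * lBi * h.μy) ^ 2)
    have r1 := (integrable_finsetSum (Finset.range T) fun i _ => j1 i).const_mul
      ((w₁ * w₂ * lBi * lA * h.μy) ^ 2 / (1 - ρ))
    have rD := (integrable_finsetSum (Finset.range (T + 1)) fun i _ => jD i).const_mul (1 - ρ)
    rw [← integral_finsetSum _ fun i _ => jD i, ← integral_finsetSum _ fun i _ => j1 i,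
      ← integral_const_mul, ← integral_const_mul, ← integral_const_mul, ← integral_add r0 r1]
    refine integral_mono rD (r0.fun_add r1) fun q => ?_
    refine (hSd.sum_deviation_le hA.one_le_K hA.W_symm hD μ (fun i => hX i q) (fun i => hZ i q)
      (hX0 q) (hZ0 q) T).trans ?_
    have n0 := blockNormSq_nonneg (act (D.A - avgMatrix K) (M 0 q))
    have n1 : 0 ≤ ∑ i ∈ Finset.range T, blockNormSq (M (i + 1) q - M i q) :=
      Finset.sum_nonneg fun i _ => blockNormSq_nonneg _
    refine add_le_add (mul_le_mul_of_nonneg_right ?_ n0) (mul_le_mul_of_nonneg_right ?_ n1)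
    · rw [mul_pow, mul_pow _ h.μy]
      gcongr
    · rw [mul_pow, mul_pow _ h.μy]
      gcongr
  have kx := key Sx (fun i q => (S i q).X) (fun i q => (S i q).Dx) (fun i q => (S i q).Mx) hSx
    hA.admissible_x h.μx hμ x₀ dx₀ hR.X_zero hR.Dx_zero hR.X_succ hR.Dx_succ
    (fun i => (hpr i).X) fun i => (hpr i).Mx
  have ky := key Sy (fun i q => (S i q).Y) (fun i q => (S i q).Dy) (fun i q => (S i q).My) hSy
    hA.admissible_y (-h.μy) (neg_sq h.μy).le y₀ dy₀ hR.Y_zero hR.Dy_zero hR.Y_succ hR.Dy_succ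
    (fun i => (hpr i).Y) fun i => (hpr i).My
  have hsum := mul_le_mul_of_nonneg_left (add_le_add kx ky) (inv_nonneg.2 hK0.le)
  simp only [consensusError, estimateIncrement, zetaSq, ← Finset.mul_sum, Finset.sum_add_distrib]
  linarith

lemma trackingError_zero_le : trackingError P prob S 0 ≤ 2 * (σ ^ 2 / h.b₀) := by
  have hK0 : (0 : ℝ) < K := by exact_mod_cast hA.one_le_K
  have hL := hA.smooth.pos.le
  have hx := hA.oracle_x.integral_trackErr_init_le hL hA.law hh.one_le_b₀ (fun _ => x₀) fun _ => y₀
  have hy := hA.oracle_y.integral_trackErr_init_le hL hA.law hh.one_le_b₀ (fun _ => x₀) fun _ => y₀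
  simp only [trackingError, hR.X_zero, hR.Y_zero, hR.Mx_zero, hR.My_zero]
  rw [inv_mul_le_iff₀ hK0]
  linarith

lemma meanTrackingError_zero_le : meanTrackingError P prob S 0 ≤ 2 * (σ ^ 2 / h.b₀) / K := by
  have hL := hA.smooth.pos.le
  have hx := hA.oracle_x.integral_centroid_trackErr_init_le hL hA.law hh.one_le_b₀ (fun _ => x₀)
    (fun _ => y₀) hA.one_le_K
  have hy := hA.oracle_y.integral_centroid_trackErr_init_le hL hA.law hh.one_le_b₀ (fun _ => x₀)
    (fun _ => y₀) hA.one_le_K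
  simp only [meanTrackingError, hR.X_zero, hR.Y_zero, hR.Mx_zero, hR.My_zero]
  rw [two_mul, add_div]
  exact add_le_add hx hy

lemma trackingError_succ_le (i : ℕ) :
    trackingError P prob S (i + 1) ≤ (1 - h.βbar) * trackingError P prob S i
      + (5 / 2 * Lf ^ 2 / h.b * displacement P S i + 10 * Oracle.noiseLevel h prob.data σ) := by
  have hK0 : (0 : ℝ) < K := by exact_mod_cast hA.one_le_K
  have hL := hA.smooth.pos.le
  have h0 := hR.prior hA hh i
  have h1 := hR.prior hA hh (i + 1)
  have hup := Nat.le_succ i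
  have hx := hA.oracle_x.integral_trackErr_le hL hA.law hh.β_nonneg hh.β_le hh.one_le_b
    hh.one_le_B (fun k => (h0.X k).mono hup) (fun k => (h0.Y k).mono hup) h1.X h1.Y h0.Mx
  have hy := hA.oracle_y.integral_trackErr_le hL hA.law hh.β_nonneg hh.β_le hh.one_le_b
    hh.one_le_B (fun k => (h0.X k).mono hup) (fun k => (h0.Y k).mono hup) h1.X h1.Y h0.My
  simp only [← hR.Mx_succ] at hx
  simp only [← hR.My_succ] at hy
  have := mul_le_mul_of_nonneg_left (add_le_add hx hy) (inv_nonneg.2 hK0.le)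
  refine this.trans_eq ?_
  rw [trackingError, displacement]
  field_simp
  ring

lemma meanTrackingError_succ_le (i : ℕ) :
    meanTrackingError P prob S (i + 1) ≤ (1 - h.βbar) * meanTrackingError P prob S i
      + (5 / 2 * Lf ^ 2 / h.b / K * displacement P S i
        + 10 * Oracle.noiseLevel h prob.data σ / K) := by
  have hL := hA.smooth.pos.le
  have h0 := hR.prior hA hh i
  have h1 := hR.prior hA hh (i + 1)
  have hup := Nat.le_succ i
  have hx := hA.oracle_x.integral_centroid_trackErr_le hL hA.law hh.β_nonneg hh.β_le hh.one_le_b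
    hh.one_le_B (fun k => (h0.X k).mono hup) (fun k => (h0.Y k).mono hup) h1.X h1.Y h0.Mx
    hA.one_le_K
  have hy := hA.oracle_y.integral_centroid_trackErr_le hL hA.law hh.β_nonneg hh.β_le hh.one_le_b
    hh.one_le_B (fun k => (h0.X k).mono hup) (fun k => (h0.Y k).mono hup) h1.X h1.Y h0.My
    hA.one_le_K
  simp only [← hR.Mx_succ] at hx
  simp only [← hR.My_succ] at hy
  refine (add_le_add hx hy).trans_eq ?_
  rw [meanTrackingError, displacement]
  ring

lemma estimateIncrement_le (i : ℕ) :
    estimateIncrement P S i ≤ 2 * h.β' * trackingError P prob S i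
      + 13 / 2 * Lf ^ 2 * displacement P S i + 10 * Oracle.noiseLevel h prob.data σ := by
  have hK0 : (0 : ℝ) < K := by exact_mod_cast hA.one_le_K
  have hL := hA.smooth.pos.le
  have h0 := hR.prior hA hh i
  have h1 := hR.prior hA hh (i + 1)
  have hup := Nat.le_succ i
  have hx := hA.oracle_x.integral_blockNormSq_increment_le hL hA.law hh.β_nonneg hh.β_le
    hh.one_le_b hh.one_le_B (fun k => (h0.X k).mono hup) (fun k => (h0.Y k).mono hup) h1.X h1.Y
    h0.Mx
  have hy := hA.oracle_y.integral_blockNormSq_increment_le hL hA.law hh.β_nonneg hh.β_le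
    hh.one_le_b hh.one_le_B (fun k => (h0.X k).mono hup) (fun k => (h0.Y k).mono hup) h1.X h1.Y
    h0.My
  simp only [← hR.Mx_succ] at hx
  simp only [← hR.My_succ] at hy
  have := mul_le_mul_of_nonneg_left (add_le_add hx hy) (inv_nonneg.2 hK0.le)
  refine this.trans_eq ?_
  rw [trackingError, displacement]
  field_simp
  ring

lemma gradientError_le (i : ℕ) :
    gradientError P prob S i
      ≤ 5 / 4 * meanTrackingError P prob S i + 10 * Lf ^ 2 * consensusError P S i := by
  have := hA.law.prob
  have hL := hA.smooth.pos.le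
  have h0 := hR.prior hA hh i
  have hup := Nat.le_succ i
  have jX := integrable_deviation h0.X
  have jY := integrable_deviation h0.Y
  have key : ∀ {d : ℕ} {g : Fin K → Vec d₁ → Vec d₂ → Ξ → Vec d}
      {G : Fin K → Vec d₁ → Vec d₂ → Vec d} (_ : Oracle prob.data g G Lf σ)
      (M : Sample K h Ξ → Block K d) (_ : ∀ k, Prior P (i + 1) fun q => M q k),
      ∫ q, ‖(K : ℝ)⁻¹ • ∑ k, G k (centroid (S i q).X) (centroid (S i q).Y) - centroid (M q)‖ ^ 2 ∂P
        ≤ 5 / 4 * ∫ q, ‖centroid (Oracle.trackErr G (M q) (S i q).X (S i q).Y)‖ ^ 2 ∂P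
          + 5 * Lf ^ 2 * consensusError P S i := by
    intro d g G hO M hM
    have j1 := (prior_centroid (hO.prior_trackErr hL (fun k => (h0.X k).mono hup)
      (fun k => (h0.Y k).mono hup) hM)).integrable_norm_sq
    rw [consensusError, ← integral_add jX jY, ← integral_const_mul, ← integral_const_mul,
      ← integral_const_mul,
      ← integral_add (j1.const_mul _) (((jX.fun_add jY).const_mul _).const_mul _)]
    refine integral_mono_of_nonneg (Filter.Eventually.of_forall fun q => sq_nonneg _)
      ((j1.const_mul _).fun_add (((jX.fun_add jY).const_mul _).const_mul _))
      (Filter.Eventually.of_forall fun q => ?_)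
    exact hO.norm_mean_sub_centroid_sq_le hA.one_le_K (M q) (S i q).X (S i q).Y
  have hx := key hA.oracle_x (fun q => (S i q).Mx) h0.Mx
  have hy := key hA.oracle_y (fun q => (S i q).My) h0.My
  rw [gradientError, meanTrackingError]
  simp only [Problem.gradJx_eq hA.regular, Problem.gradJy_eq hA.regular]
  linarith

/-- Telescoping the potential `P + 16 κ² (μ_x/μ_y) (P - J)` along the centroids, for every
realization. -/
lemma sum_gradient_le (T : ℕ) (q : Sample K h Ξ) :
    ∑ i ∈ Finset.range T,
      (2 / 25 * (‖prob.gradJx (centroid (S i q).X) (centroid (S i q).Y)‖ ^ 2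
          + ‖prob.gradJy (centroid (S i q).X) (centroid (S i q).Y)‖ ^ 2)
        + 1 / 25 * ‖centroid (S i q).Mx‖ ^ 2 + 2 * (Lf / ν) ^ 2 * ‖centroid (S i q).My‖ ^ 2
        - 8 * (Lf / ν) ^ 2
          * (‖prob.gradJx (centroid (S i q).X) (centroid (S i q).Y) - centroid (S i q).Mx‖ ^ 2
            + ‖prob.gradJy (centroid (S i q).X) (centroid (S i q).Y) - centroid (S i q).My‖ ^ 2))
      ≤ (prob.P x₀ - prob.Pstar) / h.μx
        + 16 * (Lf / ν) ^ 2 * (prob.P x₀ - prob.J x₀ y₀) / h.μy := by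
  have hμx := hh.μx_pos
  have hμy := hh.μy_pos
  have hr := Problem.smoothRisk hA.regular hA.smooth hA.variance hA.one_le_K
  have hp := Problem.plRisk hA.pl
  set c := 16 * (Lf / ν) ^ 2 * h.μx / h.μy with hc
  have hc0 : 0 ≤ c := by positivity
  set w : ℕ → ℝ := fun i =>
    2 / 25 * (‖prob.gradJx (centroid (S i q).X) (centroid (S i q).Y)‖ ^ 2
          + ‖prob.gradJy (centroid (S i q).X) (centroid (S i q).Y)‖ ^ 2)
        + 1 / 25 * ‖centroid (S i q).Mx‖ ^ 2 + 2 * (Lf / ν) ^ 2 * ‖centroid (S i q).My‖ ^ 2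
        - 8 * (Lf / ν) ^ 2
          * (‖prob.gradJx (centroid (S i q).X) (centroid (S i q).Y) - centroid (S i q).Mx‖ ^ 2
            + ‖prob.gradJy (centroid (S i q).X) (centroid (S i q).Y) - centroid (S i q).My‖ ^ 2)
    with hw
  have htel : ∀ n, prob.P (centroid (S n q).X) + c * (prob.P (centroid (S n q).X)
      - prob.J (centroid (S n q).X) (centroid (S n q).Y)) + h.μx * ∑ i ∈ Finset.range n, w i
      ≤ prob.P x₀ + c * (prob.P x₀ - prob.J x₀ y₀) := by
    intro n
    induction n with
    | zero =>
      rw [hR.X_zero, hR.Y_zero, centroid_const hA.one_le_K, centroid_const hA.one_le_K]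
      simp
    | succ n ih =>
      have hstep := hr.potential_step hp hA.smooth.pos hA.le_Lf hμx hμy hh.μx_1 hh.μx_2 hh.μy_2
        (centroid (S n q).X) (centroid (S n q).Mx) (centroid (S n q).Y) (centroid (S n q).My)
      rw [hR.centroid_x hA, hR.centroid_y hA, Finset.sum_range_succ]
      simp only [← hc] at hstep
      have e : w n = 2 / 25 * (‖prob.gradJx (centroid (S n q).X) (centroid (S n q).Y)‖ ^ 2
          + ‖prob.gradJy (centroid (S n q).X) (centroid (S n q).Y)‖ ^ 2)
        + 1 / 25 * ‖centroid (S n q).Mx‖ ^ 2 + 2 * (Lf / ν) ^ 2 * ‖centroid (S n q).My‖ ^ 2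
        - 8 * (Lf / ν) ^ 2
          * (‖prob.gradJx (centroid (S n q).X) (centroid (S n q).Y) - centroid (S n q).Mx‖ ^ 2
            + ‖prob.gradJy (centroid (S n q).X) (centroid (S n q).Y)
              - centroid (S n q).My‖ ^ 2) := rfl
      rw [mul_add, e]
      linarith
  have h1 := htel T
  have h2 := Problem.Pstar_le hA.pl (centroid (S T q).X)
  have h3 := mul_nonneg hc0 (sub_nonneg.2 (hp.le_P (centroid (S T q).X) (centroid (S T q).Y)))
  have h4 : h.μx * ∑ i ∈ Finset.range T, w i
      ≤ h.μx * ((prob.P x₀ - prob.Pstar) / h.μx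
        + 16 * (Lf / ν) ^ 2 * (prob.P x₀ - prob.J x₀ y₀) / h.μy) := by
    have e : h.μx * ((prob.P x₀ - prob.Pstar) / h.μx
        + 16 * (Lf / ν) ^ 2 * (prob.P x₀ - prob.J x₀ y₀) / h.μy)
        = prob.P x₀ - prob.Pstar + c * (prob.P x₀ - prob.J x₀ y₀) := by
      rw [hc]; field_simp
    rw [e]
    simp only at h3
    linarith
  exact le_of_mul_le_mul_left h4 hμx

lemma sum_gradientSq_le (T : ℕ) :
    ∑ i ∈ Finset.range T, (2 / 25 * gradientSq P prob S i
        + 1 / 25 * ∫ q, ‖centroid (S i q).Mx‖ ^ 2 ∂P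
        + 2 * (Lf / ν) ^ 2 * ∫ q, ‖centroid (S i q).My‖ ^ 2 ∂P)
      ≤ (prob.P x₀ - prob.Pstar) / h.μx
        + 16 * (Lf / ν) ^ 2 * (prob.P x₀ - prob.J x₀ y₀) / h.μy
        + 8 * (Lf / ν) ^ 2 * ∑ i ∈ Finset.range T, gradientError P prob S i := by
  have := hA.law.prob
  have hpr := hR.prior hA hh
  have jx := fun i => ((hpr i).prior_gradJx hA).integrable_norm_sq
  have jy := fun i => ((hpr i).prior_gradJy hA).integrable_norm_sq
  have jmx := fun i => (prior_centroid (hpr i).Mx).integrable_norm_sq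
  have jmy := fun i => (prior_centroid (hpr i).My).integrable_norm_sq
  have jex := fun i => ((((hpr i).prior_gradJx hA).mono (Nat.le_succ i)).sub
    (prior_centroid (hpr i).Mx)).integrable_norm_sq
  have jey := fun i => ((((hpr i).prior_gradJy hA).mono (Nat.le_succ i)).sub
    (prior_centroid (hpr i).My)).integrable_norm_sq
  have jg := fun i => ((jx i).fun_add (jy i)).const_mul (2 / 25)
  have jm := fun i => (jg i).fun_add ((jmx i).const_mul (1 / 25))
  have js1 := fun i => (jm i).fun_add ((jmy i).const_mul (2 * (Lf / ν) ^ 2))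
  have js2 := fun i => ((jex i).fun_add (jey i)).const_mul (8 * (Lf / ν) ^ 2)
  have js := fun i => (js1 i).sub (js2 i)
  simp only [Pi.sub_def] at js
  have hint := integral_mono (integrable_finsetSum (Finset.range T) fun i _ => js i)
    (integrable_const (μ := P) _)
    (hR.sum_gradient_le hA hh T)
  rw [integral_const, probReal_univ, one_smul] at hint
  rw [← sub_le_iff_le_add, Finset.mul_sum, ← Finset.sum_sub_distrib]
  refine le_trans (le_of_eq ?_) hint
  rw [integral_finsetSum _ fun i _ => js i]
  refine Finset.sum_congr rfl fun i _ => ?_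
  rw [integral_sub (js1 i) (js2 i), integral_add (jm i) ((jmy i).const_mul _),
    integral_add (jg i) ((jmx i).const_mul _), integral_const_mul, integral_const_mul,
    integral_const_mul, integral_const_mul, integral_add (jx i) (jy i),
    integral_add (jex i) (jey i), gradientSq, gradientError]

/-- The expected errors of a run satisfy the recursions whose solution is the performance bound. -/
lemma errorRecursions (hSx : Sx.Bounds ρ lA lBi w₁ w₂) (hSy : Sy.Bounds ρ lA lBi w₁ w₂) (T : ℕ) :
    ErrorRecursions h K T Lf ν ρ lA lBi (w₁ * w₂) (σ ^ 2 / h.b₀)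
      ((h.p / h.B * prob.data.onlineIndicator + h.β ^ 2 / h.b) * σ ^ 2)
      (prob.P x₀ - prob.Pstar) (prob.P x₀ - prob.J x₀ y₀) (zetaSq P Dx Dy (S 0))
      (consensusError P S) (trackingError P prob S) (meanTrackingError P prob S)
      (estimateIncrement P S) (displacement P S) (fun i => ∫ q, ‖centroid (S i q).Mx‖ ^ 2 ∂P)
      (fun i => ∫ q, ‖centroid (S i q).My‖ ^ 2 ∂P) (gradientError P prob S)
      (gradientSq P prob S) where
  D_nonneg i := by
    refine mul_nonneg (by positivity) (add_nonneg ?_ ?_) <;>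
      exact integral_nonneg fun q => deviation_nonneg _
  N_nonneg i := by
    refine mul_nonneg (by positivity) (add_nonneg ?_ ?_) <;>
      exact integral_nonneg fun q => blockNormSq_nonneg _
  F_nonneg i := by
    refine add_nonneg ?_ ?_ <;> exact integral_nonneg fun q => sq_nonneg _
  mx_nonneg i := integral_nonneg fun q => sq_nonneg _
  my_nonneg i := integral_nonneg fun q => sq_nonneg _
  move := hR.displacement_le hA hh
  consensus := hR.sum_consensusError_le hA hh hSx hSy T
  N_zero := hR.trackingError_zero_le hA hh
  N_succ := hR.trackingError_succ_le hA hh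
  F_zero := hR.meanTrackingError_zero_le hA hh
  F_succ := hR.meanTrackingError_succ_le hA hh
  increment := hR.estimateIncrement_le hA hh
  error := hR.gradientError_le hA hh
  potential := hR.sum_gradientSq_le hA hh T

end IsRun
end Runs

end DAMA

end

theorem theorem1 :
    ∃ C : ℝ, 0 < C ∧
      ∀ (K d₁ d₂ : ℕ) (_hK : 1 ≤ K)
        (Ξ : Type*) [MeasurableSpace Ξ] (prob : DAMA.Problem K d₁ d₂ Ξ)
        (ν Lf σ : ℝ)
        (_hreg : prob.Regular) (_hPL : prob.PLCondition ν) (_hsmooth : prob.ExpectedSmooth Lf)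
        (_hvar : prob.BoundedVariance σ) (_hκ : ν ≤ Lf)
        (W : Matrix (Fin K) (Fin K) ℝ) (_hW : W ∈ doublyStochastic ℝ (Fin K)) (_hWs : W.IsSymm)
        (Dx Dy : DAMA.Design K) (_hDx : Dx.Admissible W) (_hDy : Dy.Admissible W)
        (Sx : DAMA.Spectral Dx d₁) (Sy : DAMA.Spectral Dy d₂) (_hρ : DAMA.rho Sx Sy < 1)
        (h : DAMA.Hyper)
        (_hh : h.Conditions K Lf ν (DAMA.rho Sx Sy) (DAMA.lamA Sx Sy) (DAMA.lamBInv Sx Sy)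
          (DAMA.v₁ Sx Sy * DAMA.v₂ Sx Sy))
        (Ω : Type*) [MeasurableSpace Ω] (Pr : Measure Ω) [IsProbabilityMeasure Pr]
        (ξ : DAMA.SampleIdx K h → Ω → Ξ) (π : ℕ → Ω → Bool)
        (_hs : DAMA.IsSampling Pr prob.data h ξ π)
        (x₀ dx₀ : DAMA.Vec d₁) (y₀ dy₀ : DAMA.Vec d₂) (T : ℕ) (_hT : 1 ≤ T),
        let S : ℕ → Ω → DAMA.State K d₁ d₂ := fun i ω =>
          DAMA.iterate prob Dx Dy h x₀ y₀ dx₀ dy₀ (fun a => ξ a ω) (fun j => π j ω) i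
        let xc : ℕ → Ω → DAMA.Vec d₁ := fun i ω => DAMA.centroid (S i ω).X
        let yc : ℕ → Ω → DAMA.Vec d₂ := fun i ω => DAMA.centroid (S i ω).Y
        (∀ i, Integrable (fun ω => ‖prob.gradJx (xc i ω) (yc i ω)‖ ^ 2) Pr
          ∧ Integrable (fun ω => ‖prob.gradJy (xc i ω) (yc i ω)‖ ^ 2) Pr) ∧
        (T : ℝ)⁻¹ * ∑ i ∈ Finset.range T,
            ((∫ ω, ‖prob.gradJx (xc i ω) (yc i ω)‖ ^ 2 ∂Pr)
              + ∫ ω, ‖prob.gradJy (xc i ω) (yc i ω)‖ ^ 2 ∂Pr)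
          ≤ C * DAMA.performanceBound h K T Lf ν σ (DAMA.rho Sx Sy) (DAMA.lamA Sx Sy)
              (DAMA.lamBInv Sx Sy) (DAMA.v₁ Sx Sy * DAMA.v₂ Sx Sy) prob.data.onlineIndicator
              (∫ ω, (prob.P (xc 0 ω) - prob.Pstar) ∂Pr)
              (∫ ω, (prob.P (xc 0 ω) - prob.J (xc 0 ω) (yc 0 ω)) ∂Pr)
              (DAMA.zetaSq Pr Dx Dy (S 0)) := by
  refine ⟨75000, by norm_num, ?_⟩
  intro K d₁ d₂ hK Ξ _ prob ν Lf σ hreg hPL hsm hvar hκ W _ hWs Dx Dy hDx hDy Sx Sy hρ h hh Ω _ Pr _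
    ξ π hs x₀ dx₀ y₀ dy₀ T hT S xc yc
  have hp1 : h.p ≤ 1 := by linarith [hh.p_add_β, hh.β_nonneg]
  -- all expectations are computed under the joint law of the samples and flags
  set Φ : Ω → DAMA.Sample K h Ξ := fun ω => (fun a => ξ a ω, fun j => π j ω) with hΦ
  have hΦm : AEMeasurable Φ Pr :=
    ((measurable_pi_lambda _ hs.measurable_ξ).prodMk
      (measurable_pi_lambda _ hs.measurable_π)).aemeasurable
  have hlaw : DAMA.IsSampleLaw (Pr.map Φ) prob.data := hs.isSampleLaw hh.p_nonneg hp1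
  have hA : DAMA.Setting (Pr.map Φ) prob ν Lf σ W Dx Dy :=
    ⟨hlaw, hK, hreg, hPL, hsm, hvar, hκ, hWs, hDx, hDy⟩
  have hR := DAMA.isRun_iterate (h := h) prob Dx Dy x₀ dx₀ y₀ dy₀
  have hpr := hR.prior hA hh
  have jx := fun i => ((hpr i).prior_gradJx hA).integrable_norm_sq
  have jy := fun i => ((hpr i).prior_gradJy hA).integrable_norm_sq
  refine ⟨fun i => ⟨(integrable_map_measure (jx i).aestronglyMeasurable hΦm).1 (jx i),
    (integrable_map_measure (jy i).aestronglyMeasurable hΦm).1 (jy i)⟩, ?_⟩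
  have hSx : Sx.Bounds (DAMA.rho Sx Sy) (DAMA.lamA Sx Sy) (DAMA.lamBInv Sx Sy) (DAMA.v₁ Sx Sy)
      (DAMA.v₂ Sx Sy) :=
    ⟨le_max_left _ _, hρ, le_max_left _ _, le_max_left _ _, le_max_left _ _, le_max_left _ _⟩
  have hSy : Sy.Bounds (DAMA.rho Sx Sy) (DAMA.lamA Sx Sy) (DAMA.lamBInv Sx Sy) (DAMA.v₁ Sx Sy)
      (DAMA.v₂ Sx Sy) :=
    ⟨le_max_right _ _, hρ, le_max_right _ _, le_max_right _ _, le_max_right _ _, le_max_right _ _⟩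
  have hx0 : ∀ ω, xc 0 ω = x₀ := fun _ => DAMA.centroid_const hK x₀
  have hy0 : ∀ ω, yc 0 ω = y₀ := fun _ => DAMA.centroid_const hK y₀
  have hG : ∀ i, (∫ ω, ‖prob.gradJx (xc i ω) (yc i ω)‖ ^ 2 ∂Pr)
      + ∫ ω, ‖prob.gradJy (xc i ω) (yc i ω)‖ ^ 2 ∂Pr
      = DAMA.gradientSq (Pr.map Φ) prob
        (fun i q => DAMA.iterate prob Dx Dy h x₀ y₀ dx₀ dy₀ q.1 q.2 i) i := by
    intro i
    rw [DAMA.gradientSq, integral_map hΦm (jx i).aestronglyMeasurable,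
      integral_map hΦm (jy i).aestronglyMeasurable]
  have hζ : DAMA.zetaSq (Pr.map Φ) Dx Dy
      (fun q => DAMA.iterate prob Dx Dy h x₀ y₀ dx₀ dy₀ q.1 q.2 0)
      = DAMA.zetaSq Pr Dx Dy (S 0) := by
    have zx := DAMA.integrable_blockNormSq (DAMA.prior_act (Dx.A - DAMA.avgMatrix K) (hpr 0).Mx)
    have zy := DAMA.integrable_blockNormSq (DAMA.prior_act (Dy.A - DAMA.avgMatrix K) (hpr 0).My)
    rw [DAMA.zetaSq, DAMA.zetaSq, integral_map hΦm zx.aestronglyMeasurable,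
      integral_map hΦm zy.aestronglyMeasurable]
  have hζ0 : 0 ≤ DAMA.zetaSq Pr Dx Dy (S 0) := by
    refine add_nonneg (mul_nonneg (by positivity) ?_) (mul_nonneg (by positivity) ?_) <;>
      exact integral_nonneg fun _ => DAMA.blockNormSq_nonneg _
  have hH := hR.errorRecursions hA hh hSx hSy T
  rw [hζ] at hH
  simp only [hG, hx0, hy0, integral_const, probReal_univ, one_smul]
  exact hH.average_le hh hK hT hsm.pos hPL.pos hρ
    (mul_nonneg ((DAMA.specNorm_nonneg _).trans hSx.Q_le)
      ((DAMA.specNorm_nonneg _).trans hSx.Qinv_le))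
    ((DAMA.specNorm_nonneg _).trans hSx.A_le) ((DAMA.specNorm_nonneg _).trans hSx.B_le)
    (DAMA.Oracle.onlineIndicator_nonneg _) hζ0 (sub_nonneg.2 (DAMA.Problem.Pstar_le hPL x₀))
    (sub_nonneg.2 ((DAMA.Problem.plRisk hPL).le_P x₀ y₀))
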